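/- Let $l,m,k$ be positive integers, $n=l+m+k$, and let $\lambda,\mu$ be complex numbers with $\lambda,\mu,0$ pairwise distinct. Put $q=e^h\in\mathbb C[[h]]$, $\hat a=\sum_{i=1}^{a}q^{-2i+2}$, $\mathrm{Tr}_q(L)=\sum_{i=1}^n q^{-2i+2}L_{ii}$. Let $e_{ij}$ be the matrix units, $P=\sum_{i,j} e_{ij}\otimes e_{ji}$ the permutation matrix and $S=PR$, where $$R=q\sum_i e_{ii}\otimes e_{ii}+\sum_{i\ne j}e_{ii}\otimes e_{jj}+(q-q^{-1})\sum_{i<k'}e_{k'i}\otimes e_{ik'}.$$ Let $\mathcal A_h(O_{[l,m,k;\lambda,\mu,0]})$ be the $h$-adically complete $\mathbb C[[h]]$-algebra (the quotient of the completed free algebra $\mathbb C\langle E_{ij}\rangle[[h]]$ by the closed two-sided ideal) with generators the entries of an $n\times n$ matrix $E$ and relations $$SE_2SE_2=E_2SE_2S\quad(E_2=1\otimes E),\qquad E(E-\lambda)(E-\mu)=0,$$ $$\mathrm{Tr}_q(E)=\lambda\hat l+\mu\hat m,\qquad \mathrm{Tr}_q(E^2)=(\lambda+\mu)(\lambda\hat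 l+\mu\hat m)-\lambda\mu\,\widehat{l+m},$$ and let $\mathcal A_h(O_{[l+m,k;-\lambda\mu,0]})$ be the one with generators the entries of an $n\times n$ matrix $B$ and relations $$SB_2SB_2=B_2SB_2S,\qquad (B+\lambda\mu)B=0,\qquad \mathrm{Tr}_q(B)=-\lambda\mu\,\widehat{l+m}.$$ Let $\mathcal U_h(gl(n))$ be the standard (Drinfeld-Jimbo) quantum group over $\mathbb C[[h]]$, with generators $H_a,E_i,F_i$, $K_i=q^{H_i-H_{i+1}}$, coproduct $\Delta H_a=H_a\otimes1+1\otimes H_a$, $\Delta E_i=E_i\otimes 1+K_i\otimes E_i$, $\Delta F_i=F_i\otimes K_i^{-1}+1\otimes F_i$, counit $\varepsilon$ vanishing on $H_a,E_i,F_i$, antipode $\gamma$, and vector representation $\rho$. Then: 1. On each of the two algebras there is a unique structure of a left $\mathcal U_h(gl(n))$-module algebra with $x\triangleright L=\rho(\gamma(x_{(1)}))\,L\,\rho(x_{(2)})$ for its generating matrix $L=E$, respectively $L=B$. 2. The matrix correspondence $\pi(B)=E^2-(\lambda+\mu)E$ extends uniquely to a morphism of $\mathbb C[[h]]$-algebras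 $\pi:\mathcal A_h(O_{[l+m,k;-\lambda\mu,0]})\to\mathcal A_h(O_{[l,m,k;\lambda,\mu,0]})$, and $\pi$ is $\mathcal U_h(gl(n))$-equivariant. 3. Modulo $h$, $\pi$ is the pullback of functions along the homogeneous fiber bundle $O_{[l,m,k]}\to O_{[l+m,k]}$. Namely, let $D=\mathrm{diag}(\lambda,\dots,\lambda,\mu,\dots,\mu,0,\dots,0)$ with multiplicities $l,m,k$, let $D'=\mathrm{diag}(-\lambda\mu,\dots,-\lambda\mu,0,\dots,0)$ with multiplicities $l+m,k$, and let $O_D=\{g^{-1}Dg\}$ and $O_{D'}=\{g^{-1}D'g\}$, $g\in GL(n,\mathbb C)$, be their orbits. Then sending generators to coordinate functions and $h$ to $0$ induces isomorphisms of $\mathcal A_h(O_{[l,m,k;\lambda,\mu,0]})/h$ and $\mathcal A_h(O_{[l+m,k;-\lambda\mu,0]})/h$ with the algebras of polynomial functions on $O_D$ and $O_{D'}$; there is a well-defined map $p:O_D\to O_{D'}$, $g^{-1}Dg\mapsto g^{-1}D'g$ (the coset projection $G_{[l,m,k]}g\mapsto G_{[l+m,k]}g$ for the subgroups $G_{[l,m,k]}\subset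 G_{[l+m,k]}$ of block-diagonal matrices in $GL(n,\mathbb C)$); and under these isomorphisms $\pi$ modulo $h$ is $f\mapsto f\circ p$. -/

import Mathlib

open scoped Kronecker

noncomputable section

namespace QuantumOrbit

/-! ### Complete algebras over `ℂ⟦h⟧` given by generators and relations -/

/-- The ring of scalars `ℂ[[h]]`; the deformation parameter `h` is `PowerSeries.X`. -/
abbrev Scal : Type := PowerSeries ℂ

/-- The `h`-adically completed free algebra `T(ℂX)[[h]]` on a set `X` of generators: formal power
series in the central variable `h` with coefficients in the free associative algebra `ℂ⟨X⟩`. -/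
abbrev CFree (X : Type) : Type := PowerSeries (FreeAlgebra ℂ X)

theorem scal_commutes (X : Type) (c : Scal) (x : CFree X) :
    PowerSeries.map (algebraMap ℂ (FreeAlgebra ℂ X)) c * x =
      x * PowerSeries.map (algebraMap ℂ (FreeAlgebra ℂ X)) c := by
  ext n
  rw [PowerSeries.coeff_mul, PowerSeries.coeff_mul, ← Finset.Nat.sum_antidiagonal_swap]
  refine Finset.sum_congr rfl fun p _ => ?_
  simp only [PowerSeries.coeff_map, Prod.fst_swap, Prod.snd_swap]
  exact Algebra.commutes _ _

/-- `ℂ[[h]]` acts on `ℂ⟨X⟩[[h]]` through the coefficientwise inclusion `ℂ[[h]] ⊆ ℂ⟨X⟩[[h]]`. -/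
instance instAlgebraCFree (X : Type) : Algebra Scal (CFree X) :=
  RingHom.toAlgebra' (PowerSeries.map (algebraMap ℂ (FreeAlgebra ℂ X))) (scal_commutes X)

/-- A generator, viewed in the completed free algebra. -/
def gen {X : Type} (x : X) : CFree X := PowerSeries.C (FreeAlgebra.ι ℂ x)

/-- The `h`-adically closed two-sided ideal generated by a set `s`, that is
`⋂ N, (s) + (h ^ N)`. -/
def closedIdeal {X : Type} (s : Set (CFree X)) : TwoSidedIdeal (CFree X) :=
  ⨅ N : ℕ, TwoSidedIdeal.span (s ∪ {(PowerSeries.X : CFree X) ^ N})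

/-- The complete `ℂ[[h]]`-algebra with generators `X` subject to the relations `r = 0`, `r ∈ s`. -/
abbrev Presented {X : Type} (s : Set (CFree X)) : Type := (closedIdeal s).ringCon.Quotient

/-- The quotient map onto the algebra with relations `s`. -/
def toPresented {X : Type} (s : Set (CFree X)) : CFree X →+* Presented s :=
  (closedIdeal s).ringCon.mk'

/-- The exponential `e^{hx} = ∑ h^k x^k / k!` in `R[[h]]`, for `x ∈ R`. -/
def expH {R : Type} [Ring R] [Algebra ℂ R] (x : R) : PowerSeries R :=
  PowerSeries.mk fun k => ((Nat.factorial k : ℂ)⁻¹) • x ^ k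

/-- `q ^ z`, where `q = e^h`. -/
def qpow (z : ℤ) : Scal := expH (z : ℂ)

/-- The quantum integer `1 + q⁻² + ⋯ + q^{-2(a-1)}`. -/
def qInt (a : ℕ) : Scal := ∑ i ∈ Finset.range a, qpow (-2 * (i : ℤ))

/-- Division of a power series by `h` (the constant term is dropped). -/
def divH {R : Type} [Ring R] (f : PowerSeries R) : PowerSeries R :=
  PowerSeries.mk fun k => PowerSeries.coeff (k + 1) f

/-- `(e^{hx} - e^{-hx}) / (e^h - e^{-h})`: numerator and denominator are both divisible by `h`,
and after division by `h` the denominator is invertible in `ℂ[[h]]`. -/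
def qSinh {X : Type} (x : FreeAlgebra ℂ X) : CFree X :=
  (divH (expH (1 : ℂ) - expH (-1 : ℂ)))⁻¹ • (divH (expH x - expH (-x)) : CFree X)

/-! ### The standard (Drinfeld-Jimbo) quantum group of `gl(n, ℂ)` -/

/-- Generators: the diagonal matrix units `H a` and the simple root vectors `E i`, `F i`. -/
inductive UhGen (n : ℕ) : Type
  | H (a : Fin n)
  | E (i : Fin (n - 1))
  | F (i : Fin (n - 1))

/-- The `i`-th simple root is `ε_{lo i} - ε_{hi i}`. -/
def lo {n : ℕ} (i : Fin (n - 1)) : Fin n := ⟨i.val, by omega⟩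

/-- The `i`-th simple root is `ε_{lo i} - ε_{hi i}`. -/
def hi {n : ℕ} (i : Fin (n - 1)) : Fin n := ⟨i.val + 1, by omega⟩

/-- The value of the `i`-th simple root on the `a`-th diagonal matrix unit. -/
def rootVal {n : ℕ} (a : Fin n) (i : Fin (n - 1)) : Scal :=
  (if a = lo i then 1 else 0) - (if a = hi i then 1 else 0)

/-- Neighbouring vertices of the Dynkin diagram. -/
def Adjacent {n : ℕ} (i j : Fin (n - 1)) : Prop := i.val + 1 = j.val ∨ j.val + 1 = i.val

/-- The quantum Serre expression `x² y - (q + q⁻¹) x y x + y x²`. -/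
def serre {X : Type} (x y : CFree X) : CFree X :=
  x * x * y - (qpow 1 + qpow (-1)) • (x * y * x) + y * x * x

/-- The coroot `H_{lo i} - H_{hi i}` in the free algebra. -/
def coroot {n : ℕ} (i : Fin (n - 1)) : FreeAlgebra ℂ (UhGen n) :=
  FreeAlgebra.ι ℂ (UhGen.H (lo i)) - FreeAlgebra.ι ℂ (UhGen.H (hi i))

/-- The Drinfeld-Jimbo relations (each element is set equal to zero). -/
inductive UhRel (n : ℕ) : CFree (UhGen n) → Prop
  | HH (a b : Fin n) :
      UhRel n (gen (.H a) * gen (.H b) - gen (.H b) * gen (.H a))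
  | HE (a : Fin n) (i : Fin (n - 1)) :
      UhRel n (gen (.H a) * gen (.E i) - gen (.E i) * gen (.H a) - rootVal a i • gen (.E i))
  | HF (a : Fin n) (i : Fin (n - 1)) :
      UhRel n (gen (.H a) * gen (.F i) - gen (.F i) * gen (.H a) + rootVal a i • gen (.F i))
  | EF (i : Fin (n - 1)) :
      UhRel n (gen (.E i) * gen (.F i) - gen (.F i) * gen (.E i) - qSinh (coroot i))
  | EF_ne (i j : Fin (n - 1)) : i ≠ j →
      UhRel n (gen (.E i) * gen (.F j) - gen (.F j) * gen (.E i))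
  | EE (i j : Fin (n - 1)) : i ≠ j → ¬ Adjacent i j →
      UhRel n (gen (.E i) * gen (.E j) - gen (.E j) * gen (.E i))
  | FF (i j : Fin (n - 1)) : i ≠ j → ¬ Adjacent i j →
      UhRel n (gen (.F i) * gen (.F j) - gen (.F j) * gen (.F i))
  | serreE (i j : Fin (n - 1)) : Adjacent i j → UhRel n (serre (gen (.E i)) (gen (.E j)))
  | serreF (i j : Fin (n - 1)) : Adjacent i j → UhRel n (serre (gen (.F i)) (gen (.F j)))

/-- The quantum group `U_h(gl(n, ℂ))`, as a complete `ℂ[[h]]`-algebra. -/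
abbrev Uh (n : ℕ) : Type := Presented {x : CFree (UhGen n) | UhRel n x}

namespace Uh

variable {n : ℕ}

/-- The generator `H_a`. -/
def H (a : Fin n) : Uh n := toPresented _ (gen (.H a))

/-- The generator `E_i`. -/
def E (i : Fin (n - 1)) : Uh n := toPresented _ (gen (.E i))

/-- The generator `F_i`. -/
def F (i : Fin (n - 1)) : Uh n := toPresented _ (gen (.F i))

/-- `K_i = q^{H_i - H_{i+1}}`. -/
def K (i : Fin (n - 1)) : Uh n := toPresented _ (expH (coroot i))

/-- `K_i⁻¹ = q^{-(H_i - H_{i+1})}`. -/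
def Kinv (i : Fin (n - 1)) : Uh n := toPresented _ (expH (-coroot i))

end Uh

/-- A representation `act` of `U_h(gl(n, ℂ))` on an algebra `A` makes `A` a module algebra:
`x ▷ (a b) = (x₁ ▷ a) (x₂ ▷ b)` and `x ▷ 1 = ε(x) 1`, where the Hopf structure is
`Δ H = H ⊗ 1 + 1 ⊗ H`, `Δ E = E ⊗ 1 + K ⊗ E`, `Δ F = F ⊗ K⁻¹ + 1 ⊗ F`,
`ε(H) = ε(E) = ε(F) = 0`. As `Δ` and `ε` are (continuous) algebra morphisms, these identities for
the generators `x = H_a, E_i, F_i` give them for all `x`. -/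
structure IsModuleAlgebra {n : ℕ} {A : Type} [Ring A] [Algebra Scal A]
    (act : Uh n →ₐ[Scal] Module.End Scal A) : Prop where
  mul_H : ∀ (r : Fin n) (a b : A),
    act (Uh.H r) (a * b) = act (Uh.H r) a * b + a * act (Uh.H r) b
  mul_E : ∀ (i : Fin (n - 1)) (a b : A),
    act (Uh.E i) (a * b) = act (Uh.E i) a * b + act (Uh.K i) a * act (Uh.E i) b
  mul_F : ∀ (i : Fin (n - 1)) (a b : A),
    act (Uh.F i) (a * b) = act (Uh.F i) a * act (Uh.Kinv i) b + a * act (Uh.F i) b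
  one_H : ∀ r : Fin n, act (Uh.H r) 1 = 0
  one_E : ∀ i : Fin (n - 1), act (Uh.E i) 1 = 0
  one_F : ∀ i : Fin (n - 1), act (Uh.F i) 1 = 0

/-! ### The vector representation and the coadjoint action on matrices -/

/-- A scalar matrix with entries in `ℂ[[h]]`, viewed as a matrix over a `ℂ[[h]]`-algebra. -/
def toMat (A : Type) [Ring A] [Algebra Scal A] {ι : Type} (M : Matrix ι ι Scal) : Matrix ι ι A :=
  M.map (algebraMap Scal A)

section vector

variable {n : ℕ}

/-- The vector representation on `H_a`. -/
def rhoH (a : Fin n) : Matrix (Fin n) (Fin n) Scal := Matrix.single a a 1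

/-- The vector representation on `E_i`. -/
def rhoE (i : Fin (n - 1)) : Matrix (Fin n) (Fin n) Scal := Matrix.single (lo i) (hi i) 1

/-- The vector representation on `F_i`. -/
def rhoF (i : Fin (n - 1)) : Matrix (Fin n) (Fin n) Scal := Matrix.single (hi i) (lo i) 1

/-- The vector representation on `K_i`. -/
def rhoK (i : Fin (n - 1)) : Matrix (Fin n) (Fin n) Scal :=
  Matrix.diagonal fun a => if a = lo i then qpow 1 else if a = hi i then qpow (-1) else 1

/-- The vector representation on `K_i⁻¹`. -/
def rhoKinv (i : Fin (n - 1)) : Matrix (Fin n) (Fin n) Scal :=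
  Matrix.diagonal fun a => if a = lo i then qpow (-1) else if a = hi i then qpow 1 else 1

end vector

/-- The action is the coadjoint one on the entries of the matrix `L`:
`x ▷ L = ρ(γ(x₁)) L ρ(x₂)` for the generators `x`, with the antipode
`γ(H) = -H`, `γ(E) = -K⁻¹ E`, `γ(F) = -F K`, `γ(K) = K⁻¹`. -/
structure IsCoadjointOn {n : ℕ} {A : Type} [Ring A] [Algebra Scal A]
    (act : Uh n →ₐ[Scal] Module.End Scal A) (L : Matrix (Fin n) (Fin n) A) : Prop where
  on_H : ∀ r : Fin n, L.map (act (Uh.H r)) = -toMat A (rhoH r) * L + L * toMat A (rhoH r)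
  on_E : ∀ i : Fin (n - 1), L.map (act (Uh.E i)) =
    -toMat A (rhoKinv i * rhoE i) * L + toMat A (rhoKinv i) * L * toMat A (rhoE i)
  on_F : ∀ i : Fin (n - 1), L.map (act (Uh.F i)) =
    -toMat A (rhoF i * rhoK i) * L * toMat A (rhoKinv i) + L * toMat A (rhoF i)

/-! ### The reflection equation and the quantized orbits -/

/-- The permutation matrix `P = ∑ e^i_j ⊗ e^j_i`. -/
def permMat (n : ℕ) : Matrix (Fin n × Fin n) (Fin n × Fin n) Scal :=
  ∑ i, ∑ j, Matrix.single i j 1 ⊗ₖ Matrix.single j i 1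

/-- The standard `R`-matrix of `U_h(gl(n, ℂ))` in the vector representation. -/
def rMat (n : ℕ) : Matrix (Fin n × Fin n) (Fin n × Fin n) Scal :=
  qpow 1 • (∑ i, Matrix.single i i 1 ⊗ₖ Matrix.single i i 1)
    + (∑ i, ∑ j ∈ Finset.univ.filter (fun j => i ≠ j),
        Matrix.single i i 1 ⊗ₖ Matrix.single j j 1)
    + (qpow 1 - qpow (-1)) • (∑ i, ∑ k ∈ Finset.univ.filter (fun k => i < k),
        Matrix.single k i 1 ⊗ₖ Matrix.single i k 1)

/-- The braid matrix `S = P R`. -/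
def sMat (n : ℕ) : Matrix (Fin n × Fin n) (Fin n × Fin n) Scal := permMat n * rMat n

section matrices

variable {n : ℕ} {A : Type} [Ring A] [Algebra Scal A]

/-- `S L₂ S L₂ - L₂ S L₂ S`, where `L₂ = 1 ⊗ L`. -/
def reflectionDefect (L : Matrix (Fin n) (Fin n) A) :
    Matrix (Fin n × Fin n) (Fin n × Fin n) A :=
  let S := toMat A (sMat n)
  let L₂ := (1 : Matrix (Fin n) (Fin n) A) ⊗ₖ L
  S * L₂ * S * L₂ - L₂ * S * L₂ * S

/-- The quantum trace `∑ q^{-2i+2} L^i_i` (`i = 1, …, n`; here the indices start from `0`). -/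
def qTrace (L : Matrix (Fin n) (Fin n) A) : A := ∑ i : Fin n, qpow (-2 * (i.val : ℤ)) • L i i

/-- The scalar matrix with the complex number `c` on the diagonal. -/
def cMat (n : ℕ) (A : Type) [Ring A] [Algebra Scal A] (c : ℂ) : Matrix (Fin n) (Fin n) A :=
  toMat A (Matrix.diagonal fun _ => PowerSeries.C c)

end matrices

/-- The matrix of generators in the completed free algebra on `n × n` generators. -/
def freeGenMatrix (n : ℕ) : Matrix (Fin n) (Fin n) (CFree (Fin n × Fin n)) :=
  fun i j => gen (i, j)

/-- The relations of the quantized orbit of matrices with the eigenvalues `a`, `b` of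
multiplicities `r`, `s` (where `r + s = n`): the reflection equation,
`(L - a)(L - b) = 0` and `Tr_q L = a r̂ + b ŝ`. -/
inductive SymRel (n r s : ℕ) (a b : ℂ) : CFree (Fin n × Fin n) → Prop
  | reflection (i j : Fin n × Fin n) :
      SymRel n r s a b (reflectionDefect (freeGenMatrix n) i j)
  | poly (i j : Fin n) :
      SymRel n r s a b (((freeGenMatrix n - cMat n (CFree (Fin n × Fin n)) a) * (freeGenMatrix n - cMat n (CFree (Fin n × Fin n)) b)) i j)
  | trace :
      SymRel n r s a b (qTrace (freeGenMatrix n) -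
        algebraMap Scal _ (PowerSeries.C a * qInt r + PowerSeries.C b * qInt s))

/-- The relations of the quantized orbit of matrices with the eigenvalues `a`, `b`, `0` of
multiplicities `r`, `s`, `n - r - s`: the reflection equation, `L (L - a)(L - b) = 0`,
`Tr_q L = a r̂ + b ŝ` and `Tr_q L² = (a + b)(a r̂ + b ŝ) - a b (r + s)^`. -/
inductive BisymRel (n r s : ℕ) (a b : ℂ) : CFree (Fin n × Fin n) → Prop
  | reflection (i j : Fin n × Fin n) :
      BisymRel n r s a b (reflectionDefect (freeGenMatrix n) i j)
  | poly (i j : Fin n) :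
      BisymRel n r s a b ((freeGenMatrix n * (freeGenMatrix n - cMat n (CFree (Fin n × Fin n)) a) *
        (freeGenMatrix n - cMat n (CFree (Fin n × Fin n)) b)) i j)
  | trace :
      BisymRel n r s a b (qTrace (freeGenMatrix n) -
        algebraMap Scal _ (PowerSeries.C a * qInt r + PowerSeries.C b * qInt s))
  | trace_sq :
      BisymRel n r s a b (qTrace (freeGenMatrix n * freeGenMatrix n) -
        algebraMap Scal _
          (PowerSeries.C (a + b) * (PowerSeries.C a * qInt r + PowerSeries.C b * qInt s)
            - PowerSeries.C (a * b) * qInt (r + s)))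

/-- The quantized bisymmetric orbit `A_h(O_{[l,m,k;a,b,0]})`. -/
abbrev BisymOrbitAlg (l m k : ℕ) (a b : ℂ) : Type :=
  Presented {x : CFree (Fin (l + m + k) × Fin (l + m + k)) | BisymRel (l + m + k) l m a b x}

/-- The quantized symmetric orbit `A_h(O_{[r,s;a,b]})`. -/
abbrev SymOrbitAlg (r s : ℕ) (a b : ℂ) : Type :=
  Presented {x : CFree (Fin (r + s) × Fin (r + s)) | SymRel (r + s) r s a b x}

/-- The generating RE matrix of `A_h(O_{[l,m,k;a,b,0]})`. -/
def bisymMatrix (l m k : ℕ) (a b : ℂ) :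
    Matrix (Fin (l + m + k)) (Fin (l + m + k)) (BisymOrbitAlg l m k a b) :=
  (freeGenMatrix (l + m + k)).map (toPresented _)

/-- The generating RE matrix of `A_h(O_{[r,s;a,b]})`. -/
def symMatrix (r s : ℕ) (a b : ℂ) : Matrix (Fin (r + s)) (Fin (r + s)) (SymOrbitAlg r s a b) :=
  (freeGenMatrix (r + s)).map (toPresented _)

/-! ### Classical orbits and classical limits -/

/-- The orbit `{g⁻¹ D g | g ∈ GL(n, ℂ)}`; the point `g⁻¹ D g` corresponds to the right coset `H g`
of the stabilizer `H` of `D`. -/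
def conjOrbit {n : ℕ} (D : Matrix (Fin n) (Fin n) ℂ) : Set (Matrix (Fin n) (Fin n) ℂ) :=
  {M | ∃ g : GL (Fin n) ℂ, M = (g⁻¹ : GL (Fin n) ℂ).val * D * g.val}

/-- The base point `diag(a, …, a, b, …, b, 0, …, 0)` of `O_{[l,m,k;a,b,0]}`; its stabilizer is
`GL(l) × GL(m) × GL(k)` when `a`, `b`, `0` are distinct. -/
def bisymPoint (l m k : ℕ) (a b : ℂ) : Matrix (Fin (l + m + k)) (Fin (l + m + k)) ℂ :=
  Matrix.diagonal fun i => if i.val < l then a else if i.val < l + m then b else 0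

/-- The base point `diag(a, …, a, b, …, b)` of `O_{[r,s;a,b]}`; its stabilizer is
`GL(r) × GL(s)` when `a ≠ b`. -/
def symPoint (r s : ℕ) (a b : ℂ) : Matrix (Fin (r + s)) (Fin (r + s)) ℂ :=
  Matrix.diagonal fun i => if i.val < r then a else b

/-- The algebra `A(O)` of polynomial functions on a set `O` of matrices. -/
def polyFun {n : ℕ} (O : Set (Matrix (Fin n) (Fin n) ℂ)) : Subalgebra ℂ (O → ℂ) :=
  Algebra.adjoin ℂ {f | ∃ i j : Fin n, f = fun M => M.val i j}

/-- `cl` exhibits `A / h A` as the algebra of polynomial functions on `O`, the entries of the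
matrix `L` going to the coordinate functions: `cl` is the reduction modulo `h`. -/
structure IsClassicalLimit {n : ℕ} {A : Type} [Ring A] [Algebra Scal A]
    (L : Matrix (Fin n) (Fin n) A) (O : Set (Matrix (Fin n) (Fin n) ℂ))
    (cl : A →+* polyFun O) : Prop where
  scalars : ∀ c : Scal, cl (algebraMap Scal A c) =
    algebraMap ℂ (polyFun O) (PowerSeries.constantCoeff c)
  entries : ∀ (i j : Fin n) (M : O), (cl (L i j) : O → ℂ) M = M.val i j
  surjective : Function.Surjective cl
  ker : ∀ a : A, cl a = 0 ↔ ∃ b : A, a = (PowerSeries.X : Scal) • b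

end QuantumOrbit

end

open QuantumOrbit

/-!
The algebras in question are presented by generators and relations over `ℂ⟦h⟧`, so morphisms out
of them are built by checking relations, and linear maps out of them are compared on words in the
generators (`liftP`, `presented_linearMap_ext`); both steps rest on `h`-adic completeness of the
target (`HComplete`).

**The action.** If `G` is an invertible matrix with the `RTT` relation `S G₁ G₂ = G₁ G₂ S`, whose
entries commute with those of `L`, then `G⁻¹ L G` satisfies every relation that `L` does
(`IsGauge`, `gaugeInvariant_bisymRel`). The vector representation supplies such matrices: `ρ(K)`
with scalar entries, and for each of `H`, `E`, `F` a triangular matrix of size two over scalars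
whose off-diagonal entry is `ρ(H)`, `ρ(E)` or `ρ(F)`. The resulting morphisms into `2 × 2` matrices
are skew derivations of the quantized orbit, given by the coadjoint formula on the generating
matrix (`exists_coadjointOps`). These operators satisfy the Drinfeld-Jimbo relations: the relations
are skew primitive, so that they pass from two weight vectors to their product
(`QOps.Good.map₂`), and they hold on the generators, which are paired from the vector
representation and its dual. Products of generators are dense. The same density gives uniqueness of
the action (`action_unique`) and the equivariance of a morphism that is compatible with the
generating matrices (`equivariant_of_coadjoint`).

**The morphism.** For `B = E² - (λ + μ) E` the cubic relation reads `B E = -λμ E`, hence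
`B² = -λμ B`. Together with the Hecke relation `S² = (q - q⁻¹) S + 1` this yields the reflection
equation for `B` (`reflection_of_quadratic`), and the trace of `B` is read off from the two trace
relations.

**The classical limit.** Modulo `h` the reflection equation says that the matrix entries commute.
For a matrix over a commutative `ℂ`-algebra satisfying the remaining relations, Lagrange
interpolation gives a complete system of orthogonal idempotents with prescribed traces. Over a
local ring such a system is conjugate to the standard one (`exists_conj_local`), and a polynomial
vanishing on the orbit vanishes on the universal conjugate over the coordinate ring of `GL(n)`,
which is a localized polynomial ring (`matEval_conj_eq_zero`). So the classical relations generate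
the ideal of all polynomials vanishing on the orbit (`matEval_eq_zero_of_trace`,
`exists_classicalLimit`).
-/

noncomputable section

namespace QuantumOrbit

/-! ### Complete modules over `ℂ⟦h⟧` -/

/-- `h`-adically complete and separated modules. Completeness is stated through the existence of
the sums `∑ hᵏ uₖ`, characterized by their partial sums modulo `hᴺ`. -/
class HComplete (M : Type) [AddCommGroup M] [Module Scal M] : Prop where
  sep : ∀ a : M, (∀ N : ℕ, ∃ b : M, a = (PowerSeries.X : Scal) ^ N • b) → a = 0
  sum : ∀ u : ℕ → M, ∃ s : M, ∀ N : ℕ, ∃ b : M,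
    s = ∑ k ∈ Finset.range N, (PowerSeries.X : Scal) ^ k • u k + (PowerSeries.X : Scal) ^ N • b

section HSum

variable {M M' : Type} [AddCommGroup M] [Module Scal M] [AddCommGroup M'] [Module Scal M']

/-- The sum `∑ hᵏ uₖ` in a complete module. -/
def hSum [HComplete M] (u : ℕ → M) : M := (HComplete.sum u).choose

theorem hSum_spec [HComplete M] (u : ℕ → M) (N : ℕ) : ∃ b : M,
    hSum u = ∑ k ∈ Finset.range N, (PowerSeries.X : Scal) ^ k • u k
      + (PowerSeries.X : Scal) ^ N • b :=
  (HComplete.sum u).choose_spec N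

theorem eq_of_forall_sub [HComplete M] {a b : M}
    (h : ∀ N : ℕ, ∃ c : M, a - b = (PowerSeries.X : Scal) ^ N • c) : a = b :=
  sub_eq_zero.mp (HComplete.sep _ h)

theorem eq_hSum [HComplete M] {u : ℕ → M} {s : M} (h : ∀ N : ℕ, ∃ b : M,
    s = ∑ k ∈ Finset.range N, (PowerSeries.X : Scal) ^ k • u k
      + (PowerSeries.X : Scal) ^ N • b) : s = hSum u := by
  refine eq_of_forall_sub fun N => ?_
  obtain ⟨b, hb⟩ := h N
  obtain ⟨c, hc⟩ := hSum_spec u N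
  exact ⟨b - c, by rw [hb, hc, smul_sub]; abel⟩

theorem hSum_add [HComplete M] (u v : ℕ → M) : hSum (fun k => u k + v k) = hSum u + hSum v := by
  symm
  refine eq_hSum fun N => ?_
  obtain ⟨b, hb⟩ := hSum_spec u N
  obtain ⟨c, hc⟩ := hSum_spec v N
  refine ⟨b + c, ?_⟩
  rw [hb, hc]
  simp only [smul_add, Finset.sum_add_distrib]
  abel

/-- Linear maps are automatically continuous for the `h`-adic topology. -/
theorem map_hSum [HComplete M] [HComplete M'] (T : M →ₗ[Scal] M') (u : ℕ → M) :
    T (hSum u) = hSum fun k => T (u k) := by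
  refine eq_hSum fun N => ?_
  obtain ⟨b, hb⟩ := hSum_spec u N
  exact ⟨T b, by rw [hb]; simp⟩

theorem smul_hSum [HComplete M] (c : Scal) (u : ℕ → M) :
    hSum (fun k => c • u k) = c • hSum u :=
  (map_hSum (LinearMap.lsmul Scal M c) u).symm

instance [HComplete M'] : HComplete (M →ₗ[Scal] M') where
  sep T hT := by
    ext a
    refine HComplete.sep _ fun N => ?_
    obtain ⟨b, hb⟩ := hT N
    exact ⟨b a, by rw [hb]; rfl⟩
  sum u := by
    let lin (v : ℕ → M →ₗ[Scal] M') : M →ₗ[Scal] M' :=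
      { toFun := fun a => hSum fun k => v k a
        map_add' := fun a b => by simp only [map_add, hSum_add]
        map_smul' := fun c a => by simp only [map_smul, smul_hSum, RingHom.id_apply] }
    refine ⟨lin u, fun N => ⟨lin fun k => u (N + k), ?_⟩⟩
    ext a
    change hSum (fun k => u k a) = _
    rw [LinearMap.add_apply, LinearMap.sum_apply]
    simp only [LinearMap.smul_apply]
    symm
    refine eq_hSum fun K => ?_
    change ∃ b, _ + (PowerSeries.X : Scal) ^ N • hSum (fun k => u (N + k) a) = _
    obtain ⟨b, hb⟩ := hSum_spec (fun k => u (N + k) a) K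
    obtain ⟨c, hc⟩ : ∃ c, ∑ k ∈ Finset.range (N + K), (PowerSeries.X : Scal) ^ k • u k a =
        ∑ k ∈ Finset.range K, (PowerSeries.X : Scal) ^ k • u k a +
          (PowerSeries.X : Scal) ^ K • c := by
      rw [add_comm N K, Finset.sum_range_add]
      exact ⟨∑ k ∈ Finset.range N, (PowerSeries.X : Scal) ^ k • u (K + k) a, by
        rw [Finset.smul_sum]; simp only [smul_smul, pow_add]⟩
    refine ⟨c + (PowerSeries.X : Scal) ^ N • b, ?_⟩
    rw [hb, smul_add, ← add_assoc, smul_add, ← add_assoc, ← hc, Finset.sum_range_add,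
      Finset.smul_sum]
    simp only [smul_smul, pow_add, mul_comm]

instance {ι κ : Type} [HComplete M] : HComplete (Matrix ι κ M) where
  sep A hA := by
    ext i j
    refine HComplete.sep _ fun N => ?_
    obtain ⟨b, hb⟩ := hA N
    exact ⟨b i j, by rw [hb]; rfl⟩
  sum u := by
    choose b hb using fun i j => hSum_spec (fun k => u k i j)
    refine ⟨Matrix.of fun i j => hSum fun k => u k i j, fun N =>
      ⟨Matrix.of fun i j => b i j N, ?_⟩⟩
    ext i j
    simpa [Matrix.sum_apply] using hb i j N

/-- A linear image of a complete module is complete as soon as it is separated. -/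
theorem HComplete.of_surjective [HComplete M] (T : M →ₗ[Scal] M') (hT : Function.Surjective T)
    (sep : ∀ a : M', (∀ N : ℕ, ∃ b : M', a = (PowerSeries.X : Scal) ^ N • b) → a = 0) :
    HComplete M' where
  sep := sep
  sum u := by
    choose v hv using fun k => hT (u k)
    refine ⟨T (hSum v), fun N => ?_⟩
    obtain ⟨b, hb⟩ := hSum_spec v N
    exact ⟨T b, by rw [hb]; simp [hv]⟩

end HSum

/-! ### The completed free algebra -/

section CFree

variable {Y : Type}

theorem cfree_algebraMap_X :
    algebraMap Scal (CFree Y) PowerSeries.X = PowerSeries.X :=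
  PowerSeries.map_X _

theorem cfree_algebraMap_C (c : ℂ) :
    algebraMap Scal (CFree Y) (PowerSeries.C c) =
      PowerSeries.C (algebraMap ℂ (FreeAlgebra ℂ Y) c) :=
  PowerSeries.map_C _ _

theorem cfree_X_pow_smul (N : ℕ) (f : CFree Y) :
    (PowerSeries.X : Scal) ^ N • f = PowerSeries.X ^ N * f := by
  rw [Algebra.smul_def, map_pow, cfree_algebraMap_X]

theorem cfree_C_smul (c : ℂ) (x : FreeAlgebra ℂ Y) :
    (PowerSeries.C c : Scal) • (PowerSeries.C x : CFree Y) = PowerSeries.C (c • x) := by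
  rw [Algebra.smul_def, cfree_algebraMap_C, ← map_mul, Algebra.smul_def]

/-- Dropping the first `N` coefficients. -/
def tail {R : Type} [Ring R] (N : ℕ) (f : PowerSeries R) : PowerSeries R :=
  PowerSeries.mk fun k => PowerSeries.coeff (N + k) f

theorem eq_sum_add_tail {R : Type} [Ring R] (N : ℕ) (f : PowerSeries R) :
    f = ∑ k ∈ Finset.range N, PowerSeries.X ^ k * PowerSeries.C (PowerSeries.coeff k f)
      + PowerSeries.X ^ N * tail N f := by
  ext m
  simp only [map_add, map_sum, PowerSeries.coeff_X_pow_mul', PowerSeries.coeff_C, tail,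
    PowerSeries.coeff_mk]
  by_cases h : N ≤ m
  · rw [if_pos h, Finset.sum_eq_zero, zero_add, Nat.add_sub_cancel' h]
    intro k hk
    rw [Finset.mem_range] at hk
    rw [if_pos (by omega), if_neg (by omega)]
  · rw [if_neg h, add_zero, Finset.sum_eq_single m]
    · simp
    · intro k _ hkm
      by_cases hk : k ≤ m
      · rw [if_pos hk, if_neg (by omega)]
      · rw [if_neg hk]
    · intro hm
      exact absurd (Finset.mem_range.mpr (by omega)) hm

theorem cfree_eq_sum_add_tail (N : ℕ) (f : CFree Y) :
    f = ∑ k ∈ Finset.range N,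
        (PowerSeries.X : Scal) ^ k • (PowerSeries.C (PowerSeries.coeff k f) : CFree Y)
      + (PowerSeries.X : Scal) ^ N • tail N f := by
  simp only [cfree_X_pow_smul]
  exact eq_sum_add_tail N f

theorem cfree_X_pow_dvd_iff {N : ℕ} {f : CFree Y} :
    (∃ b : CFree Y, f = (PowerSeries.X : Scal) ^ N • b) ↔
      ∀ m < N, PowerSeries.coeff m f = 0 := by
  simp only [cfree_X_pow_smul]
  exact PowerSeries.X_pow_dvd_iff

instance : HComplete (CFree Y) where
  sep f hf := by
    ext m
    exact cfree_X_pow_dvd_iff.mp (hf (m + 1)) m (Nat.lt_succ_self m)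
  sum u := by
    refine ⟨PowerSeries.mk fun m => ∑ k ∈ Finset.range (m + 1), PowerSeries.coeff (m - k) (u k),
      fun N => ?_⟩
    obtain ⟨b, hb⟩ := (cfree_X_pow_dvd_iff (Y := Y) (N := N)
      (f := (PowerSeries.mk fun m => ∑ k ∈ Finset.range (m + 1), PowerSeries.coeff (m - k) (u k))
        - ∑ k ∈ Finset.range N, (PowerSeries.X : Scal) ^ k • u k)).mpr (by
      intro m hm
      simp only [cfree_X_pow_smul, map_sub, map_sum, PowerSeries.coeff_X_pow_mul',
        PowerSeries.coeff_mk]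
      rw [sub_eq_zero, ← Finset.sum_filter]
      refine Finset.sum_congr ?_ fun _ _ => rfl
      ext k
      simp only [Finset.mem_range, Finset.mem_filter]
      omega)
    exact ⟨b, by rw [← hb]; abel⟩

/-- A linear map on the completed free algebra is determined by its values on constant series. -/
theorem cfree_map_eq {M : Type} [AddCommGroup M] [Module Scal M] [HComplete M]
    {T T' : CFree Y →ₗ[Scal] M} {f : CFree Y}
    (h : ∀ k, T (PowerSeries.C (PowerSeries.coeff k f)) =
      T' (PowerSeries.C (PowerSeries.coeff k f))) : T f = T' f := by
  refine eq_of_forall_sub fun N => ⟨T (tail N f) - T' (tail N f), ?_⟩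
  conv_lhs => rw [cfree_eq_sum_add_tail N f]
  simp only [map_add, map_sum, map_smul, h, smul_sub]
  abel

/-- If every coefficient of `f` acts by the corresponding coefficient of the scalar `c`,
then `f` acts by `c`. -/
theorem cfree_map_eq_smul {M : Type} [AddCommGroup M] [Module Scal M] [HComplete M]
    {T : CFree Y →ₗ[Scal] M} {f : CFree Y} {c : Scal} {m : M}
    (h : ∀ k, T (PowerSeries.C (PowerSeries.coeff k f)) =
      (PowerSeries.C (PowerSeries.coeff k c) : Scal) • m) : T f = c • m := by
  refine eq_of_forall_sub fun N => ⟨T (tail N f) - tail N c • m, ?_⟩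
  conv_lhs => rw [cfree_eq_sum_add_tail N f, eq_sum_add_tail N c]
  simp only [map_add, map_sum, map_smul, h, smul_sub, add_smul, Finset.sum_smul, mul_smul]
  abel

/-- The constants are spanned by the words in the generators. -/
theorem freeAlgebra_submodule_eq_top (W : Submodule ℂ (FreeAlgebra ℂ Y)) (h1 : 1 ∈ W)
    (hmul : ∀ x, ∀ w ∈ W, FreeAlgebra.ι ℂ x * w ∈ W) : W = ⊤ := by
  rw [eq_top_iff]
  rintro a -
  suffices h : ∀ w ∈ W, a * w ∈ W by simpa using h 1 h1
  induction a using FreeAlgebra.induction with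
  | grade0 c => intro w hw; rw [← Algebra.smul_def]; exact W.smul_mem c hw
  | grade1 x => exact hmul x
  | mul a b ha hb => intro w hw; rw [mul_assoc]; exact ha _ (hb _ hw)
  | add a b ha hb => intro w hw; rw [add_mul]; exact W.add_mem (ha _ hw) (hb _ hw)

end CFree

section Eval

variable {Y B : Type} [Ring B] [Algebra Scal B] (g : Y → B)

/-- The extension of a map on generators to the free algebra over `ℂ`. -/
def freeLift : FreeAlgebra ℂ Y →+* B :=
  letI : Algebra ℂ B := Algebra.compHom B (PowerSeries.C : ℂ →+* Scal)
  (FreeAlgebra.lift ℂ g).toRingHom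

@[simp] theorem freeLift_ι (x : Y) : freeLift g (FreeAlgebra.ι ℂ x) = g x := by
  let _ : Algebra ℂ B := Algebra.compHom B (PowerSeries.C : ℂ →+* Scal)
  exact FreeAlgebra.lift_ι_apply g x

@[simp] theorem freeLift_algebraMap (c : ℂ) :
    freeLift g (algebraMap ℂ _ c) = algebraMap Scal B (PowerSeries.C c) := by
  let _ : Algebra ℂ B := Algebra.compHom B (PowerSeries.C : ℂ →+* Scal)
  exact (FreeAlgebra.lift ℂ g).commutes c

variable [HComplete B]

/-- The underlying map of `eval`. -/
def evalFun (f : CFree Y) : B := hSum fun k => freeLift g (PowerSeries.coeff k f)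

theorem evalFun_add (f f' : CFree Y) : evalFun g (f + f') = evalFun g f + evalFun g f' := by
  simp only [evalFun, map_add, hSum_add]

theorem evalFun_C_mul (x : FreeAlgebra ℂ Y) (f : CFree Y) :
    evalFun g (PowerSeries.C x * f) = freeLift g x * evalFun g f := by
  simp only [evalFun, PowerSeries.coeff_C_mul, map_mul]
  exact (map_hSum (LinearMap.mulLeft Scal (freeLift g x)) _).symm

theorem evalFun_X_mul (f : CFree Y) :
    evalFun g (PowerSeries.X * f) = (PowerSeries.X : Scal) • evalFun g f := by
  symm
  refine eq_hSum fun N => ?_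
  cases N with
  | zero => exact ⟨_, by simp; rfl⟩
  | succ N =>
    obtain ⟨b, hb⟩ := hSum_spec (fun k => freeLift g (PowerSeries.coeff k f)) N
    refine ⟨b, ?_⟩
    rw [evalFun, hb, Finset.sum_range_succ', smul_add, Finset.smul_sum]
    simp [smul_smul, pow_succ', PowerSeries.coeff_succ_X_mul]

theorem evalFun_X_pow_mul (N : ℕ) (f : CFree Y) :
    evalFun g (PowerSeries.X ^ N * f) = (PowerSeries.X : Scal) ^ N • evalFun g f := by
  induction N with
  | zero => simp
  | succ N ih => rw [pow_succ', mul_assoc, evalFun_X_mul, ih, smul_smul, ← pow_succ']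

theorem evalFun_sum_mul (N : ℕ) (u : ℕ → FreeAlgebra ℂ Y) (f : CFree Y) :
    evalFun g ((∑ k ∈ Finset.range N, PowerSeries.X ^ k * PowerSeries.C (u k)) * f) =
      (∑ k ∈ Finset.range N, (PowerSeries.X : Scal) ^ k • freeLift g (u k)) * evalFun g f := by
  induction N with
  | zero =>
    have := evalFun_C_mul g 0 0
    simpa using this
  | succ N ih =>
    rw [Finset.sum_range_succ, Finset.sum_range_succ, add_mul, evalFun_add, ih, mul_assoc,
      evalFun_X_pow_mul, evalFun_C_mul, add_mul, smul_mul_assoc]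

theorem evalFun_one : evalFun g 1 = 1 := by
  symm
  refine eq_hSum fun N => ?_
  cases N with
  | zero => exact ⟨1, by simp⟩
  | succ N =>
    refine ⟨0, ?_⟩
    rw [Finset.sum_eq_single 0]
    · simp
    · intro k _ hk
      simp [PowerSeries.coeff_one, hk]
    · simp

/-- Multiplicativity is checked modulo every `hᴺ`, after cutting off the first factor. -/
theorem evalFun_mul (f f' : CFree Y) : evalFun g (f * f') = evalFun g f * evalFun g f' := by
  have key : ∀ N (r : CFree Y), evalFun g (f * r) =
      (∑ k ∈ Finset.range N, (PowerSeries.X : Scal) ^ k • freeLift g (PowerSeries.coeff k f))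
        * evalFun g r + (PowerSeries.X : Scal) ^ N • evalFun g (tail N f * r) := by
    intro N r
    conv_lhs => rw [eq_sum_add_tail N f]
    rw [add_mul, evalFun_add, evalFun_sum_mul, mul_assoc, evalFun_X_pow_mul]
  refine eq_of_forall_sub fun N => ?_
  have h1 := key N 1
  rw [mul_one, mul_one, evalFun_one, mul_one] at h1
  refine ⟨evalFun g (tail N f * f') - evalFun g (tail N f) * evalFun g f', ?_⟩
  rw [key N f', h1, add_mul, smul_sub, smul_mul_assoc]
  abel

/-- The morphism from the completed free algebra to a complete algebra with prescribed values on
the generators. -/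
def eval : CFree Y →ₐ[Scal] B :=
  { toFun := evalFun g
    map_one' := evalFun_one g
    map_mul' := evalFun_mul g
    map_zero' := by simpa using evalFun_C_mul g 0 0
    map_add' := evalFun_add g
    commutes' := by
      intro c
      symm
      refine eq_hSum fun N => ⟨algebraMap Scal B (tail N c), ?_⟩
      conv_lhs => rw [eq_sum_add_tail N c]
      have hc : ∀ k, PowerSeries.coeff k (algebraMap Scal (CFree Y) c) =
        algebraMap ℂ _ (PowerSeries.coeff k c) := fun k => PowerSeries.coeff_map _ _ _
      simp only [hc, freeLift_algebraMap, map_add, map_sum, map_mul, Algebra.smul_def] }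

theorem eval_C (x : FreeAlgebra ℂ Y) : eval g (PowerSeries.C x) = freeLift g x := by
  have := evalFun_C_mul g x 1
  rwa [mul_one, evalFun_one, mul_one] at this

@[simp] theorem eval_gen (x : Y) : eval g (gen x) = g x := by
  rw [gen, eval_C, freeLift_ι]

end Eval

/-! ### Algebras given by generators and relations -/

section Presented

variable {Y : Type} {s : Set (CFree Y)}

/-- The quotient map as a morphism of `ℂ⟦h⟧`-algebras. -/
def mkP (s : Set (CFree Y)) : CFree Y →ₐ[Scal] Presented s :=
  { toPresented s with commutes' := fun _ => rfl }

theorem mkP_surjective : Function.Surjective (mkP s) :=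
  RingCon.mk'_surjective (closedIdeal s).ringCon

theorem mkP_eq_zero_iff {f : CFree Y} : mkP s f = 0 ↔ f ∈ closedIdeal s := by
  rw [TwoSidedIdeal.mem_iff, ← RingCon.eq]
  rfl

theorem mem_closedIdeal {f : CFree Y} : f ∈ closedIdeal s ↔
    ∀ N : ℕ, f ∈ TwoSidedIdeal.span (s ∪ {(PowerSeries.X : CFree Y) ^ N}) := by
  rw [closedIdeal, TwoSidedIdeal.mem_iInf]

theorem subset_closedIdeal {f : CFree Y} (hf : f ∈ s) : f ∈ closedIdeal s :=
  mem_closedIdeal.mpr fun _ => TwoSidedIdeal.subset_span (Or.inl hf)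

theorem mkP_eq_zero {f : CFree Y} (hf : f ∈ s) : mkP s f = 0 :=
  mkP_eq_zero_iff.mpr (subset_closedIdeal hf)

instance : HComplete (Presented s) := by
  refine HComplete.of_surjective (mkP s).toLinearMap mkP_surjective fun a ha => ?_
  obtain ⟨f, rfl⟩ := mkP_surjective a
  rw [mkP_eq_zero_iff, mem_closedIdeal]
  intro N
  obtain ⟨b, hb⟩ := ha N
  obtain ⟨b, rfl⟩ := mkP_surjective b
  have h : f - (PowerSeries.X : Scal) ^ N • b ∈ closedIdeal s := by
    rw [← mkP_eq_zero_iff, map_sub, map_smul, ← hb, sub_self]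
  have h2 : (PowerSeries.X : Scal) ^ N • b ∈
      TwoSidedIdeal.span (s ∪ {(PowerSeries.X : CFree Y) ^ N}) := by
    rw [cfree_X_pow_smul]
    exact TwoSidedIdeal.mul_mem_right _ _ _ (TwoSidedIdeal.subset_span (Or.inr rfl))
  simpa using TwoSidedIdeal.add_mem _ (mem_closedIdeal.mp h N) h2

variable {B : Type} [Ring B] [Algebra Scal B] [HComplete B]

/-- A morphism to a separated algebra that kills the relations kills the closed ideal. -/
theorem map_eq_zero_of_mem_closedIdeal (θ : CFree Y →ₐ[Scal] B) (hθ : ∀ r ∈ s, θ r = 0)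
    {f : CFree Y} (hf : f ∈ closedIdeal s) : θ f = 0 := by
  refine HComplete.sep _ fun N => ?_
  refine TwoSidedIdeal.span_induction (p := fun f _ => ∃ b, θ f = (PowerSeries.X : Scal) ^ N • b)
    ?_ ⟨0, by simp⟩ ?_ ?_ ?_ ?_ (mem_closedIdeal.mp hf N)
  · rintro x (hx | rfl)
    · exact ⟨0, by rw [hθ x hx, smul_zero]⟩
    · exact ⟨1, by rw [← mul_one (PowerSeries.X ^ N), ← cfree_X_pow_smul, map_smul, map_one]⟩
  · rintro x y - - ⟨a, ha⟩ ⟨b, hb⟩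
    exact ⟨a + b, by rw [map_add, ha, hb, smul_add]⟩
  · rintro x - ⟨a, ha⟩
    exact ⟨-a, by rw [map_neg, ha, smul_neg]⟩
  · rintro a x - ⟨b, hb⟩
    exact ⟨θ a * b, by rw [map_mul, hb, mul_smul_comm]⟩
  · rintro a x - ⟨b, hb⟩
    exact ⟨b * θ a, by rw [map_mul, hb, smul_mul_assoc]⟩

/-- The universal property of an algebra given by generators and relations. -/
def liftP (θ : CFree Y →ₐ[Scal] B) (hθ : ∀ r ∈ s, θ r = 0) : Presented s →ₐ[Scal] B :=
  { RingCon.lift (closedIdeal s).ringCon θ.toRingHom (by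
      intro x y hxy
      have h : x - y ∈ closedIdeal s := (TwoSidedIdeal.rel_iff _ _ _).mp hxy
      have := map_eq_zero_of_mem_closedIdeal θ hθ h
      rw [map_sub, sub_eq_zero] at this
      exact this) with
    commutes' := θ.commutes }

@[simp] theorem liftP_mkP (θ : CFree Y →ₐ[Scal] B) (hθ : ∀ r ∈ s, θ r = 0) (f : CFree Y) :
    liftP θ hθ (mkP s f) = θ f := rfl

/-- A linear map on a presented algebra is determined by its values on any set that contains `1`
and is stable under left multiplication by the generators. -/
theorem presented_linearMap_ext {M : Type} [AddCommGroup M] [Module Scal M] [HComplete M]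
    {T T' : Presented s →ₗ[Scal] M} (P : Presented s → Prop) (h1 : P 1)
    (hmul : ∀ x b, P b → P (mkP s (gen x) * b)) (h : ∀ b, P b → T b = T' b) : T = T' := by
  let W : Submodule ℂ (FreeAlgebra ℂ Y) := Submodule.span ℂ {w | P (mkP s (PowerSeries.C w))}
  have hW : W = ⊤ := by
    refine freeAlgebra_submodule_eq_top W (Submodule.subset_span (by simpa using h1)) ?_
    intro x w hw
    induction hw using Submodule.span_induction with
    | mem w hw =>
      refine Submodule.subset_span ?_
      have := hmul x _ hw
      rwa [gen, ← map_mul, ← map_mul] at this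
    | zero => simp
    | add a b _ _ ha hb => rw [mul_add]; exact W.add_mem ha hb
    | smul c a _ ha => rw [mul_smul_comm]; exact W.smul_mem c ha
  ext a
  obtain ⟨f, rfl⟩ := mkP_surjective a
  refine cfree_map_eq (T := T ∘ₗ (mkP s).toLinearMap) (T' := T' ∘ₗ (mkP s).toLinearMap) fun k => ?_
  have hk : PowerSeries.coeff k f ∈ W := hW ▸ Submodule.mem_top
  generalize PowerSeries.coeff k f = v at hk ⊢
  induction hk using Submodule.span_induction with
  | mem w hw => exact h _ hw
  | zero => simp
  | add a b _ _ ha hb => rw [map_add, map_add, map_add, ha, hb]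
  | smul c a _ ha => rw [← cfree_C_smul, map_smul, map_smul, ha]

/-- Two linear maps agree once they agree at `1` and their agreement at `b` implies their
agreement at every product of a generator and `b`. -/
theorem presented_linearMap_ext' {M : Type} [AddCommGroup M] [Module Scal M] [HComplete M]
    {T T' : Presented s →ₗ[Scal] M} (h1 : T 1 = T' 1)
    (hmul : ∀ x b, T b = T' b → T (mkP s (gen x) * b) = T' (mkP s (gen x) * b)) : T = T' :=
  presented_linearMap_ext (fun b => T b = T' b) h1 hmul fun _ h => h

theorem presented_algHom_ext {θ θ' : Presented s →ₐ[Scal] B}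
    (h : ∀ x, θ (mkP s (gen x)) = θ' (mkP s (gen x))) : θ = θ' := by
  have := presented_linearMap_ext' (T := θ.toLinearMap) (T' := θ'.toLinearMap) (by simp)
    (fun x b hb => by
      simp only [AlgHom.toLinearMap_apply] at hb ⊢
      rw [map_mul, map_mul, h, hb])
  exact AlgHom.toLinearMap_injective this

end Presented

/-! ### Powers of `q` -/

theorem expH_eq_rescale (z : ℂ) : (expH z : Scal) = PowerSeries.rescale z (PowerSeries.exp ℂ) := by
  ext k
  simp [expH, PowerSeries.coeff_rescale, PowerSeries.coeff_exp, mul_comm]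

theorem expH_add (a b : ℂ) : (expH (a + b) : Scal) = expH a * expH b := by
  simp only [expH_eq_rescale, PowerSeries.exp_mul_exp_eq_exp_add]

theorem qpow_add (a b : ℤ) : qpow (a + b) = qpow a * qpow b := by
  simp only [qpow, Int.cast_add, expH_add]

@[simp] theorem qpow_zero : qpow 0 = 1 := by
  ext k
  cases k <;> simp [qpow, expH, PowerSeries.coeff_one]

theorem qpow_one_mul_neg_one : qpow 1 * qpow (-1) = 1 := by
  rw [← qpow_add]; simp

theorem constantCoeff_qpow (z : ℤ) : PowerSeries.constantCoeff (qpow z) = 1 := by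
  rw [← PowerSeries.coeff_zero_eq_constantCoeff_apply]
  simp [qpow, expH]

theorem constantCoeff_qInt (a : ℕ) : PowerSeries.constantCoeff (qInt a) = a := by
  simp [qInt, constantCoeff_qpow]

/-! ### The braid matrix -/

section Braid

variable {n : ℕ}

theorem permMat_apply (p r : Fin n × Fin n) : permMat n p r = if r = p.swap then 1 else 0 := by
  obtain ⟨a, b⟩ := p
  obtain ⟨c, d⟩ := r
  simp only [permMat, Matrix.sum_apply, Matrix.kroneckerMap_apply, Matrix.single_apply,
    Prod.swap_prod_mk, Prod.mk.injEq]
  rw [Finset.sum_eq_single a, Finset.sum_eq_single b]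
  · by_cases h1 : b = c <;> by_cases h2 : a = d <;> simp [h1, h2, eq_comm]
  · intro x _ hx; simp [hx]
  · simp
  · intro x _ hx; simp [hx]
  · simp

theorem rMat_apply (p r : Fin n × Fin n) : rMat n p r =
    (if r = p then (if p.1 = p.2 then qpow 1 else 1) else 0) +
      (if r = p.swap ∧ p.2 < p.1 then qpow 1 - qpow (-1) else 0) := by
  obtain ⟨a, b⟩ := p
  obtain ⟨c, d⟩ := r
  simp only [rMat, Matrix.sum_apply, Matrix.add_apply, Matrix.smul_apply,
    Matrix.kroneckerMap_apply, Matrix.single_apply, Prod.swap_prod_mk, Prod.mk.injEq]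
  have h1 : (∑ i, (if i = a ∧ i = c then (1 : Scal) else 0) * (if i = b ∧ i = d then 1 else 0)) =
      if c = a ∧ d = b ∧ a = b then 1 else 0 := by
    rw [Finset.sum_eq_single a]
    · grind
    · grind
    · simp
  have h2 : (∑ i, ∑ j ∈ Finset.univ.filter (fun j => i ≠ j),
      (if i = a ∧ i = c then (1 : Scal) else 0) * (if j = b ∧ j = d then 1 else 0)) =
      if c = a ∧ d = b ∧ a ≠ b then 1 else 0 := by
    rw [Finset.sum_eq_single a]
    · rw [Finset.sum_filter, Finset.sum_eq_single b]
      · grind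
      · grind
      · simp
    · intro x _ hx; simp [hx]
    · simp
  have h3 : (∑ i, ∑ j ∈ Finset.univ.filter (fun j => i < j),
      (if j = a ∧ i = c then (1 : Scal) else 0) * (if i = b ∧ j = d then 1 else 0)) =
      if c = b ∧ d = a ∧ b < a then 1 else 0 := by
    rw [Finset.sum_eq_single b]
    · rw [Finset.sum_filter, Finset.sum_eq_single a]
      · grind
      · grind
      · simp
    · intro x _ hx; simp [hx]
    · simp
  rw [h1, h2, h3]
  simp only [smul_eq_mul]
  grind

theorem sMat_apply (p r : Fin n × Fin n) : sMat n p r =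
    (if r = p.swap then (if p.1 = p.2 then qpow 1 else 1) else 0) +
      (if r = p ∧ p.1 < p.2 then qpow 1 - qpow (-1) else 0) := by
  rw [sMat, Matrix.mul_apply]
  simp only [permMat_apply, ite_mul, one_mul, zero_mul, Finset.sum_ite_eq', Finset.mem_univ,
    if_true]
  rw [rMat_apply]
  simp only [Prod.fst_swap, Prod.snd_swap, Prod.swap_swap]
  grind

variable {A : Type} [Ring A] [Algebra Scal A]

/-- Left multiplication by `S` on matrix entries; `S` has at most two entries in each row. -/
theorem toMat_sMat_mul_apply {κ : Type} (M : Matrix (Fin n × Fin n) κ A) (p : Fin n × Fin n)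
    (x : κ) : (toMat A (sMat n) * M) p x =
      (if p.1 = p.2 then qpow 1 else 1) • M p.swap x +
        (if p.1 < p.2 then qpow 1 - qpow (-1) else 0) • M p x := by
  rw [Matrix.mul_apply]
  simp only [toMat, Matrix.map_apply, sMat_apply, ← Algebra.smul_def, add_smul,
    Finset.sum_add_distrib, ite_smul, zero_smul, Finset.sum_ite_eq', Finset.mem_univ, if_true,
    ite_and]

theorem mul_toMat_sMat_apply {κ : Type} (M : Matrix κ (Fin n × Fin n) A) (p : Fin n × Fin n)
    (x : κ) : (M * toMat A (sMat n)) x p =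
      (if p.1 = p.2 then qpow 1 else 1) • M x p.swap +
        (if p.1 < p.2 then qpow 1 - qpow (-1) else 0) • M x p := by
  rw [Matrix.mul_apply]
  have h : ∀ r : Fin n × Fin n, sMat n r p =
    (if r = p.swap then (if p.1 = p.2 then qpow 1 else 1) else 0) +
      (if r = p then (if p.1 < p.2 then qpow 1 - qpow (-1) else 0) else 0) := by
    intro r
    rw [sMat_apply]
    obtain ⟨a, b⟩ := p
    obtain ⟨c, d⟩ := r
    simp only [Prod.swap_prod_mk, Prod.mk.injEq]
    grind
  simp only [toMat, Matrix.map_apply, h, ← Algebra.commutes, ← Algebra.smul_def, add_smul,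
    Finset.sum_add_distrib, ite_smul, zero_smul, Finset.sum_ite_eq', Finset.mem_univ, if_true]

/-- `toMat` as a morphism of algebras. -/
def toMatHom (A : Type) [Ring A] [Algebra Scal A] (ι : Type) [Fintype ι] [DecidableEq ι] :
    Matrix ι ι Scal →ₐ[Scal] Matrix ι ι A := (Algebra.ofId Scal A).mapMatrix

theorem toMat_eq {ι : Type} [Fintype ι] [DecidableEq ι] (M : Matrix ι ι Scal) :
    toMat A M = toMatHom A ι M := rfl

/-- The Hecke relation. -/
theorem sMat_mul_sMat : toMat A (sMat n) * toMat A (sMat n) =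
    (qpow 1 - qpow (-1)) • toMat A (sMat n) + 1 := by
  have h : sMat n * sMat n = (qpow 1 - qpow (-1)) • sMat n + 1 := by
    have e : sMat n = toMat Scal (sMat n) := Matrix.ext fun _ _ => by simp [toMat]
    refine Matrix.ext fun p r => ?_
    conv_lhs => rw [e, toMat_sMat_mul_apply, ← e]
    simp only [sMat_apply, Matrix.add_apply, Matrix.smul_apply, Matrix.one_apply, smul_eq_mul]
    have := qpow_one_mul_neg_one
    obtain ⟨a, b⟩ := p
    obtain ⟨c, d⟩ := r
    simp only [Prod.mk.injEq, Prod.swap_prod_mk]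
    rcases lt_trichotomy a b with hab | rfl | hab
    · grind
    · grind
    · grind
  rw [toMat_eq, ← map_mul, h, map_add, map_smul, map_one]

end Braid

/-! ### Gauge transformations -/

section Gauge

variable {n : ℕ} {B : Type} [Ring B]

theorem one_kronecker_mul (M N : Matrix (Fin n) (Fin n) B) :
    ((1 : Matrix (Fin n) (Fin n) B) ⊗ₖ M) * ((1 : Matrix (Fin n) (Fin n) B) ⊗ₖ N) =
      (1 : Matrix (Fin n) (Fin n) B) ⊗ₖ (M * N) := by
  ext ⟨a, b⟩ ⟨c, d⟩
  simp [Matrix.mul_apply, Fintype.sum_prod_type, Matrix.one_apply, Finset.sum_ite_irrel]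

theorem kronecker_one_mul (M N : Matrix (Fin n) (Fin n) B) :
    (M ⊗ₖ (1 : Matrix (Fin n) (Fin n) B)) * (N ⊗ₖ (1 : Matrix (Fin n) (Fin n) B)) =
      (M * N) ⊗ₖ (1 : Matrix (Fin n) (Fin n) B) := by
  ext ⟨a, b⟩ ⟨c, d⟩
  simp [Matrix.mul_apply, Fintype.sum_prod_type, Matrix.one_apply, Finset.sum_ite_irrel]

theorem kronecker_one_mul_one_kronecker (M N : Matrix (Fin n) (Fin n) B) :
    (M ⊗ₖ (1 : Matrix (Fin n) (Fin n) B)) * ((1 : Matrix (Fin n) (Fin n) B) ⊗ₖ N) =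
      M ⊗ₖ N := by
  ext ⟨a, b⟩ ⟨c, d⟩
  simp [Matrix.mul_apply, Fintype.sum_prod_type, Matrix.one_apply, Finset.sum_ite_irrel]

theorem one_kronecker_mul_kronecker_one (M N : Matrix (Fin n) (Fin n) B)
    (h : ∀ a b c d, Commute (M a b) (N c d)) :
    ((1 : Matrix (Fin n) (Fin n) B) ⊗ₖ N) * (M ⊗ₖ (1 : Matrix (Fin n) (Fin n) B)) =
      M ⊗ₖ N := by
  ext ⟨a, b⟩ ⟨c, d⟩
  simp [Matrix.mul_apply, Fintype.sum_prod_type, Matrix.one_apply,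
    (h a c b d).eq]

variable [Algebra Scal B]

/-- A point, with values in a possibly noncommutative algebra `B`, of the quantum group of
functions on `GL(n)` dual to `U_h(gl(n))`: an invertible matrix with the `RTT` relation
`S G₁ G₂ = G₁ G₂ S`. The last condition is the invariance of the quantum trace. -/
structure IsGauge (G Gi : Matrix (Fin n) (Fin n) B) : Prop where
  mul_inv : G * Gi = 1
  inv_mul : Gi * G = 1
  rtt : toMat B (sMat n) * (G ⊗ₖ G) = (G ⊗ₖ G) * toMat B (sMat n)
  trace : ∀ b c, ∑ a : Fin n, qpow (-2 * (a.val : ℤ)) • (Gi a b * G c a) =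
    if b = c then qpow (-2 * (b.val : ℤ)) • 1 else 0

theorem IsGauge.map {B' : Type} [Ring B'] [Algebra Scal B'] {G Gi : Matrix (Fin n) (Fin n) B}
    (h : IsGauge G Gi) (f : B →ₐ[Scal] B') : IsGauge (G.map f) (Gi.map f) where
  mul_inv := by rw [← Matrix.map_mul, h.mul_inv]; simp
  inv_mul := by rw [← Matrix.map_mul, h.inv_mul]; simp
  rtt := by
    have e : toMat B' (sMat n) = (toMat B (sMat n)).map f := by
      ext; simp [toMat]
    have e2 : (G.map f) ⊗ₖ (G.map f) = (G ⊗ₖ G).map f := by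
      ext; simp
    rw [e, e2, ← Matrix.map_mul, h.rtt, Matrix.map_mul]
  trace b c := by
    have := congrArg f (h.trace b c)
    rw [map_sum] at this
    simp only [map_smul, map_mul] at this
    simp only [Matrix.map_apply, this]
    split_ifs <;> simp

variable {G Gi L : Matrix (Fin n) (Fin n) B}

/-- With `W = G₁ G₂`, which commutes with `S`, the matrix `1 ⊗ (G⁻¹ L G)` is `W⁻¹ (1 ⊗ L) W`. -/
theorem IsGauge.reflectionDefect_conj (h : IsGauge G Gi) (hG : ∀ a b c d, Commute (G a b) (L c d))
    (hL : reflectionDefect L = 0) : reflectionDefect (Gi * L * G) = 0 := by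
  set S := toMat B (sMat n) with hS
  set u := G ⊗ₖ (1 : Matrix (Fin n) (Fin n) B) with hu
  set v := (1 : Matrix (Fin n) (Fin n) B) ⊗ₖ G with hv
  set ui := Gi ⊗ₖ (1 : Matrix (Fin n) (Fin n) B) with hui
  set vi := (1 : Matrix (Fin n) (Fin n) B) ⊗ₖ Gi with hvi
  set l := (1 : Matrix (Fin n) (Fin n) B) ⊗ₖ L with hl
  have one : (1 : Matrix (Fin n) (Fin n) B) ⊗ₖ (1 : Matrix (Fin n) (Fin n) B) = 1 := by simp
  have huui : u * ui = 1 := by rw [hu, hui, kronecker_one_mul, h.mul_inv, one]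
  have huiu : ui * u = 1 := by rw [hu, hui, kronecker_one_mul, h.inv_mul, one]
  have hvvi : v * vi = 1 := by rw [hv, hvi, one_kronecker_mul, h.mul_inv, one]
  have hviv : vi * v = 1 := by rw [hv, hvi, one_kronecker_mul, h.inv_mul, one]
  have hul : u * l = l * u := by
    rw [hu, hl, kronecker_one_mul_one_kronecker, one_kronecker_mul_kronecker_one _ _ hG]
  have hW : S * (u * v) = u * v * S := by
    rw [hu, hv, kronecker_one_mul_one_kronecker]; exact h.rtt
  set W := u * v with hWdef
  set Wi := vi * ui with hWidef
  have hWWi : W * Wi = 1 := by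
    rw [hWdef, hWidef, mul_assoc, ← mul_assoc v, hvvi, one_mul, huui]
  have hWiW : Wi * W = 1 := by
    rw [hWdef, hWidef, mul_assoc, ← mul_assoc ui, huiu, one_mul, hviv]
  have hWi : S * Wi = Wi * S := by
    calc S * Wi = Wi * W * (S * Wi) := by rw [hWiW, one_mul]
      _ = Wi * (W * S) * Wi := by simp only [mul_assoc]
      _ = Wi * S * (W * Wi) := by rw [← hW]; simp only [mul_assoc]
      _ = Wi * S := by rw [hWWi, mul_one]
  have hl' : (1 : Matrix (Fin n) (Fin n) B) ⊗ₖ (Gi * L * G) = Wi * l * W := by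
    rw [← one_kronecker_mul, ← one_kronecker_mul, ← hv, ← hvi, ← hl, hWdef, hWidef]
    calc vi * l * v = vi * (ui * u) * l * v := by rw [huiu, mul_one]
      _ = vi * ui * (u * l) * v := by simp only [mul_assoc]
      _ = vi * ui * l * (u * v) := by rw [hul]; simp only [mul_assoc]
  have hd : S * l * S * l - l * S * l * S = 0 := hL
  change S * ((1 : Matrix (Fin n) (Fin n) B) ⊗ₖ (Gi * L * G)) * S * _ - _ * S * _ * S = 0
  rw [hl']
  have e1 : S * (Wi * l * W) * S * (Wi * l * W) = Wi * (S * l * S * l) * W := by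
    calc S * (Wi * l * W) * S * (Wi * l * W) = (S * Wi) * l * W * (S * Wi) * l * W := by
          simp only [mul_assoc]
      _ = Wi * S * l * (W * Wi) * S * l * W := by rw [hWi]; simp only [mul_assoc]
      _ = _ := by rw [hWWi, mul_one]; simp only [mul_assoc]
  have e2 : (Wi * l * W) * S * (Wi * l * W) * S = Wi * (l * S * l * S) * W := by
    calc (Wi * l * W) * S * (Wi * l * W) * S = Wi * l * W * (S * Wi) * l * (W * S) := by
          simp only [mul_assoc]
      _ = Wi * l * (W * Wi) * S * l * (S * W) := by rw [hWi, ← hW]; simp only [mul_assoc]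
      _ = _ := by rw [hWWi, mul_one]; simp only [mul_assoc]
  rw [e1, e2, ← sub_mul, ← mul_sub, hd, mul_zero, zero_mul]

theorem IsGauge.qTrace_conj (h : IsGauge G Gi) (hGi : ∀ a b c d, Commute (Gi a b) (L c d)) :
    qTrace (Gi * L * G) = qTrace L := by
  have e : ∀ a, (Gi * L * G) a a = ∑ c, ∑ b, L b c * (Gi a b * G c a) := by
    intro a
    simp only [Matrix.mul_apply, Finset.sum_mul]
    refine Finset.sum_congr rfl fun c _ => Finset.sum_congr rfl fun b _ => ?_
    rw [(hGi a b b c).eq, mul_assoc]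
  simp only [qTrace, e, Finset.smul_sum]
  rw [Finset.sum_comm]
  refine Finset.sum_congr rfl fun c _ => ?_
  rw [Finset.sum_comm]
  have e3 : ∀ b, ∑ a : Fin n, qpow (-2 * (a.val : ℤ)) • (L b c * (Gi a b * G c a)) =
      L b c * if b = c then qpow (-2 * (b.val : ℤ)) • 1 else 0 := by
    intro b
    rw [← h.trace, Finset.mul_sum]
    simp only [mul_smul_comm]
  rw [Finset.sum_congr rfl fun b _ => e3 b]
  simp

end Gauge

/-! ### Gauge transformations from the vector representation -/

section Blocks

variable {n : ℕ} {A : Type} [Ring A]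

/-- The matrix over `2 × 2` matrices with the upper triangular entries `(p, q; 0, r)`. -/
def blk (p q r : Matrix (Fin n) (Fin n) A) :
    Matrix (Fin n) (Fin n) (Matrix (Fin 2) (Fin 2) A) :=
  fun a c => !![p a c, q a c; 0, r a c]

theorem blk_mul (p q r p' q' r' : Matrix (Fin n) (Fin n) A) :
    blk p q r * blk p' q' r' = blk (p * p') (p * q' + q * r') (r * r') := by
  ext a c i j
  rw [Matrix.mul_apply, Matrix.sum_apply]
  fin_cases i <;> fin_cases j <;>
    simp [blk, Matrix.mul_apply, Finset.sum_add_distrib]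

theorem blk_one : blk (1 : Matrix (Fin n) (Fin n) A) 0 1 = 1 := by
  ext a c i j
  by_cases h : a = c <;> fin_cases i <;> fin_cases j <;> simp [blk, Matrix.one_apply, h]

variable [Algebra Scal A]

theorem blk_map (p q r : Matrix (Fin n) (Fin n) Scal) :
    (blk p q r).map (toMatHom A (Fin 2)) = blk (toMat A p) (toMat A q) (toMat A r) := by
  ext a c i j
  fin_cases i <;> fin_cases j <;>
    simp [blk, toMatHom, toMat, Algebra.ofId_apply]

/-- A triangular matrix over `2 × 2` matrices is a gauge transformation if its diagonal blocks are,
and the off-diagonal block is skew primitive with respect to them. -/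
theorem IsGauge.blk {p q r pi qi ri : Matrix (Fin n) (Fin n) Scal} (hp : IsGauge p pi)
    (hr : IsGauge r ri) (hq : p * qi + q * ri = 0) (hq' : pi * q + qi * r = 0)
    (hS : sMat n * (p ⊗ₖ q + q ⊗ₖ r) = (p ⊗ₖ q + q ⊗ₖ r) * sMat n)
    (ht : ∀ b c, ∑ a : Fin n, qpow (-2 * (a.val : ℤ)) * (pi a b * q c a + qi a b * r c a) = 0) :
    IsGauge (blk p q r) (blk pi qi ri) where
  mul_inv := by rw [blk_mul, hp.mul_inv, hr.mul_inv, hq, blk_one]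
  inv_mul := by rw [blk_mul, hp.inv_mul, hr.inv_mul, hq', blk_one]
  rtt := by
    have e : toMat Scal (sMat n) = sMat n := Matrix.ext fun _ _ => by simp [toMat]
    have h1 := hp.rtt
    have h2 := hr.rtt
    rw [← e] at hS
    refine Matrix.ext fun x y => Matrix.ext fun i j => ?_
    have h1 := congrFun (congrFun h1 x) y
    have h2 := congrFun (congrFun h2 x) y
    have h3 := congrFun (congrFun hS x) y
    rw [toMat_sMat_mul_apply, mul_toMat_sMat_apply] at h1 h2 h3 ⊢
    rw [Matrix.add_apply, Matrix.add_apply, Matrix.smul_apply, Matrix.smul_apply,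
      Matrix.smul_apply, Matrix.smul_apply]
    fin_cases i <;> fin_cases j <;>
      simp [QuantumOrbit.blk, Matrix.kroneckerMap_apply] at h1 h2 h3 ⊢ <;> assumption
  trace b c := by
    refine Matrix.ext fun i j => ?_
    have h1 := hp.trace b c
    have h2 := hr.trace b c
    have h3 := ht b c
    rw [Matrix.sum_apply]
    simp only [neg_mul, smul_eq_mul] at h1 h2 h3
    split_ifs at h1 h2 ⊢ with hbc <;>
    fin_cases i <;> fin_cases j <;>
      simp [QuantumOrbit.blk, h1, h2, h3]

end Blocks

section Generators

variable {n : ℕ}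

theorem isGauge_diagonal (d e : Fin n → Scal) (h : ∀ a, d a * e a = 1) :
    IsGauge (Matrix.diagonal d) (Matrix.diagonal e) where
  mul_inv := by rw [Matrix.diagonal_mul_diagonal]; simp [h]
  inv_mul := by rw [Matrix.diagonal_mul_diagonal]; simp [mul_comm, h]
  rtt := by
    refine Matrix.ext fun x y => ?_
    rw [toMat_sMat_mul_apply, mul_toMat_sMat_apply]
    simp only [Matrix.kroneckerMap_apply, Matrix.diagonal_apply, Prod.fst_swap, Prod.snd_swap,
      smul_eq_mul]
    grind
  trace b c := by
    rw [Finset.sum_eq_single b]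
    · by_cases hbc : b = c
      · subst hbc; simp [mul_comm (e b), h]
      · simp [hbc, Matrix.diagonal_apply_ne _ (Ne.symm hbc)]
    · intro a _ ha
      simp [Matrix.diagonal_apply_ne _ ha]
    · simp

theorem isGauge_one : IsGauge (1 : Matrix (Fin n) (Fin n) Scal) 1 := by
  rw [← Matrix.diagonal_one]
  exact isGauge_diagonal _ _ fun _ => one_mul 1

theorem lo_ne_hi (i : Fin (n - 1)) : lo i ≠ hi i := by
  simp [lo, hi]

theorem isGauge_rhoK (i : Fin (n - 1)) : IsGauge (rhoK i) (rhoKinv i) := by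
  refine isGauge_diagonal _ _ fun a => ?_
  have := qpow_one_mul_neg_one
  grind

theorem isGauge_rhoKinv (i : Fin (n - 1)) : IsGauge (rhoKinv i) (rhoK i) := by
  refine isGauge_diagonal _ _ fun a => ?_
  have := qpow_one_mul_neg_one
  grind

theorem sum_diagonal_mul_add (w d e : Fin n → Scal) (x y : Matrix (Fin n) (Fin n) Scal)
    (b c : Fin n) :
    ∑ a, w a * (Matrix.diagonal d a b * x c a + y a b * Matrix.diagonal e c a) =
      w b * (d b * x c b) + w c * (y c b * e c) := by
  simp only [mul_add, Finset.sum_add_distrib]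
  congr 1
  · rw [Finset.sum_eq_single b]
    · simp
    · intro a _ ha; simp [Matrix.diagonal_apply_ne _ ha]
    · simp
  · rw [Finset.sum_eq_single c]
    · simp
    · intro a _ ha; simp [Matrix.diagonal_apply_ne _ ha.symm]
    · simp

theorem isGauge_H (r : Fin n) : IsGauge (blk 1 (rhoH r) 1) (blk 1 (-rhoH r) 1) := by
  refine isGauge_one.blk isGauge_one (by simp) (by simp) ?_ ?_
  · have e : toMat Scal (sMat n) = sMat n := Matrix.ext fun _ _ => by simp [toMat]
    refine Matrix.ext fun x y => ?_
    rw [← e, toMat_sMat_mul_apply, mul_toMat_sMat_apply]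
    simp only [Matrix.kroneckerMap_apply, Matrix.add_apply, Matrix.one_apply, rhoH,
      Matrix.single_apply, Prod.fst_swap, Prod.snd_swap, smul_eq_mul]
    grind
  · intro b c
    refine Finset.sum_eq_zero fun a _ => ?_
    simp only [Matrix.neg_apply, Matrix.one_apply, rhoH, Matrix.single_apply]
    grind

theorem isGauge_E (i : Fin (n - 1)) :
    IsGauge (blk (rhoK i) (rhoE i) 1) (blk (rhoKinv i) (-(rhoKinv i * rhoE i)) 1) := by
  refine (isGauge_rhoK i).blk isGauge_one ?_ (by simp) ?_ ?_
  · rw [mul_neg, ← mul_assoc, (isGauge_rhoK i).mul_inv]; simp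
  · have e : toMat Scal (sMat n) = sMat n := Matrix.ext fun _ _ => by simp [toMat]
    refine Matrix.ext fun x y => ?_
    rw [← e, toMat_sMat_mul_apply, mul_toMat_sMat_apply]
    simp only [Matrix.kroneckerMap_apply, Matrix.add_apply, Matrix.one_apply, rhoE, rhoK,
      Matrix.single_apply, Prod.fst_swap, Prod.snd_swap, smul_eq_mul, Matrix.diagonal_apply]
    obtain ⟨a, b⟩ := x
    obtain ⟨c, d⟩ := y
    have := qpow_one_mul_neg_one
    simp only [Fin.ext_iff, lo, hi, Fin.lt_def]
    generalize a.val = a, b.val = b, c.val = c, d.val = d, i.val = i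
    grind
  · intro b c
    have := qpow_one_mul_neg_one
    have h1 : qpow (-2 * ((hi i).val : ℤ)) = qpow (-2 * ((lo i).val : ℤ)) * qpow (-1) * qpow (-1) := by
      rw [← qpow_add, ← qpow_add]; congr 1; simp [lo, hi]; ring
    have h2 := lo_ne_hi i
    rw [← Matrix.diagonal_one, rhoKinv, sum_diagonal_mul_add, Matrix.neg_apply,
      Matrix.diagonal_mul, rhoE, Matrix.single_apply]
    grind

theorem isGauge_F (i : Fin (n - 1)) :
    IsGauge (blk 1 (rhoF i) (rhoKinv i)) (blk 1 (-(rhoF i * rhoK i)) (rhoK i)) := by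
  refine isGauge_one.blk (isGauge_rhoKinv i) (by simp) ?_ ?_ ?_
  · rw [neg_mul, mul_assoc, (isGauge_rhoK i).mul_inv]; simp
  · have e : toMat Scal (sMat n) = sMat n := Matrix.ext fun _ _ => by simp [toMat]
    refine Matrix.ext fun x y => ?_
    rw [← e, toMat_sMat_mul_apply, mul_toMat_sMat_apply]
    simp only [Matrix.kroneckerMap_apply, Matrix.add_apply, Matrix.one_apply, rhoF, rhoKinv,
      Matrix.single_apply, Prod.fst_swap, Prod.snd_swap, smul_eq_mul, Matrix.diagonal_apply]
    obtain ⟨a, b⟩ := x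
    obtain ⟨c, d⟩ := y
    have := qpow_one_mul_neg_one
    simp only [Fin.ext_iff, lo, hi, Fin.lt_def]
    generalize a.val = a, b.val = b, c.val = c, d.val = d, i.val = i
    grind
  · intro b c
    have := qpow_one_mul_neg_one
    have h1 : qpow (-2 * ((hi i).val : ℤ)) = qpow (-2 * ((lo i).val : ℤ)) * qpow (-1) * qpow (-1) := by
      rw [← qpow_add, ← qpow_add]; congr 1; simp [lo, hi]; ring
    have h2 := lo_ne_hi i
    rw [← Matrix.diagonal_one, rhoKinv, sum_diagonal_mul_add, Matrix.neg_apply, rhoK,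
      Matrix.mul_diagonal, rhoF, Matrix.single_apply]
    grind

end Generators

/-! ### Coadjoint operators on reflection equation algebras -/

section Naturality

variable {n : ℕ} {A B : Type} [Ring A] [Algebra Scal A] [Ring B] [Algebra Scal B]

theorem toMat_map {ι : Type} (M : Matrix ι ι Scal) (f : A →ₐ[Scal] B) :
    (toMat A M).map f = toMat B M := by
  ext; simp [toMat]

theorem reflectionDefect_map (L : Matrix (Fin n) (Fin n) A) (f : A →ₐ[Scal] B) :
    (reflectionDefect L).map f = reflectionDefect (L.map f) := by
  have h : ((1 : Matrix (Fin n) (Fin n) A) ⊗ₖ L).map f =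
      (1 : Matrix (Fin n) (Fin n) B) ⊗ₖ L.map f := by
    ext x y
    by_cases hxy : x.1 = y.1 <;> simp [hxy, Matrix.one_apply]
  simp only [reflectionDefect]
  rw [Matrix.map_sub _ (map_sub f)]
  simp only [Matrix.map_mul, h, toMat_map]

theorem qTrace_map (L : Matrix (Fin n) (Fin n) A) (f : A →ₐ[Scal] B) :
    f (qTrace L) = qTrace (L.map f) := by
  simp [qTrace]

theorem cMat_map (c : ℂ) (f : A →ₐ[Scal] B) : (cMat n A c).map f = cMat n B c :=
  toMat_map _ f

theorem cMat_eq (c : ℂ) : cMat n A c = (PowerSeries.C c : Scal) • 1 := by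
  ext i j
  by_cases h : i = j <;> simp [cMat, toMat, h, Algebra.smul_def]

end Naturality

section CoadjointOperators

variable {n : ℕ}

/-- Invariance of a set of relations under gauge transformations `L ↦ G⁻¹ L G` whose entries
commute with the entries of `L`. -/
def GaugeInvariant (s : Set (CFree (Fin n × Fin n))) : Prop :=
  ∀ (B : Type) [Ring B] [Algebra Scal B] (θ θ' : CFree (Fin n × Fin n) →ₐ[Scal] B)
    (G Gi : Matrix (Fin n) (Fin n) B), IsGauge G Gi →
    (∀ a b c d, Commute (G a b) ((freeGenMatrix n).map θ c d)) →
    (∀ a b c d, Commute (Gi a b) ((freeGenMatrix n).map θ c d)) →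
    (freeGenMatrix n).map θ' = Gi * (freeGenMatrix n).map θ * G →
    (∀ r ∈ s, θ r = 0) → ∀ r ∈ s, θ' r = 0

/-- The matrix of generators of a presented algebra. -/
def genMatrix (s : Set (CFree (Fin n × Fin n))) : Matrix (Fin n) (Fin n) (Presented s) :=
  (freeGenMatrix n).map (mkP s)

variable {s : Set (CFree (Fin n × Fin n))}

theorem genMatrix_apply (a b : Fin n) : genMatrix s a b = mkP s (gen (a, b)) := rfl

/-- A gauge transformation of the generating matrix extends to a morphism of algebras. -/
theorem exists_gauge_algHom (hs : GaugeInvariant s) {B : Type} [Ring B] [Algebra Scal B]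
    [HComplete B] (f : Presented s →ₐ[Scal] B) {G Gi : Matrix (Fin n) (Fin n) B}
    (h : IsGauge G Gi) (hG : ∀ a b x, Commute (G a b) (f x))
    (hGi : ∀ a b x, Commute (Gi a b) (f x)) :
    ∃ α : Presented s →ₐ[Scal] B, (genMatrix s).map α = Gi * (genMatrix s).map f * G := by
  set θ' : CFree (Fin n × Fin n) →ₐ[Scal] B :=
    eval fun x => (Gi * (genMatrix s).map f * G) x.1 x.2 with hθ'
  have e : (freeGenMatrix n).map θ' = Gi * (genMatrix s).map f * G := by
    ext a b
    simp [freeGenMatrix, hθ']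
  have hr : ∀ r ∈ s, θ' r = 0 :=
    hs B (f.comp (mkP s)) θ' G Gi h (fun a b c d => hG a b _) (fun a b c d => hGi a b _) e
      fun r hr => by rw [AlgHom.comp_apply, mkP_eq_zero hr, map_zero]
  exact ⟨liftP θ' hr, e⟩

theorem exists_conj_algHom (hs : GaugeInvariant s) {p pi : Matrix (Fin n) (Fin n) Scal}
    (h : IsGauge p pi) : ∃ α : Presented s →ₐ[Scal] Presented s, (genMatrix s).map α =
      toMat _ pi * genMatrix s * toMat _ p := by
  obtain ⟨α, hα⟩ := exists_gauge_algHom hs (AlgHom.id Scal (Presented s))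
    (h.map (Algebra.ofId Scal (Presented s)))
    (fun a b x => Algebra.commute_algebraMap_left (p a b) x)
    (fun a b x => Algebra.commute_algebraMap_left (pi a b) x)
  exact ⟨α, by rw [hα]; congr 2⟩

theorem commute_toMatHom_scalar {A : Type} [Ring A] [Algebra Scal A]
    (M : Matrix (Fin 2) (Fin 2) Scal) (a : A) :
    Commute (toMatHom A (Fin 2) M) (Matrix.scalarAlgHom (Fin 2) Scal a) := by
  ext i j
  simp [toMatHom, Algebra.ofId_apply, Algebra.commutes]

/-- A triangular gauge transformation gives a skew derivation: it is the off-diagonal entry of the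
corresponding morphism to `2 × 2` matrices. -/
theorem exists_skewDerivation (hs : GaugeInvariant s)
    {p q r pi qi ri : Matrix (Fin n) (Fin n) Scal} (h : IsGauge (blk p q r) (blk pi qi ri))
    (α β : Presented s →ₐ[Scal] Presented s)
    (hα : (genMatrix s).map α = toMat _ pi * genMatrix s * toMat _ p)
    (hβ : (genMatrix s).map β = toMat _ ri * genMatrix s * toMat _ r) :
    ∃ D : Presented s →ₗ[Scal] Presented s, D 1 = 0 ∧ (∀ a b, D (a * b) = α a * D b + D a * β b) ∧
      (genMatrix s).map D = toMat _ pi * genMatrix s * toMat _ q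
        + toMat _ qi * genMatrix s * toMat _ r := by
  obtain ⟨Φ, hΦ⟩ := exists_gauge_algHom hs (Matrix.scalarAlgHom (Fin 2) Scal)
    (h.map (toMatHom (Presented s) (Fin 2))) (fun a b x => commute_toMatHom_scalar _ _)
    (fun a b x => commute_toMatHom_scalar _ _)
  have e : (genMatrix s).map (Matrix.scalarAlgHom (Fin 2) Scal) =
      blk (genMatrix s) 0 (genMatrix s) := by
    ext a b i j
    fin_cases i <;> fin_cases j <;> simp [blk]
  rw [e, blk_map, blk_map, blk_mul, blk_mul] at hΦ
  have hgen : ∀ a b, Φ (mkP s (gen (a, b))) = _ := fun a b => congrFun (congrFun hΦ a) b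
  let ent (i j : Fin 2) : Presented s →ₗ[Scal] Presented s :=
    (LinearMap.proj j ∘ₗ LinearMap.proj i) ∘ₗ Φ.toLinearMap
  have hent : ∀ i j a, Φ a i j = ent i j a := fun _ _ _ => rfl
  have hmul : ∀ i j a b, ent i j (a * b) = ent i 0 a * ent 0 j b + ent i 1 a * ent 1 j b := by
    intro i j a b
    rw [← hent, map_mul, Matrix.mul_apply, Fin.sum_univ_two]
    rfl
  have hone : ∀ i j, ent i j 1 = (1 : Matrix (Fin 2) (Fin 2) (Presented s)) i j := by
    intro i j
    rw [← hent, map_one]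
  -- The values of `Φ` are upper triangular with diagonal entries `α` and `β`.
  have h10 : ent 1 0 = 0 := by
    refine presented_linearMap_ext' (by rw [hone]; simp) fun x b hb => ?_
    rw [hmul, hb, ← hent, hgen x.1 x.2]
    simp [blk]
  have h00 : ent 0 0 = α.toLinearMap := by
    refine presented_linearMap_ext' (by rw [hone]; simp) fun x b hb => ?_
    have := congrFun (congrFun hα x.1) x.2
    rw [Matrix.map_apply, genMatrix_apply] at this
    rw [hmul, hb, ← hent, hgen x.1 x.2, h10]
    simp [blk, this]
  have h11 : ent 1 1 = β.toLinearMap := by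
    refine presented_linearMap_ext' (by rw [hone]; simp) fun x b hb => ?_
    have := congrFun (congrFun hβ x.1) x.2
    rw [Matrix.map_apply, genMatrix_apply] at this
    rw [hmul, hb, h10, ← hent 1 1, hgen x.1 x.2]
    simp [blk, this]
  refine ⟨ent 0 1, by rw [hone]; simp, fun a b => ?_, ?_⟩
  · rw [hmul, h00, h11]; rfl
  · ext a b
    rw [Matrix.map_apply, genMatrix_apply, ← hent, hgen]
    simp [blk]

/-- Candidates for the action of the generators of `U_h(gl(n))` on a module. -/
structure QOps (n : ℕ) (M : Type) [AddCommGroup M] [Module Scal M] where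
  H : Fin n → M →ₗ[Scal] M
  E : Fin (n - 1) → M →ₗ[Scal] M
  F : Fin (n - 1) → M →ₗ[Scal] M
  K : Fin (n - 1) → M →ₗ[Scal] M
  Kinv : Fin (n - 1) → M →ₗ[Scal] M

/-- Compatibility of a bilinear map with the generators of `U_h(gl(n))`, by the coproduct. -/
structure QOps.Intertwines {M₁ M₂ M₃ : Type} [AddCommGroup M₁] [Module Scal M₁] [AddCommGroup M₂]
    [Module Scal M₂] [AddCommGroup M₃] [Module Scal M₃] (Q₁ : QOps n M₁) (Q₂ : QOps n M₂)
    (Q₃ : QOps n M₃) (β : M₁ →ₗ[Scal] M₂ →ₗ[Scal] M₃) : Prop where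
  H : ∀ r a b, Q₃.H r (β a b) = β (Q₁.H r a) b + β a (Q₂.H r b)
  E : ∀ i a b, Q₃.E i (β a b) = β (Q₁.E i a) b + β (Q₁.K i a) (Q₂.E i b)
  F : ∀ i a b, Q₃.F i (β a b) = β (Q₁.F i a) (Q₂.Kinv i b) + β a (Q₂.F i b)
  K : ∀ i a b, Q₃.K i (β a b) = β (Q₁.K i a) (Q₂.K i b)
  Kinv : ∀ i a b, Q₃.Kinv i (β a b) = β (Q₁.Kinv i a) (Q₂.Kinv i b)

/-- The coadjoint operators: they are compatible with the multiplication and the unit, and are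
given on the generating matrix by `x ▷ L = ρ(γ(x₁)) L ρ(x₂)`. -/
structure QOps.IsCoadjoint {A : Type} [Ring A] [Algebra Scal A] (Q : QOps n A)
    (L : Matrix (Fin n) (Fin n) A) : Prop where
  mul : Q.Intertwines Q Q (LinearMap.mul Scal A)
  one_H : ∀ r, Q.H r 1 = 0
  one_E : ∀ i, Q.E i 1 = 0
  one_F : ∀ i, Q.F i 1 = 0
  one_K : ∀ i, Q.K i 1 = 1
  one_Kinv : ∀ i, Q.Kinv i 1 = 1
  on_H : ∀ r, L.map (Q.H r) = -toMat A (rhoH r) * L + L * toMat A (rhoH r)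
  on_E : ∀ i, L.map (Q.E i) =
    -toMat A (rhoKinv i * rhoE i) * L + toMat A (rhoKinv i) * L * toMat A (rhoE i)
  on_F : ∀ i, L.map (Q.F i) =
    -toMat A (rhoF i * rhoK i) * L * toMat A (rhoKinv i) + L * toMat A (rhoF i)
  on_K : ∀ i, L.map (Q.K i) = toMat A (rhoKinv i) * L * toMat A (rhoK i)
  on_Kinv : ∀ i, L.map (Q.Kinv i) = toMat A (rhoK i) * L * toMat A (rhoKinv i)

/-- The operators of `K i` are conjugations by diagonal matrices, and those of `H r`, `E i`, `F i`
are skew derivations coming from triangular gauge transformations. -/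
theorem exists_coadjointOps (hs : GaugeInvariant s) :
    ∃ Q : QOps n (Presented s), Q.IsCoadjoint (genMatrix s) := by
  choose K hK using fun i => exists_conj_algHom hs (isGauge_rhoK i)
  choose Kinv hKinv using fun i => exists_conj_algHom hs (isGauge_rhoKinv i)
  have hid : (genMatrix s).map (AlgHom.id Scal (Presented s)) =
      toMat _ 1 * genMatrix s * toMat _ 1 := by
    simp [toMat_eq]
  choose H hH1 hHmul hH using fun r => exists_skewDerivation hs (isGauge_H r)
    (AlgHom.id Scal _) (AlgHom.id Scal _) hid hid
  choose E hE1 hEmul hE using fun i => exists_skewDerivation hs (isGauge_E i)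
    (K i) (AlgHom.id Scal _) (hK i) hid
  choose F hF1 hFmul hF using fun i => exists_skewDerivation hs (isGauge_F i)
    (AlgHom.id Scal _) (Kinv i) hid (hKinv i)
  refine ⟨⟨H, E, F, fun i => (K i).toLinearMap, fun i => (Kinv i).toLinearMap⟩, ⟨?_, ?_, ?_, ?_, ?_⟩,
    hH1, hE1, hF1, by simp, by simp, fun r => ?_, fun i => ?_, fun i => ?_, hK, hKinv⟩
  · intro r a b; simp [hHmul, add_comm]
  · intro i a b; simp [hEmul, add_comm]
  · intro i a b; simp [hFmul, add_comm]
  · intro i a b; simp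
  · intro i a b; simp
  · exact (hH r).trans (by simp [toMat_eq, add_comm])
  · exact (hE i).trans (by simp [toMat_eq, add_comm])
  · exact (hF i).trans (by simp [toMat_eq, add_comm])

end CoadjointOperators

/-! ### Quantum numbers -/

/-- The quantum number `(q^w - q^{-w}) / (q - q⁻¹)`. -/
def qnum (w : ℤ) : Scal :=
  (divH (expH (1 : ℂ) - expH (-1 : ℂ)))⁻¹ * divH (expH (w : ℂ) - expH (-(w : ℂ)))

theorem X_mul_divH {R : Type} [Ring R] {f : PowerSeries R} (h : PowerSeries.constantCoeff f = 0) :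
    PowerSeries.X * divH f = f := by
  conv_rhs => rw [PowerSeries.eq_X_mul_shift_add_const f, h, map_zero, add_zero]
  rfl

theorem constantCoeff_expH (z : ℂ) : PowerSeries.constantCoeff (expH z : Scal) = 1 := by
  rw [← PowerSeries.coeff_zero_eq_constantCoeff_apply]
  simp [expH]

theorem constantCoeff_divH_ne_zero :
    PowerSeries.constantCoeff (divH (expH (1 : ℂ) - expH (-1 : ℂ))) ≠ 0 := by
  rw [← PowerSeries.coeff_zero_eq_constantCoeff_apply]
  simp only [divH, expH, PowerSeries.coeff_mk, map_sub]
  norm_num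

theorem qnum_spec (w : ℤ) : (qpow 1 - qpow (-1)) * qnum w = qpow w - qpow (-w) := by
  have h1 : qpow 1 - qpow (-1) = PowerSeries.X * divH (expH (1 : ℂ) - expH (-1 : ℂ)) := by
    rw [X_mul_divH (by simp [constantCoeff_expH])]
    simp [qpow]
  have h2 : qpow w - qpow (-w) = PowerSeries.X * divH (expH (w : ℂ) - expH (-(w : ℂ))) := by
    rw [X_mul_divH (by simp [constantCoeff_expH])]
    simp [qpow]
  rw [h1, h2, qnum, mul_assoc, ← mul_assoc (divH _), PowerSeries.mul_inv_cancel _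
    constantCoeff_divH_ne_zero, one_mul]

theorem qpow_one_sub_ne_zero : qpow 1 - qpow (-1) ≠ 0 := by
  intro h
  have := congrArg (PowerSeries.coeff 1) h
  simp [qpow, expH] at this

theorem qnum_eq_of {w : ℤ} {x : Scal}
    (h : (qpow 1 - qpow (-1)) * x = qpow w - qpow (-w)) : qnum w = x :=
  mul_left_cancel₀ qpow_one_sub_ne_zero ((qnum_spec w).trans h.symm)

@[simp] theorem qnum_zero : qnum 0 = 0 := qnum_eq_of (by simp)

@[simp] theorem qnum_one : qnum 1 = 1 := qnum_eq_of (by simp)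

@[simp] theorem qnum_neg_one : qnum (-1) = -1 := qnum_eq_of (by simp)

theorem qnum_add (w v : ℤ) : qnum (w + v) = qpow (-v) * qnum w + qpow w * qnum v := by
  refine qnum_eq_of ?_
  rw [mul_add, mul_left_comm, qnum_spec, mul_left_comm, qnum_spec, neg_add, qpow_add, qpow_add]
  ring

/-! ### Skew primitive elements -/

section SkewPrimitive

variable {R M M₁ M₂ M₃ : Type} [CommRing R] [AddCommGroup M] [Module R M] [AddCommGroup M₁]
  [Module R M₁] [AddCommGroup M₂] [Module R M₂] [AddCommGroup M₃] [Module R M₃]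
  {β : M₁ →ₗ[R] M₂ →ₗ[R] M₃}

/-- The vanishing of the Serre expression `x² y - c x y x + y x²` of two operators at a vector. -/
def SerreAt (c : R) (x y : M →ₗ[R] M) (m : M) : Prop :=
  x (x (y m)) - c • x (y (x m)) + y (x (x m)) = 0

/-- The quantum Serre expression is skew primitive: its vanishing at two vectors implies its
vanishing at their product. -/
theorem SerreAt.map₂ {t s : R} (hts : t * s = 1) {x₁ y₁ k₁ l₁ : M₁ →ₗ[R] M₁}
    {x₂ y₂ : M₂ →ₗ[R] M₂} {x₃ y₃ : M₃ →ₗ[R] M₃}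
    (hx : ∀ a b, x₃ (β a b) = β (x₁ a) b + β (k₁ a) (x₂ b))
    (hy : ∀ a b, y₃ (β a b) = β (y₁ a) b + β (l₁ a) (y₂ b)) {a : M₁} {b : M₂} {c d : R}
    (hk : k₁ a = c • a) (hl : l₁ a = d • a)
    (hkx : k₁ (x₁ a) = (t * t * c) • x₁ a)
    (hky : k₁ (y₁ a) = (s * c) • y₁ a)
    (hlx : l₁ (x₁ a) = (s * d) • x₁ a)
    (hkxy : k₁ (x₁ (y₁ a)) = (t * c) • x₁ (y₁ a))
    (hkyx : k₁ (y₁ (x₁ a)) = (t * c) • y₁ (x₁ a))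
    (hlxx : l₁ (x₁ (x₁ a)) = (s * s * d) • x₁ (x₁ a))
    (ha : SerreAt (t + s) x₁ y₁ a) (hb : SerreAt (t + s) x₂ y₂ b) :
    SerreAt (t + s) x₃ y₃ (β a b) := by
  unfold SerreAt at *
  have ha' : y₁ (x₁ (x₁ a)) = (t + s) • x₁ (y₁ (x₁ a)) - x₁ (x₁ (y₁ a)) := by
    rw [← sub_eq_zero, ← ha]; abel
  have hb' : y₂ (x₂ (x₂ b)) = (t + s) • x₂ (y₂ (x₂ b)) - x₂ (x₂ (y₂ b)) := by
    rw [← sub_eq_zero, ← hb]; abel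
  simp only [hx, hy, map_add, map_smul, LinearMap.smul_apply, hk, hl, hkx,
    hky, hlx, hkxy, hkyx, hlxx, ha', hb', map_sub, LinearMap.sub_apply, smul_add, smul_sub,
    smul_smul]
  match_scalars <;> grind

/-- The commutator of a skew primitive element of type `(1, k)` with one of type `(l, 1)`. -/
theorem commutator_map₂ {x₁ y₁ k₁ : M₁ →ₗ[R] M₁} {x₂ y₂ l₂ : M₂ →ₗ[R] M₂}
    {x₃ y₃ : M₃ →ₗ[R] M₃}
    (hx : ∀ a b, x₃ (β a b) = β (x₁ a) b + β (k₁ a) (x₂ b))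
    (hy : ∀ a b, y₃ (β a b) = β (y₁ a) (l₂ b) + β a (y₂ b)) {a : M₁} {b : M₂} {c d u z w : R}
    (hk : k₁ a = c • a) (hl : l₂ b = d • b) (hky : k₁ (y₁ a) = (u * c) • y₁ a)
    (hlx : l₂ (x₂ b) = (u * d) • x₂ b) (ha : x₁ (y₁ a) - y₁ (x₁ a) = z • a)
    (hb : x₂ (y₂ b) - y₂ (x₂ b) = w • b) :
    x₃ (y₃ (β a b)) - y₃ (x₃ (β a b)) = (d * z + c * w) • β a b := by
  rw [sub_eq_iff_eq_add] at ha hb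
  simp only [hx, hy, map_add, map_smul, LinearMap.smul_apply, hk, hl, hky, hlx, ha, hb,
    LinearMap.add_apply]
  module

end SkewPrimitive

/-! ### Weights -/

section Weights

variable {n : ℕ}

/-- The `i`-th simple root as an integral weight. -/
def root (i : Fin (n - 1)) (a : Fin n) : ℤ :=
  (if a = lo i then 1 else 0) - (if a = hi i then 1 else 0)

/-- The value of the `i`-th simple coroot on a weight. -/
def pair (w : Fin n → ℤ) (i : Fin (n - 1)) : ℤ := w (lo i) - w (hi i)

theorem rootVal_eq (a : Fin n) (i : Fin (n - 1)) : rootVal a i = (root i a : Scal) := by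
  simp [rootVal, root]

theorem pair_add (w v : Fin n → ℤ) (i : Fin (n - 1)) : pair (w + v) i = pair w i + pair v i := by
  simp [pair]; ring

theorem pair_sub (w v : Fin n → ℤ) (i : Fin (n - 1)) : pair (w - v) i = pair w i - pair v i := by
  simp [pair]; ring

@[simp] theorem pair_zero (i : Fin (n - 1)) : pair (0 : Fin n → ℤ) i = 0 := by simp [pair]

theorem pair_root_self (i : Fin (n - 1)) : pair (root i) i = 2 := by
  simp [pair, root, lo_ne_hi, (lo_ne_hi i).symm]

theorem pair_root_comm (i j : Fin (n - 1)) : pair (root i) j = pair (root j) i := by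
  simp only [pair, root, lo, hi, Fin.ext_iff]
  grind

theorem pair_root_adjacent {i j : Fin (n - 1)} (h : Adjacent i j) : pair (root i) j = -1 := by
  simp only [pair, root, lo, hi, Fin.ext_iff, Adjacent] at *
  grind

theorem pair_root_not_adjacent {i j : Fin (n - 1)} (hij : i ≠ j) (h : ¬ Adjacent i j) :
    pair (root i) j = 0 := by
  simp only [pair, root, lo, hi, Fin.ext_iff, Adjacent, ne_eq] at *
  grind

variable {M M₁ M₂ M₃ : Type} [AddCommGroup M] [Module Scal M] [AddCommGroup M₁] [Module Scal M₁]
  [AddCommGroup M₂] [Module Scal M₂] [AddCommGroup M₃] [Module Scal M₃]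
  {Q : QOps n M} {Q₁ : QOps n M₁} {Q₂ : QOps n M₂} {Q₃ : QOps n M₃}
  {β : M₁ →ₗ[Scal] M₂ →ₗ[Scal] M₃}

namespace QOps

/-- `m` is a vector of weight `w`. -/
structure Wt (Q : QOps n M) (w : Fin n → ℤ) (m : M) : Prop where
  H : ∀ r, Q.H r m = (w r : Scal) • m
  K : ∀ i, Q.K i m = qpow (pair w i) • m
  Kinv : ∀ i, Q.Kinv i m = qpow (-pair w i) • m

theorem Wt.add {w : Fin n → ℤ} {m m' : M} (h : Q.Wt w m) (h' : Q.Wt w m') : Q.Wt w (m + m') where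
  H r := by rw [map_add, h.H, h'.H, smul_add]
  K r := by rw [map_add, h.K, h'.K, smul_add]
  Kinv r := by rw [map_add, h.Kinv, h'.Kinv, smul_add]

theorem Wt.zero (w : Fin n → ℤ) : Q.Wt w 0 := ⟨by simp, by simp, by simp⟩

theorem Wt.smul {w : Fin n → ℤ} {m : M} (h : Q.Wt w m) (c : Scal) : Q.Wt w (c • m) where
  H r := by rw [map_smul, h.H, smul_comm]
  K r := by rw [map_smul, h.K, smul_comm]
  Kinv r := by rw [map_smul, h.Kinv, smul_comm]

theorem Wt.map₂ (hβ : Q₁.Intertwines Q₂ Q₃ β) {w v : Fin n → ℤ} {a : M₁} {b : M₂}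
    (ha : Q₁.Wt w a) (hb : Q₂.Wt v b) : Q₃.Wt (w + v) (β a b) where
  H r := by
    rw [hβ.H, ha.H, hb.H]
    simp [add_smul]
  K i := by
    rw [hβ.K, ha.K, hb.K, pair_add, qpow_add]
    simp [smul_smul, mul_comm]
  Kinv i := by
    rw [hβ.Kinv, ha.Kinv, hb.Kinv, pair_add, neg_add, qpow_add]
    simp [smul_smul, mul_comm]

/-- The operators `E i` and `F i` shift the weights by the simple roots. -/
structure Graded (Q : QOps n M) : Prop where
  E : ∀ i w m, Q.Wt w m → Q.Wt (w + root i) (Q.E i m)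
  F : ∀ i w m, Q.Wt w m → Q.Wt (w - root i) (Q.F i m)

/-- The weight vectors on which the operators `E i` and `F i` act as required by `Graded`. -/
def IsShifted (Q : QOps n M) (m : M) : Prop :=
  ∃ w, Q.Wt w m ∧ (∀ i, Q.Wt (w + root i) (Q.E i m)) ∧ ∀ i, Q.Wt (w - root i) (Q.F i m)

theorem IsShifted.map₂ (hβ : Q₁.Intertwines Q₂ Q₃ β) {a : M₁} {b : M₂}
    (ha : Q₁.IsShifted a) (hb : Q₂.IsShifted b) : Q₃.IsShifted (β a b) := by
  obtain ⟨w, hw, hwE, hwF⟩ := ha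
  obtain ⟨v, hv, hvE, hvF⟩ := hb
  refine ⟨w + v, hw.map₂ hβ hv, fun i => ?_, fun i => ?_⟩
  · rw [hβ.E, hw.K, map_smul, LinearMap.smul_apply]
    have h1 := (hwE i).map₂ hβ hv
    have h2 := (hw.map₂ hβ (hvE i)).smul (qpow (pair w i))
    rw [add_right_comm] at h1
    rw [← add_assoc] at h2
    exact h1.add h2
  · rw [hβ.F, hv.Kinv, map_smul]
    have h1 := ((hwF i).map₂ hβ hv).smul (qpow (-pair v i))
    have h2 := hw.map₂ hβ (hvF i)
    rw [sub_add_eq_add_sub] at h1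
    rw [← add_sub_assoc] at h2
    exact h1.add h2

/-- Gradedness is a family of operator identities, so it suffices to have it on a set of weight
vectors that determines linear maps. -/
theorem Graded.of_dense (h : ∀ T T' : M →ₗ[Scal] M, (∀ m, Q.IsShifted m → T m = T' m) → T = T') :
    Q.Graded := by
  have HE : ∀ r i, Q.H r ∘ₗ Q.E i = Q.E i ∘ₗ Q.H r + (root i r : Scal) • Q.E i := by
    refine fun r i => h _ _ fun m ⟨w, hw, hE, _⟩ => ?_
    simp [(hE i).H, hw.H, add_smul]
  have HF : ∀ r i, Q.H r ∘ₗ Q.F i = Q.F i ∘ₗ Q.H r - (root i r : Scal) • Q.F i := by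
    refine fun r i => h _ _ fun m ⟨w, hw, _, hF⟩ => ?_
    simp [(hF i).H, hw.H, sub_smul]
  have KE : ∀ j i, Q.K j ∘ₗ Q.E i = qpow (pair (root i) j) • (Q.E i ∘ₗ Q.K j) := by
    refine fun r i => h _ _ fun m ⟨w, hw, hE, _⟩ => ?_
    simp [(hE i).K, hw.K, pair_add, qpow_add, smul_smul, mul_comm]
  have KF : ∀ j i, Q.K j ∘ₗ Q.F i = qpow (-pair (root i) j) • (Q.F i ∘ₗ Q.K j) := by
    refine fun r i => h _ _ fun m ⟨w, hw, _, hF⟩ => ?_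
    rw [LinearMap.comp_apply, (hF i).K, pair_sub, sub_eq_neg_add, qpow_add]
    simp [hw.K, smul_smul]
  have KiE : ∀ j i, Q.Kinv j ∘ₗ Q.E i = qpow (-pair (root i) j) • (Q.E i ∘ₗ Q.Kinv j) := by
    refine fun r i => h _ _ fun m ⟨w, hw, hE, _⟩ => ?_
    simp [(hE i).Kinv, hw.Kinv, pair_add, qpow_add, smul_smul]
  have KiF : ∀ j i, Q.Kinv j ∘ₗ Q.F i = qpow (pair (root i) j) • (Q.F i ∘ₗ Q.Kinv j) := by
    refine fun r i => h _ _ fun m ⟨w, hw, _, hF⟩ => ?_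
    rw [LinearMap.comp_apply, (hF i).Kinv, pair_sub, neg_sub, sub_eq_add_neg, qpow_add]
    simp [hw.Kinv, smul_smul]
  refine ⟨fun i w m hm => ⟨fun r => ?_, fun j => ?_, fun j => ?_⟩,
    fun i w m hm => ⟨fun r => ?_, fun j => ?_, fun j => ?_⟩⟩
  · have := LinearMap.congr_fun (HE r i) m
    simp only [LinearMap.comp_apply, LinearMap.add_apply, LinearMap.smul_apply, hm.H, map_smul]
      at this
    simp [this, add_smul]
  · have := LinearMap.congr_fun (KE j i) m
    simp only [LinearMap.comp_apply, LinearMap.smul_apply, hm.K, map_smul, smul_smul] at this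
    rw [this, pair_add, add_comm, qpow_add]
  · have := LinearMap.congr_fun (KiE j i) m
    simp only [LinearMap.comp_apply, LinearMap.smul_apply, hm.Kinv, map_smul, smul_smul] at this
    rw [this, pair_add, neg_add, add_comm, qpow_add]
  · have := LinearMap.congr_fun (HF r i) m
    simp only [LinearMap.comp_apply, LinearMap.sub_apply, LinearMap.smul_apply, hm.H, map_smul]
      at this
    simp [this, sub_smul]
  · have := LinearMap.congr_fun (KF j i) m
    simp only [LinearMap.comp_apply, LinearMap.smul_apply, hm.K, map_smul, smul_smul] at this
    rw [this, pair_sub, sub_eq_add_neg, add_comm, qpow_add]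
  · have := LinearMap.congr_fun (KiF j i) m
    simp only [LinearMap.comp_apply, LinearMap.smul_apply, hm.Kinv, map_smul, smul_smul] at this
    rw [this, pair_sub, neg_sub, sub_eq_add_neg, qpow_add]

/-- `m` is a vector of weight `w` at which the defining relations of `U_h(gl(n))` hold. -/
structure Good (Q : QOps n M) (w : Fin n → ℤ) (m : M) : Prop where
  wt : Q.Wt w m
  EF : ∀ i j, Q.E i (Q.F j m) - Q.F j (Q.E i m) = if i = j then qnum (pair w i) • m else 0
  EE : ∀ i j, i ≠ j → ¬ Adjacent i j → Q.E i (Q.E j m) = Q.E j (Q.E i m)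
  FF : ∀ i j, i ≠ j → ¬ Adjacent i j → Q.F i (Q.F j m) = Q.F j (Q.F i m)
  serreE : ∀ i j, Adjacent i j → SerreAt (qpow 1 + qpow (-1)) (Q.E i) (Q.E j) m
  serreF : ∀ i j, Adjacent i j → SerreAt (qpow 1 + qpow (-1)) (Q.F i) (Q.F j) m

/-- The defining relations of `U_h(gl(n))` are compatible with the coproduct. -/
theorem Good.map₂ (hβ : Q₁.Intertwines Q₂ Q₃ β) (h₁ : Q₁.Graded) (h₂ : Q₂.Graded)
    {w v : Fin n → ℤ} {a : M₁} {b : M₂} (ha : Q₁.Good w a) (hb : Q₂.Good v b) :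
    Q₃.Good (w + v) (β a b) where
  wt := ha.wt.map₂ hβ hb.wt
  EF i j := by
    have hF := h₁.F j w a ha.wt
    have hE := h₂.E i v b hb.wt
    have hkF : Q₁.K i (Q₁.F j a) = (qpow (-pair (root j) i) * qpow (pair w i)) • Q₁.F j a := by
      rw [hF.K, pair_sub, sub_eq_neg_add, qpow_add]
    have hlE : Q₂.Kinv j (Q₂.E i b) = (qpow (-pair (root j) i) * qpow (-pair v j)) • Q₂.E i b := by
      rw [hE.Kinv, pair_add, neg_add_rev, qpow_add, pair_root_comm]
    have e1 := ha.EF i j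
    have e2 := hb.EF i j
    split_ifs at e1 e2 ⊢ with hij
    · subst hij
      rw [commutator_map₂ (hβ.E i) (hβ.F i) (ha.wt.K i) (hb.wt.Kinv i) hkF hlE e1 e2, pair_add,
        qnum_add]
    · rw [← zero_smul Scal] at e1 e2
      rw [commutator_map₂ (hβ.E i) (hβ.F j) (ha.wt.K i) (hb.wt.Kinv j) hkF hlE e1 e2]
      simp
  EE i j hij hadj := by
    have hEi := h₁.E i w a ha.wt
    have hEj := h₁.E j w a ha.wt
    have hp := pair_root_not_adjacent hij hadj
    have hp' : pair (root j) i = 0 := by rw [pair_root_comm, hp]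
    simp only [hβ.E, map_add, map_smul, LinearMap.smul_apply, ha.wt.K, hEi.K, hEj.K, pair_add,
      hp, hp', add_zero, ha.EE i j hij hadj, hb.EE i j hij hadj, smul_add, smul_smul,
      mul_comm (qpow (pair w i))]
    abel
  FF i j hij hadj := by
    have hFi := h₂.F i v b hb.wt
    have hFj := h₂.F j v b hb.wt
    have hp := pair_root_not_adjacent hij hadj
    have hp' : pair (root j) i = 0 := by rw [pair_root_comm, hp]
    simp only [hβ.F, map_add, map_smul, hb.wt.Kinv, hFi.Kinv, hFj.Kinv,
      pair_sub, hp, hp', sub_zero, ha.FF i j hij hadj, hb.FF i j hij hadj, smul_add, smul_smul,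
      mul_comm (qpow (-pair v i))]
    abel
  serreE i j hadj := by
    have hEi := h₁.E i w a ha.wt
    have hEj := h₁.E j w a ha.wt
    have hEij := h₁.E i _ _ hEj
    have hEji := h₁.E j _ _ hEi
    have hEii := h₁.E i _ _ hEi
    have p1 := pair_root_self i
    have p2 := pair_root_adjacent hadj
    have p3 : pair (root j) i = -1 := by rw [pair_root_comm, p2]
    refine SerreAt.map₂ qpow_one_mul_neg_one (hβ.E i) (hβ.E j) (ha.wt.K i) (ha.wt.K j)
      ?_ ?_ ?_ ?_ ?_ ?_
      (ha.serreE i j hadj) (hb.serreE i j hadj)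
    · rw [hEi.K, pair_add, p1, ← qpow_add, ← qpow_add]; congr 2; ring
    · rw [hEj.K, pair_add, p3, ← qpow_add]; congr 2; ring
    · rw [hEi.K, pair_add, p2, ← qpow_add]; congr 2; ring
    · rw [hEij.K, pair_add, pair_add, p1, p3, ← qpow_add]; congr 2; ring
    · rw [hEji.K, pair_add, pair_add, p1, p3, ← qpow_add]; congr 2; ring
    · rw [hEii.K, pair_add, pair_add, p2, ← qpow_add, ← qpow_add]; congr 2; ring
  serreF i j hadj := by
    have hEi := h₂.F i v b hb.wt
    have hEj := h₂.F j v b hb.wt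
    have hEij := h₂.F i _ _ hEj
    have hEji := h₂.F j _ _ hEi
    have hEii := h₂.F i _ _ hEi
    have p1 := pair_root_self i
    have p2 := pair_root_adjacent hadj
    have p3 : pair (root j) i = -1 := by rw [pair_root_comm, p2]
    -- `F` is skew primitive with the factors in the opposite order.
    refine SerreAt.map₂ (β := β.flip) (a := b) (b := a) qpow_one_mul_neg_one
      (fun b a => (hβ.F i a b).trans (add_comm _ _))
      (fun b a => (hβ.F j a b).trans (add_comm _ _)) (hb.wt.Kinv i) (hb.wt.Kinv j)
      ?_ ?_ ?_ ?_ ?_ ?_ (hb.serreF i j hadj) (ha.serreF i j hadj)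
    · rw [hEi.Kinv, pair_sub, p1, ← qpow_add, ← qpow_add]; congr 2; ring
    · rw [hEj.Kinv, pair_sub, p3, ← qpow_add]; congr 2; ring
    · rw [hEi.Kinv, pair_sub, p2, ← qpow_add]; congr 2; ring
    · rw [hEij.Kinv, pair_sub, pair_sub, p1, p3, ← qpow_add]; congr 2; ring
    · rw [hEji.Kinv, pair_sub, pair_sub, p1, p3, ← qpow_add]; congr 2; ring
    · rw [hEii.Kinv, pair_sub, pair_sub, p2, ← qpow_add, ← qpow_add]; congr 2; ring

end QOps

end Weights

/-! ### The vector representation and its dual -/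

section VectorRepresentations

variable {n : ℕ}

/-- A chain of vectors moved along the Dynkin diagram by the operators `E i` and `F i`
(in either direction) satisfies the relations of `U_h(gl(n))`. -/
theorem QOps.good_of_chain {M : Type} [AddCommGroup M] [Module Scal M] {Q : QOps n M}
    {e : Fin n → M} {w : Fin n → Fin n → ℤ} {σ τ : Fin (n - 1) → Fin n} {x y : Scal}
    (hw : ∀ b, Q.Wt (w b) (e b)) (hxy : x * y = 1)
    (hστ : (σ = lo ∧ τ = hi) ∨ (σ = hi ∧ τ = lo))
    (hE : ∀ i b, Q.E i (e b) = if b = σ i then x • e (τ i) else 0)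
    (hF : ∀ i b, Q.F i (e b) = if b = τ i then y • e (σ i) else 0)
    (hroot : ∀ i, w (τ i) = w (σ i) + root i)
    (hpair : ∀ b i, pair (w b) i = (if b = τ i then 1 else 0) - (if b = σ i then 1 else 0)) :
    (∀ b, Q.Good (w b) (e b)) ∧ ∀ b, Q.IsShifted (e b) := by
  have hσ : ∀ i j, σ i = σ j ↔ i = j := by
    rcases hστ with ⟨rfl, rfl⟩ | ⟨rfl, rfl⟩ <;> intro i j <;> simp [lo, hi, Fin.ext_iff]
  have hτ : ∀ i j, τ i = τ j ↔ i = j := by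
    rcases hστ with ⟨rfl, rfl⟩ | ⟨rfl, rfl⟩ <;> intro i j <;> simp [lo, hi, Fin.ext_iff]
  have hne : ∀ i, τ i ≠ σ i := by
    rcases hστ with ⟨rfl, rfl⟩ | ⟨rfl, rfl⟩ <;> intro i <;> simp [lo, hi]
  have hadj : ∀ i j, τ j = σ i → Adjacent i j := by
    rcases hστ with ⟨rfl, rfl⟩ | ⟨rfl, rfl⟩ <;> intro i j <;>
      simp only [lo, hi, Fin.ext_iff, Adjacent] <;> omega
  have hback : ∀ i j, τ i = σ j → τ j ≠ σ i := by
    rcases hστ with ⟨rfl, rfl⟩ | ⟨rfl, rfl⟩ <;> intro i j <;>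
      simp only [lo, hi, Fin.ext_iff, ne_eq] <;> omega
  refine ⟨fun b => ⟨hw b, fun i j => ?_, fun i j hij ha => ?_, fun i j hij ha => ?_,
    fun i j ha => ?_, fun i j ha => ?_⟩, fun b => ⟨w b, hw b, fun i => ?_, fun i => ?_⟩⟩
  · rw [hE, hF, apply_ite (Q.E i), apply_ite (Q.F j)]
    simp only [map_smul, map_zero, hE, hF, hσ, hτ, hpair, smul_ite, smul_zero, smul_smul,
      mul_comm y x, hxy, one_smul]
    by_cases hij : i = j
    · subst hij
      by_cases h1 : b = τ i
      · simp [h1, hne]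
      · by_cases h2 : b = σ i
        · simp [h2, (hne i).symm]
        · simp [h1, h2]
    · simp [hij, Ne.symm hij]
  · have h1 : τ j ≠ σ i := fun h => ha (hadj i j h)
    have h2 : τ i ≠ σ j := fun h => ha ((hadj j i h).symm)
    rw [hE, hE, apply_ite (Q.E i), apply_ite (Q.E j)]
    simp [hE, h1, h2]
  · have h1 : σ j ≠ τ i := fun h => ha ((hadj j i h.symm).symm)
    have h2 : σ i ≠ τ j := fun h => ha (hadj i j h.symm)
    rw [hF, hF, apply_ite (Q.F i), apply_ite (Q.F j)]
    simp [hF, h1, h2]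
  · have hxx : ∀ b, Q.E i (Q.E i (e b)) = 0 := by
      intro b; rw [hE, apply_ite (Q.E i)]; simp [hE, hne]
    have hxyx : Q.E i (Q.E j (Q.E i (e b))) = 0 := by
      rw [hE, apply_ite (Q.E j), apply_ite (Q.E i)]
      by_cases h : τ i = σ j
      · simp [hE, h, hback i j h]
      · simp [hE, h]
    have hxxy : Q.E i (Q.E i (Q.E j (e b))) = 0 := by
      rw [hE, apply_ite (Q.E i), apply_ite (Q.E i)]
      simp [hxx]
    simp [SerreAt, hxx, hxyx, hxxy]
  · have hxx : ∀ b, Q.F i (Q.F i (e b)) = 0 := by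
      intro b; rw [hF, apply_ite (Q.F i)]; simp [hF, (hne i).symm]
    have hxyx : Q.F i (Q.F j (Q.F i (e b))) = 0 := by
      rw [hF, apply_ite (Q.F j), apply_ite (Q.F i)]
      by_cases h : σ i = τ j
      · have h' : σ j ≠ τ i := fun h' => hback i j h'.symm h.symm
        simp [hF, h, h']
      · simp [hF, h]
    have hxxy : Q.F i (Q.F i (Q.F j (e b))) = 0 := by
      rw [hF, apply_ite (Q.F i), apply_ite (Q.F i)]
      simp [hxx]
    simp [SerreAt, hxx, hxyx, hxxy]
  · rw [hE]
    split_ifs with h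
    · rw [h, ← hroot]; exact (hw _).smul x
    · exact QOps.Wt.zero _
  · rw [hF]
    split_ifs with h
    · have := (hw (σ i)).smul y
      rw [h, hroot, add_sub_cancel_right]; exact this
    · exact QOps.Wt.zero _

/-- The vector representation. -/
def vecOps (n : ℕ) : QOps n (Fin n → Scal) where
  H r := (rhoH r).mulVecLin
  E i := (rhoE i).mulVecLin
  F i := (rhoF i).mulVecLin
  K i := (rhoK i).mulVecLin
  Kinv i := (rhoKinv i).mulVecLin

/-- The dual of the vector representation, on the coordinates with respect to the dual basis:
the transposed matrices of the antipodes of the generators. -/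
def covecOps (n : ℕ) : QOps n (Fin n → Scal) where
  H r := (-rhoH r).transpose.mulVecLin
  E i := (-(rhoKinv i * rhoE i)).transpose.mulVecLin
  F i := (-(rhoF i * rhoK i)).transpose.mulVecLin
  K i := (rhoKinv i).transpose.mulVecLin
  Kinv i := (rhoK i).transpose.mulVecLin

theorem vecOps_good : (∀ b, (vecOps n).Good (Pi.single b 1) (Pi.single b 1)) ∧
    ∀ b, (vecOps n).IsShifted (Pi.single b 1) := by
  refine QOps.good_of_chain (σ := hi) (τ := lo) (x := 1) (y := 1)
    (fun b => ⟨fun r => ?_, fun i => ?_, fun i => ?_⟩) (one_mul 1) (Or.inr ⟨rfl, rfl⟩)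
    (fun i b => ?_) (fun i b => ?_) (fun i => ?_) (fun b i => ?_)
  · ext c
    simp [vecOps, rhoH, Matrix.single_apply, Pi.single_apply]
    grind
  · ext c : 1
    simp [vecOps, rhoK, pair, Pi.single_apply]
    have := lo_ne_hi i
    by_cases h : c = b
    · subst h; grind [qpow_zero]
    · simp [h]
  · ext c : 1
    simp [vecOps, rhoKinv, pair, Pi.single_apply]
    have := lo_ne_hi i
    by_cases h : c = b
    · subst h; grind [qpow_zero]
    · simp [h]
  · ext c : 1
    by_cases h : b = hi i <;> simp [vecOps, rhoE, Matrix.single_apply, Pi.single_apply, h, eq_comm]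
  · ext c : 1
    by_cases h : b = lo i <;> simp [vecOps, rhoF, Matrix.single_apply, Pi.single_apply, h, eq_comm]
  · ext c
    simp only [Pi.add_apply, Pi.single_apply, root]; ring
  · simp only [pair, Pi.single_apply, eq_comm]

theorem covecOps_good : (∀ b, (covecOps n).Good (-Pi.single b 1) (Pi.single b 1)) ∧
    ∀ b, (covecOps n).IsShifted (Pi.single b 1) := by
  refine QOps.good_of_chain (σ := lo) (τ := hi) (x := -qpow (-1)) (y := -qpow 1)
    (fun b => ⟨fun r => ?_, fun i => ?_, fun i => ?_⟩) (by
      rw [neg_mul_neg, mul_comm, qpow_one_mul_neg_one]) (Or.inl ⟨rfl, rfl⟩)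
    (fun i b => ?_) (fun i b => ?_) (fun i => ?_) (fun b i => ?_)
  · ext c : 1
    simp [covecOps, rhoH, Matrix.single_apply, Pi.single_apply]
    grind
  · ext c : 1
    simp [covecOps, rhoKinv, pair, Pi.single_apply]
    have := lo_ne_hi i
    by_cases h : c = b
    · subst h; grind [qpow_zero]
    · simp [h]
  · ext c : 1
    simp [covecOps, rhoK, pair, Pi.single_apply]
    have := lo_ne_hi i
    by_cases h : c = b
    · subst h; grind [qpow_zero]
    · simp [h]
  · ext c : 1
    change ((-(rhoKinv i * rhoE i)).transpose.mulVec (Pi.single b 1)) c = _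
    rw [Matrix.mulVec_single_one]
    simp only [Matrix.col_apply, Matrix.transpose_apply, Matrix.neg_apply, rhoKinv,
      Matrix.diagonal_mul, rhoE, Matrix.single_apply]
    by_cases h : b = lo i <;> by_cases h' : c = hi i <;> simp [h, h', eq_comm]
  · ext c : 1
    change ((-(rhoF i * rhoK i)).transpose.mulVec (Pi.single b 1)) c = _
    rw [Matrix.mulVec_single_one]
    simp only [Matrix.col_apply, Matrix.transpose_apply, Matrix.neg_apply, rhoK,
      Matrix.mul_diagonal, rhoF, Matrix.single_apply]
    by_cases h : b = hi i <;> by_cases h' : c = lo i <;> simp [h, h', eq_comm]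
  · ext c
    simp only [Pi.add_apply, Pi.neg_apply, Pi.single_apply, root]; ring
  · simp only [pair, Pi.neg_apply, Pi.single_apply, eq_comm]; ring

theorem graded_of_single {Q : QOps n (Fin n → Scal)} (h : ∀ b, Q.IsShifted (Pi.single b 1)) :
    Q.Graded :=
  QOps.Graded.of_dense fun T T' hT => LinearMap.pi_ext' fun b =>
    LinearMap.ext_ring (by simpa using hT _ (h b))

variable {A : Type} [AddCommGroup A] [Module Scal A]

/-- The linear combinations of the entries of a matrix, as a pairing of covectors and vectors. -/
def entryPairing (L : Matrix (Fin n) (Fin n) A) :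
    (Fin n → Scal) →ₗ[Scal] (Fin n → Scal) →ₗ[Scal] A :=
  LinearMap.mk₂ Scal (fun u v => ∑ a, ∑ b, (u a * v b) • L a b)
    (fun u u' v => by simp only [Pi.add_apply, add_mul, add_smul, Finset.sum_add_distrib])
    (fun c u v => by simp only [Pi.smul_apply, smul_eq_mul, mul_assoc, mul_smul, Finset.smul_sum])
    (fun u v v' => by simp only [Pi.add_apply, mul_add, add_smul, Finset.sum_add_distrib])
    (fun c u v => by
      simp only [Pi.smul_apply, smul_eq_mul, mul_left_comm, mul_smul, Finset.smul_sum,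
        smul_comm c])

theorem entryPairing_apply (L : Matrix (Fin n) (Fin n) A) (u v : Fin n → Scal) :
    entryPairing L u v = ∑ a, ∑ b, (u a * v b) • L a b := rfl

theorem entryPairing_single (L : Matrix (Fin n) (Fin n) A) (a b : Fin n) :
    entryPairing L (Pi.single a 1) (Pi.single b 1) = L a b := by
  rw [entryPairing_apply, Finset.sum_eq_single a, Finset.sum_eq_single b]
  · simp
  · intro c _ hc; simp [hc]
  · simp
  · intro c _ hc; simp [hc]
  · simp

theorem entryPairing_add (L L' : Matrix (Fin n) (Fin n) A) (u v : Fin n → Scal) :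
    entryPairing (L + L') u v = entryPairing L u v + entryPairing L' u v := by
  simp [entryPairing_apply, Finset.sum_add_distrib]

theorem map_entryPairing {A' : Type} [AddCommGroup A'] [Module Scal A']
    (L : Matrix (Fin n) (Fin n) A) (T : A →ₗ[Scal] A') (u v : Fin n → Scal) :
    T (entryPairing L u v) = entryPairing (L.map T) u v := by
  simp [entryPairing_apply]

theorem entryPairing_mul {A : Type} [Ring A] [Algebra Scal A] (L : Matrix (Fin n) (Fin n) A)
    (M N : Matrix (Fin n) (Fin n) Scal) (u v : Fin n → Scal) :
    entryPairing (toMat A M * L * toMat A N) u v =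
      entryPairing L (M.transpose.mulVec u) (N.mulVec v) := by
  have h1 : ∀ (L : Matrix (Fin n) (Fin n) A) (u v : Fin n → Scal),
      entryPairing (toMat A M * L) u v = entryPairing L (M.transpose.mulVec u) v := by
    intro L u v
    simp only [entryPairing_apply, Matrix.mul_apply, toMat, Matrix.map_apply, ← Algebra.smul_def,
      Matrix.mulVec, dotProduct, Matrix.transpose_apply, Finset.sum_mul, Finset.smul_sum,
      Finset.sum_smul, smul_smul]
    rw [Finset.sum_congr rfl fun a _ => Finset.sum_comm, Finset.sum_comm]
    refine Finset.sum_congr rfl fun c _ => ?_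
    rw [Finset.sum_comm]
    refine Finset.sum_congr rfl fun b _ => Finset.sum_congr rfl fun a _ => ?_
    congr 1; ring
  have h2 : ∀ (L : Matrix (Fin n) (Fin n) A) (u v : Fin n → Scal),
      entryPairing (L * toMat A N) u v = entryPairing L u (N.mulVec v) := by
    intro L u v
    simp only [entryPairing_apply, Matrix.mul_apply, toMat, Matrix.map_apply,
      ← Algebra.commutes, ← Algebra.smul_def,
      Matrix.mulVec, dotProduct, Finset.mul_sum, Finset.smul_sum,
      Finset.sum_smul, smul_smul]
    refine Finset.sum_congr rfl fun a _ => ?_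
    rw [Finset.sum_comm]
    refine Finset.sum_congr rfl fun b _ => Finset.sum_congr rfl fun c _ => ?_
    congr 1; ring
  rw [h2, h1]

/-- The coadjoint formula makes the span of the matrix entries a quotient of `V* ⊗ V`. -/
theorem QOps.IsCoadjoint.intertwines {A : Type} [Ring A] [Algebra Scal A] {Q : QOps n A}
    {L : Matrix (Fin n) (Fin n) A} (hQ : Q.IsCoadjoint L) :
    (covecOps n).Intertwines (vecOps n) Q (entryPairing L) := by
  have hl : ∀ M u v, entryPairing (toMat A M * L) u v =
      entryPairing L (M.transpose.mulVec u) v := by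
    intro M u v
    have := entryPairing_mul L M 1 u v
    rwa [toMat_eq 1, map_one, mul_one, Matrix.one_mulVec] at this
  have hr : ∀ N u v, entryPairing (L * toMat A N) u v = entryPairing L u (N.mulVec v) := by
    intro N u v
    have := entryPairing_mul L 1 N u v
    rwa [toMat_eq 1, map_one, one_mul, Matrix.transpose_one, Matrix.one_mulVec] at this
  have hn : ∀ M : Matrix (Fin n) (Fin n) Scal, -toMat A M = toMat A (-M) := by
    intro M; rw [toMat_eq, toMat_eq, map_neg]
  refine ⟨fun r a b => ?_, fun i a b => ?_, fun i a b => ?_, fun i a b => ?_, fun i a b => ?_⟩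
  · rw [map_entryPairing, hQ.on_H, entryPairing_add, hn, hl, hr]; rfl
  · rw [map_entryPairing, hQ.on_E, entryPairing_add, hn, hl, entryPairing_mul]; rfl
  · rw [map_entryPairing, hQ.on_F, entryPairing_add, hn, hr, entryPairing_mul]; rfl
  · rw [map_entryPairing, hQ.on_K, entryPairing_mul]; rfl
  · rw [map_entryPairing, hQ.on_Kinv, entryPairing_mul]; rfl

end VectorRepresentations

/-! ### The action of the quantum group -/

section Action

variable {n : ℕ} {s : Set (CFree (Fin n × Fin n))} {Q : QOps n (Presented s)}

theorem QOps.IsCoadjoint.isShifted_gen (hQ : Q.IsCoadjoint (genMatrix s)) (x : Fin n × Fin n) :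
    Q.IsShifted (mkP s (gen x)) := by
  have := (covecOps_good.2 x.1).map₂ hQ.intertwines (vecOps_good.2 x.2)
  rwa [entryPairing_single] at this

theorem QOps.IsCoadjoint.good_gen (hQ : Q.IsCoadjoint (genMatrix s)) (x : Fin n × Fin n) :
    ∃ w, Q.Good w (mkP s (gen x)) := by
  have := QOps.Good.map₂ hQ.intertwines (graded_of_single covecOps_good.2)
    (graded_of_single vecOps_good.2) (covecOps_good.1 x.1) (vecOps_good.1 x.2)
  rw [entryPairing_single] at this
  exact ⟨_, this⟩

theorem QOps.IsCoadjoint.wt_one (hQ : Q.IsCoadjoint (genMatrix s)) : Q.Wt 0 1 :=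
  ⟨by simp [hQ.one_H], by simp [hQ.one_K], by simp [hQ.one_Kinv]⟩

theorem QOps.IsCoadjoint.graded (hQ : Q.IsCoadjoint (genMatrix s)) : Q.Graded := by
  refine QOps.Graded.of_dense fun T T' hT => presented_linearMap_ext Q.IsShifted
    ⟨0, hQ.wt_one, ?_, ?_⟩ (fun x b hb => (hQ.isShifted_gen x).map₂ hQ.mul hb) hT
  · intro i; rw [hQ.one_E]; exact QOps.Wt.zero _
  · intro i; rw [hQ.one_F]; exact QOps.Wt.zero _

/-- Two linear maps on a reflection equation algebra agree once they agree on the weight vectors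
at which the relations of `U_h(gl(n))` hold. -/
theorem QOps.IsCoadjoint.linearMap_ext (hQ : Q.IsCoadjoint (genMatrix s)) {M : Type}
    [AddCommGroup M] [Module Scal M] [HComplete M] {T T' : Presented s →ₗ[Scal] M}
    (h : ∀ w m, Q.Good w m → T m = T' m) : T = T' := by
  refine presented_linearMap_ext (fun m => ∃ w, Q.Good w m) ⟨0, hQ.wt_one, ?_, ?_, ?_, ?_, ?_⟩
    (fun x b hb => ?_) fun b ⟨w, hw⟩ => h w b hw
  · intro i j; simp [hQ.one_E, hQ.one_F]
  · intro i j; simp [hQ.one_E]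
  · intro i j; simp [hQ.one_F]
  · intro i j; simp [SerreAt, hQ.one_E]
  · intro i j; simp [SerreAt, hQ.one_F]
  · obtain ⟨w, hw⟩ := hQ.good_gen x
    obtain ⟨v, hv⟩ := hb
    exact ⟨_, hw.map₂ hQ.mul hQ.graded hQ.graded hv⟩

end Action

section Action

variable {n : ℕ}

theorem coeff_expH {R : Type} [Ring R] [Algebra ℂ R] (x : R) (k : ℕ) :
    PowerSeries.coeff k (expH x) = ((Nat.factorial k : ℂ)⁻¹) • x ^ k := by
  simp [expH]

/-- If `x` acts on `m` by the number `c`, then `e^{hx}` acts by `e^{hc}`. -/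
theorem map_expH_of_eigenvector {Y M : Type} [AddCommGroup M] [Module Scal M] [HComplete M]
    {T : CFree Y →ₗ[Scal] M} {x : FreeAlgebra ℂ Y} {c : ℂ} {m : M}
    (h : ∀ k, T (PowerSeries.C (x ^ k)) = (PowerSeries.C (c ^ k) : Scal) • m) :
    T (expH x) = (expH c : Scal) • m := by
  refine cfree_map_eq_smul fun k => ?_
  rw [coeff_expH, coeff_expH, ← cfree_C_smul, map_smul, h, smul_smul, ← map_mul, smul_eq_mul]

theorem map_divH_expH_of_eigenvector {Y M : Type} [AddCommGroup M] [Module Scal M] [HComplete M]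
    {T : CFree Y →ₗ[Scal] M} {x : FreeAlgebra ℂ Y} {c : ℂ} {m : M}
    (h : ∀ k, T (PowerSeries.C (x ^ k)) = (PowerSeries.C (c ^ k) : Scal) • m) :
    T (divH (expH x - expH (-x))) = (divH (expH c - expH (-c)) : Scal) • m := by
  refine cfree_map_eq_smul fun k => ?_
  have e : ∀ {R : Type} [Ring R] [Algebra ℂ R] (x : R),
      PowerSeries.coeff k (divH (expH x - expH (-x))) =
        ((Nat.factorial (k + 1) : ℂ)⁻¹ * (1 - (-1) ^ (k + 1))) • x ^ (k + 1) := by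
    intro R _ _ x
    rw [divH, PowerSeries.coeff_mk, map_sub, coeff_expH, coeff_expH, neg_pow, ← smul_sub, mul_smul,
      sub_smul, one_smul]
    rcases Nat.even_or_odd (k + 1) with hk | hk
    · simp [hk.neg_one_pow]
    · simp [hk.neg_one_pow]
  rw [e, e, ← cfree_C_smul, map_smul, h, smul_smul, ← map_mul, smul_eq_mul]

/-- The operators as images of the generators. -/
def QOps.toFun {M : Type} [AddCommGroup M] [Module Scal M] (Q : QOps n M) :
    UhGen n → Module.End Scal M
  | .H a => Q.H a
  | .E i => Q.E i
  | .F i => Q.F i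

section

variable {M : Type} [AddCommGroup M] [Module Scal M] [HComplete M] {Q : QOps n M}
  {w : Fin n → ℤ} {m : M}

theorem QOps.Wt.eval_coroot_pow (h : Q.Wt w m) (i : Fin (n - 1)) (k : ℕ) :
    eval Q.toFun (PowerSeries.C (coroot i ^ k)) m =
      (PowerSeries.C (((pair w i : ℤ) : ℂ) ^ k) : Scal) • m := by
  have h1 : (freeLift Q.toFun (coroot i)) m = ((pair w i : ℤ) : Scal) • m := by
    rw [coroot, map_sub, freeLift_ι, freeLift_ι, LinearMap.sub_apply]
    simp [QOps.toFun, h.H, pair, sub_smul]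
  rw [eval_C, map_pow]
  induction k with
  | zero => simp
  | succ k ih =>
    rw [pow_succ, Module.End.mul_apply, h1, map_smul, ih, smul_smul]
    simp [pow_succ, mul_comm]

/-- `K i` acts on weight vectors as required by `K i = q^{H_i - H_{i+1}}`. -/
theorem QOps.Wt.eval_expH (h : Q.Wt w m) (i : Fin (n - 1)) :
    eval Q.toFun (expH (coroot i)) m = qpow (pair w i) • m :=
  map_expH_of_eigenvector (T := (LinearMap.applyₗ m) ∘ₗ (eval Q.toFun).toLinearMap)
    fun k => h.eval_coroot_pow i k

theorem QOps.Wt.eval_expH_neg (h : Q.Wt w m) (i : Fin (n - 1)) :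
    eval Q.toFun (expH (-coroot i)) m = qpow (-pair w i) • m := by
  have := map_expH_of_eigenvector (T := (LinearMap.applyₗ m) ∘ₗ (eval Q.toFun).toLinearMap)
    (x := -coroot i) (c := -((pair w i : ℤ) : ℂ)) (m := m) fun k => by
      rw [LinearMap.comp_apply, AlgHom.toLinearMap_apply, LinearMap.applyₗ_apply_apply]
      have := h.eval_coroot_pow i k
      rcases Nat.even_or_odd k with hk | hk
      · rw [hk.neg_pow, hk.neg_pow, this]
      · rw [hk.neg_pow, hk.neg_pow, map_neg, map_neg, LinearMap.neg_apply, this, map_neg, neg_smul]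
  rw [qpow, Int.cast_neg]
  exact this

theorem QOps.Wt.eval_qSinh (h : Q.Wt w m) (i : Fin (n - 1)) :
    eval Q.toFun (qSinh (coroot i)) m = qnum (pair w i) • m := by
  rw [qSinh, map_smul, LinearMap.smul_apply, qnum, mul_smul]
  congr 1
  exact map_divH_expH_of_eigenvector
    (T := (LinearMap.applyₗ m) ∘ₗ (eval Q.toFun).toLinearMap) fun k => h.eval_coroot_pow i k

end

variable {s : Set (CFree (Fin n × Fin n))} {Q : QOps n (Presented s)}

/-- The coadjoint operators satisfy the Drinfeld-Jimbo relations. -/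
theorem QOps.IsCoadjoint.eval_rel (hQ : Q.IsCoadjoint (genMatrix s)) {r : CFree (UhGen n)}
    (hr : UhRel n r) : eval Q.toFun r = 0 := by
  refine hQ.linearMap_ext fun w m hm => ?_
  rw [LinearMap.zero_apply]
  have hE := hQ.graded.E
  have hF := hQ.graded.F
  cases hr with
  | HH a b =>
    simp [QOps.toFun, hm.wt.H, smul_smul, mul_comm]
  | HE a i =>
    simp [QOps.toFun, hm.wt.H, (hE i w m hm.wt).H, rootVal_eq, add_smul]
  | HF a i =>
    simp [QOps.toFun, hm.wt.H, (hF i w m hm.wt).H, rootVal_eq, sub_smul]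
  | EF i =>
    have := hm.EF i i
    rw [if_pos rfl] at this
    simp [QOps.toFun, hm.wt.eval_qSinh, this]
  | EF_ne i j hij =>
    have := hm.EF i j
    rw [if_neg hij] at this
    simp [QOps.toFun, this]
  | EE i j hij h => simp [QOps.toFun, hm.EE i j hij h]
  | FF i j hij h => simp [QOps.toFun, hm.FF i j hij h]
  | serreE i j h =>
    simpa [QOps.toFun, serre, SerreAt] using hm.serreE i j h
  | serreF i j h =>
    simpa [QOps.toFun, serre, SerreAt] using hm.serreF i j h

/-- A presented algebra with gauge invariant relations is a module algebra over `U_h(gl(n))` by the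
coadjoint action on its generating matrix. -/
theorem exists_action (hs : GaugeInvariant s) :
    ∃ act : Uh n →ₐ[Scal] Module.End Scal (Presented s),
      IsModuleAlgebra act ∧ IsCoadjointOn act (genMatrix s) ∧
      (∀ i, (genMatrix s).map (act (Uh.K i)) =
        toMat _ (rhoKinv i) * genMatrix s * toMat _ (rhoK i)) ∧
      ∀ i, (genMatrix s).map (act (Uh.Kinv i)) =
        toMat _ (rhoK i) * genMatrix s * toMat _ (rhoKinv i) := by
  obtain ⟨Q, hQ⟩ := exists_coadjointOps hs
  let act : Uh n →ₐ[Scal] Module.End Scal (Presented s) :=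
    liftP (eval Q.toFun) fun _ hr => hQ.eval_rel hr
  have hH : ∀ a, act (Uh.H a) = Q.H a := fun a =>
    (liftP_mkP _ _ _).trans (eval_gen Q.toFun (.H a))
  have hE : ∀ i, act (Uh.E i) = Q.E i := fun i =>
    (liftP_mkP _ _ _).trans (eval_gen Q.toFun (.E i))
  have hF : ∀ i, act (Uh.F i) = Q.F i := fun i =>
    (liftP_mkP _ _ _).trans (eval_gen Q.toFun (.F i))
  have hK : ∀ i, act (Uh.K i) = Q.K i := fun i => hQ.linearMap_ext fun w m hm =>
    (hm.wt.eval_expH i).trans (hm.wt.K i).symm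
  have hKinv : ∀ i, act (Uh.Kinv i) = Q.Kinv i := fun i => hQ.linearMap_ext fun w m hm =>
    (hm.wt.eval_expH_neg i).trans (hm.wt.Kinv i).symm
  refine ⟨act, ⟨?_, ?_, ?_, ?_, ?_, ?_⟩, ⟨?_, ?_, ?_⟩, ?_, ?_⟩
  · intro r a b; rw [hH]; exact hQ.mul.H r a b
  · intro i a b; rw [hE, hK]; exact hQ.mul.E i a b
  · intro i a b; rw [hF, hKinv]; exact hQ.mul.F i a b
  · intro r; rw [hH]; exact hQ.one_H r
  · intro i; rw [hE]; exact hQ.one_E i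
  · intro i; rw [hF]; exact hQ.one_F i
  · intro r; rw [hH]; exact hQ.on_H r
  · intro i; rw [hE]; exact hQ.on_E i
  · intro i; rw [hF]; exact hQ.on_F i
  · intro i; rw [hK]; exact hQ.on_K i
  · intro i; rw [hKinv]; exact hQ.on_Kinv i

/-! ### Equivariant linear maps -/

section Equivariance

variable {A A' : Type} [Ring A] [Algebra Scal A] [Ring A'] [Algebra Scal A']
  {act : Uh n →ₐ[Scal] Module.End Scal A} {act' : Uh n →ₐ[Scal] Module.End Scal A'} {f : A →ₗ[Scal] A'}

/-- The elements `x` with `f (x ▷ a) = x ▷ f a` for all `a`, as the agreement set of two linear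
maps. -/
theorem equivariant_iff (x : Uh n) :
    (∀ a, f (act x a) = act' x (f a)) ↔ (f ∘ₗ act x : A →ₗ[Scal] A') = (act' x) ∘ₗ f :=
  ⟨fun h => LinearMap.ext h, fun h a => LinearMap.congr_fun h a⟩

/-- A map commuting with `x` commutes with `e^{h x}`. -/
theorem equivariant_expH [HComplete A'] {x : FreeAlgebra ℂ (UhGen n)}
    (hx : ∀ a, f (act (mkP _ (PowerSeries.C x)) a) = act' (mkP _ (PowerSeries.C x)) (f a))
    (a : A) : f (act (mkP _ (expH x)) a) = act' (mkP _ (expH x)) (f a) := by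
  refine cfree_map_eq
    (T := f ∘ₗ (LinearMap.applyₗ a) ∘ₗ act.toLinearMap ∘ₗ (mkP _).toLinearMap)
    (T' := (LinearMap.applyₗ (f a)) ∘ₗ act'.toLinearMap ∘ₗ (mkP _).toLinearMap) fun k => ?_
  simp only [LinearMap.comp_apply, AlgHom.toLinearMap_apply, LinearMap.applyₗ_apply_apply]
  rw [coeff_expH, ← cfree_C_smul, map_smul, map_smul, map_smul, LinearMap.smul_apply,
    LinearMap.smul_apply, map_smul]
  congr 1
  induction k generalizing a with
  | zero => simp
  | succ k ih =>
    simp only [pow_succ, map_mul, Module.End.mul_apply] at ih ⊢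
    rw [ih, hx]

theorem equivariant_coroot (hH : ∀ r a, f (act (Uh.H r) a) = act' (Uh.H r) (f a))
    (i : Fin (n - 1)) (a : A) :
    f (act (mkP _ (PowerSeries.C (coroot i))) a) = act' (mkP _ (PowerSeries.C (coroot i))) (f a) := by
  rw [coroot, map_sub, map_sub, map_sub, map_sub, LinearMap.sub_apply, LinearMap.sub_apply, map_sub]
  exact congrArg₂ _ (hH _ _) (hH _ _)

theorem equivariant_K [HComplete A']
    (hH : ∀ r a, f (act (Uh.H r) a) = act' (Uh.H r) (f a))
    (i : Fin (n - 1)) (a : A) : f (act (Uh.K i) a) = act' (Uh.K i) (f a) :=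
  equivariant_expH (equivariant_coroot hH i) a

theorem equivariant_Kinv [HComplete A']
    (hH : ∀ r a, f (act (Uh.H r) a) = act' (Uh.H r) (f a))
    (i : Fin (n - 1)) (a : A) : f (act (Uh.Kinv i) a) = act' (Uh.Kinv i) (f a) := by
  refine equivariant_expH (fun a => ?_) a
  rw [map_neg, map_neg, map_neg, map_neg, LinearMap.neg_apply, LinearMap.neg_apply, map_neg,
    equivariant_coroot hH]

/-- A map commuting with the generators of `U_h(gl(n))` is equivariant. -/
theorem equivariant_of_generators [HComplete A']
    (hH : ∀ r a, f (act (Uh.H r) a) = act' (Uh.H r) (f a))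
    (hE : ∀ i a, f (act (Uh.E i) a) = act' (Uh.E i) (f a))
    (hF : ∀ i a, f (act (Uh.F i) a) = act' (Uh.F i) (f a)) (x : Uh n) (a : A) :
    f (act x a) = act' x (f a) := by
  have : (LinearMap.llcomp Scal A A A' f) ∘ₗ act.toLinearMap =
      (LinearMap.lcomp Scal A' f) ∘ₗ act'.toLinearMap := by
    refine presented_linearMap_ext' ?_ fun g b hb => ?_
    · ext a; simp
    · ext a
      have hb' : ∀ a, f (act b a) = act' b (f a) := fun a => LinearMap.congr_fun hb a
      have hg : ∀ a, f (act (mkP _ (gen g)) a) = act' (mkP _ (gen g)) (f a) := by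
        cases g with
        | H r => exact hH r
        | E i => exact hE i
        | F i => exact hF i
      change f (act (mkP _ (gen g) * b) a) = act' (mkP _ (gen g) * b) (f a)
      rw [map_mul, map_mul, Module.End.mul_apply, Module.End.mul_apply, hg, hb']
  exact LinearMap.congr_fun (LinearMap.congr_fun this x) a

end Equivariance

/-- A morphism of module algebras is equivariant if it commutes with the action of the generators
of the quantum group on the generators of the algebra. -/
theorem algHom_equivariant {Y : Type} {s : Set (CFree Y)} {A' : Type} [Ring A'] [Algebra Scal A']
    [HComplete A'] {act : Uh n →ₐ[Scal] Module.End Scal (Presented s)}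
    {act' : Uh n →ₐ[Scal] Module.End Scal A'} (ha : IsModuleAlgebra act)
    (ha' : IsModuleAlgebra act') (f : Presented s →ₐ[Scal] A')
    (hH : ∀ r y, f (act (Uh.H r) (mkP s (gen y))) = act' (Uh.H r) (f (mkP s (gen y))))
    (hE : ∀ i y, f (act (Uh.E i) (mkP s (gen y))) = act' (Uh.E i) (f (mkP s (gen y))))
    (hF : ∀ i y, f (act (Uh.F i) (mkP s (gen y))) = act' (Uh.F i) (f (mkP s (gen y))))
    (x : Uh n) (a : Presented s) : f (act x a) = act' x (f a) := by
  have HH : ∀ r a, f (act (Uh.H r) a) = act' (Uh.H r) (f a) := by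
    intro r
    refine (equivariant_iff (f := f.toLinearMap) _).mpr (presented_linearMap_ext' ?_ fun y b hb => ?_)
    · simp [ha.one_H, ha'.one_H]
    · simp only [LinearMap.comp_apply, AlgHom.toLinearMap_apply] at hb ⊢
      rw [ha.mul_H, map_add, map_mul, map_mul, map_mul, ha'.mul_H, hb, hH]
  have HK := equivariant_K (f := f.toLinearMap) HH
  have HKinv := equivariant_Kinv (f := f.toLinearMap) HH
  simp only [AlgHom.toLinearMap_apply] at HK HKinv
  refine equivariant_of_generators (f := f.toLinearMap) HH (fun i => ?_) (fun i => ?_) x a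
  · refine (equivariant_iff (f := f.toLinearMap) _).mpr (presented_linearMap_ext' ?_ fun y b hb => ?_)
    · simp [ha.one_E, ha'.one_E]
    · simp only [LinearMap.comp_apply, AlgHom.toLinearMap_apply] at hb ⊢
      rw [ha.mul_E, map_add, map_mul, map_mul, map_mul, ha'.mul_E, hb, hE, HK]
  · refine (equivariant_iff (f := f.toLinearMap) _).mpr (presented_linearMap_ext' ?_ fun y b hb => ?_)
    · simp [ha.one_F, ha'.one_F]
    · simp only [LinearMap.comp_apply, AlgHom.toLinearMap_apply] at hb ⊢
      rw [ha.mul_F, map_add, map_mul, map_mul, map_mul, ha'.mul_F, hb, hF, HKinv]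

/-- The module algebra structure extending the coadjoint action is unique: the identity is
equivariant for any two of them. -/
theorem action_unique {s : Set (CFree (Fin n × Fin n))}
    {act act' : Uh n →ₐ[Scal] Module.End Scal (Presented s)} (ha : IsModuleAlgebra act)
    (hc : IsCoadjointOn act (genMatrix s)) (ha' : IsModuleAlgebra act')
    (hc' : IsCoadjointOn act' (genMatrix s)) : act = act' := by
  have h : ∀ {x}, (genMatrix s).map (act x) = (genMatrix s).map (act' x) →
      ∀ y, act x (mkP s (gen y)) = act' x (mkP s (gen y)) :=
    fun h y => congrFun (congrFun h y.1) y.2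
  ext x a
  exact algHom_equivariant ha ha' (AlgHom.id Scal (Presented s))
    (fun r => h ((hc.on_H r).trans (hc'.on_H r).symm))
    (fun i => h ((hc.on_E i).trans (hc'.on_E i).symm))
    (fun i => h ((hc.on_F i).trans (hc'.on_F i).symm)) x a

end Action

/-! ### Matrices transforming by the coadjoint action -/

section CoadjointMatrices

variable {n : ℕ} {A A' : Type} [Ring A] [Algebra Scal A] [Ring A'] [Algebra Scal A']

/-- The product of matrices transforming by the coadjoint action transforms in the same way. The
formulas for `K i` and `Kinv i` are used as hypotheses, as they are not part of `IsCoadjointOn`. -/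
theorem IsCoadjointOn.mul {act : Uh n →ₐ[Scal] Module.End Scal A} (ha : IsModuleAlgebra act)
    {L L' : Matrix (Fin n) (Fin n) A} (h : IsCoadjointOn act L) (h' : IsCoadjointOn act L')
    (hK : ∀ i, L.map (act (Uh.K i)) = toMat A (rhoKinv i) * L * toMat A (rhoK i))
    (hKinv : ∀ i, L'.map (act (Uh.Kinv i)) = toMat A (rhoK i) * L' * toMat A (rhoKinv i)) :
    IsCoadjointOn act (L * L') where
  on_H r := by
    have : (L * L').map (act (Uh.H r)) = L.map (act (Uh.H r)) * L' + L * L'.map (act (Uh.H r)) := by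
      ext a b
      simp [Matrix.mul_apply, ha.mul_H, Finset.sum_add_distrib]
    rw [this, h.on_H, h'.on_H]
    noncomm_ring
  on_E i := by
    have : (L * L').map (act (Uh.E i)) =
        L.map (act (Uh.E i)) * L' + L.map (act (Uh.K i)) * L'.map (act (Uh.E i)) := by
      ext a b
      simp [Matrix.mul_apply, ha.mul_E, Finset.sum_add_distrib]
    have hk : toMat A (rhoK i) * toMat A (rhoKinv i) = 1 := by
      rw [toMat_eq, toMat_eq, ← map_mul, (isGauge_rhoK i).mul_inv, map_one]
    rw [this, h.on_E, h'.on_E, hK]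
    simp only [toMat_eq, map_mul] at hk ⊢
    generalize toMatHom A (Fin n) (rhoK i) = k at *
    generalize toMatHom A (Fin n) (rhoKinv i) = k' at *
    generalize toMatHom A (Fin n) (rhoE i) = e at *
    have e1 : k' * L * k * (-(k' * e) * L' + k' * L' * e) =
      k' * L * (k * k') * (-e * L' + L' * e) := by noncomm_ring
    rw [e1, hk]
    noncomm_ring
  on_F i := by
    have : (L * L').map (act (Uh.F i)) =
        L.map (act (Uh.F i)) * L'.map (act (Uh.Kinv i)) + L * L'.map (act (Uh.F i)) := by
      ext a b
      simp [Matrix.mul_apply, ha.mul_F, Finset.sum_add_distrib]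
    have hk : toMat A (rhoKinv i) * toMat A (rhoK i) = 1 := by
      rw [toMat_eq, toMat_eq, ← map_mul, (isGauge_rhoK i).inv_mul, map_one]
    rw [this, h.on_F, h'.on_F, hKinv]
    simp only [toMat_eq, map_mul] at hk ⊢
    generalize toMatHom A (Fin n) (rhoK i) = k at *
    generalize toMatHom A (Fin n) (rhoKinv i) = k' at *
    generalize toMatHom A (Fin n) (rhoF i) = f at *
    have e1 : (-(f * k) * L * k' + L * f) * (k * L' * k') =
      -(f * k) * L * (k' * k) * L' * k' + L * f * k * L' * k' := by noncomm_ring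
    rw [e1, hk]
    noncomm_ring

theorem IsCoadjointOn.sub_smul {act : Uh n →ₐ[Scal] Module.End Scal A}
    {L L' : Matrix (Fin n) (Fin n) A} (h : IsCoadjointOn act L) (h' : IsCoadjointOn act L')
    (c : Scal) : IsCoadjointOn act (L - c • L') := by
  have e : ∀ T : Module.End Scal A, (L - c • L').map T = L.map T - c • L'.map T := by
    intro T; ext; simp
  refine ⟨fun r => ?_, fun i => ?_, fun i => ?_⟩
  · rw [e, h.on_H, h'.on_H]
    simp only [mul_sub, sub_mul, mul_smul_comm, smul_mul_assoc, smul_add]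
    abel
  · rw [e, h.on_E, h'.on_E]
    simp only [mul_sub, sub_mul, mul_smul_comm, smul_mul_assoc, smul_add]
    abel
  · rw [e, h.on_F, h'.on_F]
    simp only [mul_sub, sub_mul, mul_smul_comm, smul_mul_assoc, smul_add]
    abel

/-- A morphism of module algebras that sends the generating matrix to a matrix transforming by
the coadjoint action is equivariant. -/
theorem equivariant_of_coadjoint {s : Set (CFree (Fin n × Fin n))} [HComplete A']
    {act : Uh n →ₐ[Scal] Module.End Scal (Presented s)}
    {act' : Uh n →ₐ[Scal] Module.End Scal A'} (ha : IsModuleAlgebra act)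
    (ha' : IsModuleAlgebra act') (hc : IsCoadjointOn act (genMatrix s))
    (f : Presented s →ₐ[Scal] A') (hc' : IsCoadjointOn act' ((genMatrix s).map f)) (x : Uh n)
    (a : Presented s) : f (act x a) = act' x (f a) := by
  have h : ∀ {x}, ((genMatrix s).map (act x)).map f = ((genMatrix s).map f).map (act' x) →
      ∀ y, f (act x (mkP s (gen y))) = act' x (f (mkP s (gen y))) :=
    fun h y => congrFun (congrFun h y.1) y.2
  have hadd : ∀ M N : Matrix (Fin n) (Fin n) (Presented s), (M + N).map f = M.map f + N.map f :=
    fun M N => Matrix.map_add _ (map_add f) M N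
  have hneg : ∀ M : Matrix (Fin n) (Fin n) (Presented s), (-M).map f = -M.map f :=
    fun M => by ext; simp
  refine algHom_equivariant ha ha' f (fun r => h ?_) (fun i => h ?_) (fun i => h ?_) x a
  · rw [hc.on_H, hc'.on_H]
    simp only [hadd, Matrix.map_mul, toMat_map, hneg]
  · rw [hc.on_E, hc'.on_E]
    simp only [hadd, Matrix.map_mul, toMat_map, hneg]
  · rw [hc.on_F, hc'.on_F]
    simp only [hadd, Matrix.map_mul, toMat_map, hneg]

end CoadjointMatrices

/-! ### The quantized orbits -/

section Orbits

theorem commute_mul_entries {n : ℕ} {A : Type} [Ring A] {Gi L : Matrix (Fin n) (Fin n) A}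
    (h : ∀ a b c d, Commute (Gi a b) (L c d)) (a b c d : Fin n) :
    Commute (Gi a b) ((L * L) c d) := by
  rw [Matrix.mul_apply]
  exact Commute.sum_right _ _ _ fun e _ => (h a b c e).mul_right (h a b e d)

variable {n : ℕ} {A : Type} [Ring A] [Algebra Scal A]

theorem matrix_map_eq_zero_iff {B : Type} [Ring B] [Algebra Scal B] {ι : Type}
    (M : Matrix ι ι A) (θ : A →ₐ[Scal] B) : (∀ i j, θ (M i j) = 0) ↔ M.map θ = 0 :=
  ⟨fun h => Matrix.ext h, fun h i j => congrFun (congrFun h i) j⟩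

theorem symRel_iff (r s : ℕ) (a b : ℂ) (θ : CFree (Fin n × Fin n) →ₐ[Scal] A) :
    (∀ x ∈ {x | SymRel n r s a b x}, θ x = 0) ↔
      reflectionDefect ((freeGenMatrix n).map θ) = 0 ∧
      ((freeGenMatrix n).map θ - cMat n A a) * ((freeGenMatrix n).map θ - cMat n A b) = 0 ∧
      qTrace ((freeGenMatrix n).map θ) =
        algebraMap Scal A (PowerSeries.C a * qInt r + PowerSeries.C b * qInt s) := by
  have hsub : ∀ M N : Matrix (Fin n) (Fin n) (CFree (Fin n × Fin n)),
      (M - N).map θ = M.map θ - N.map θ := fun M N => Matrix.map_sub _ (map_sub θ) M N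
  rw [← reflectionDefect_map, ← matrix_map_eq_zero_iff, ← cMat_map _ θ, ← cMat_map _ θ, ← hsub,
    ← hsub, ← Matrix.map_mul, ← matrix_map_eq_zero_iff, ← qTrace_map, ← sub_eq_zero (a := θ _),
    ← θ.commutes, ← map_sub]
  refine ⟨fun h => ⟨fun i j => h _ (.reflection i j), fun i j => h _ (.poly i j), h _ .trace⟩, ?_⟩
  rintro ⟨h1, h2, h3⟩ x hx
  cases hx with
  | reflection i j => exact h1 i j
  | poly i j => exact h2 i j
  | trace => exact h3

theorem bisymRel_iff (r s : ℕ) (a b : ℂ) (θ : CFree (Fin n × Fin n) →ₐ[Scal] A) :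
    (∀ x ∈ {x | BisymRel n r s a b x}, θ x = 0) ↔
      reflectionDefect ((freeGenMatrix n).map θ) = 0 ∧
      (freeGenMatrix n).map θ * ((freeGenMatrix n).map θ - cMat n A a) *
        ((freeGenMatrix n).map θ - cMat n A b) = 0 ∧
      qTrace ((freeGenMatrix n).map θ) =
        algebraMap Scal A (PowerSeries.C a * qInt r + PowerSeries.C b * qInt s) ∧
      qTrace ((freeGenMatrix n).map θ * (freeGenMatrix n).map θ) =
        algebraMap Scal A
          (PowerSeries.C (a + b) * (PowerSeries.C a * qInt r + PowerSeries.C b * qInt s)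
            - PowerSeries.C (a * b) * qInt (r + s)) := by
  have hsub : ∀ M N : Matrix (Fin n) (Fin n) (CFree (Fin n × Fin n)),
      (M - N).map θ = M.map θ - N.map θ := fun M N => Matrix.map_sub _ (map_sub θ) M N
  rw [← reflectionDefect_map, ← matrix_map_eq_zero_iff, ← cMat_map _ θ, ← cMat_map _ θ, ← hsub,
    ← hsub, ← Matrix.map_mul, ← Matrix.map_mul, ← matrix_map_eq_zero_iff, ← qTrace_map,
    ← sub_eq_zero (a := θ _), ← θ.commutes, ← map_sub, ← Matrix.map_mul, ← qTrace_map,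
    ← sub_eq_zero (a := θ (qTrace (_ * _))), ← θ.commutes, ← map_sub]
  refine ⟨fun h => ⟨fun i j => h _ (.reflection i j), fun i j => h _ (.poly i j), h _ .trace,
    h _ .trace_sq⟩, ?_⟩
  rintro ⟨h1, h2, h3, h4⟩ x hx
  cases hx with
  | reflection i j => exact h1 i j
  | poly i j => exact h2 i j
  | trace => exact h3
  | trace_sq => exact h4

theorem IsGauge.conj_mul {G Gi : Matrix (Fin n) (Fin n) A} (h : IsGauge G Gi)
    (M N : Matrix (Fin n) (Fin n) A) : (Gi * M * G) * (Gi * N * G) = Gi * (M * N) * G := by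
  calc (Gi * M * G) * (Gi * N * G) = Gi * M * (G * Gi) * N * G := by simp only [mul_assoc]
    _ = _ := by rw [h.mul_inv, mul_one]; simp only [mul_assoc]

theorem IsGauge.conj_sub_cMat {G Gi : Matrix (Fin n) (Fin n) A} (h : IsGauge G Gi)
    (M : Matrix (Fin n) (Fin n) A) (c : ℂ) :
    Gi * M * G - cMat n A c = Gi * (M - cMat n A c) * G := by
  rw [cMat_eq, mul_sub, sub_mul, mul_smul_comm, mul_one, smul_mul_assoc, h.inv_mul]

theorem gaugeInvariant_symRel (r s : ℕ) (a b : ℂ) :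
    GaugeInvariant {x | SymRel n r s a b x} := by
  intro B _ _ θ θ' G Gi h hG hGi e hθ
  rw [symRel_iff] at hθ ⊢
  obtain ⟨h1, h2, h3⟩ := hθ
  rw [e]
  refine ⟨h.reflectionDefect_conj hG h1, ?_, by rw [h.qTrace_conj hGi, h3]⟩
  rw [h.conj_sub_cMat, h.conj_sub_cMat, h.conj_mul, h2]
  simp

theorem gaugeInvariant_bisymRel (r s : ℕ) (a b : ℂ) :
    GaugeInvariant {x | BisymRel n r s a b x} := by
  intro B _ _ θ θ' G Gi h hG hGi e hθ
  rw [bisymRel_iff] at hθ ⊢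
  obtain ⟨h1, h2, h3, h4⟩ := hθ
  rw [e]
  refine ⟨h.reflectionDefect_conj hG h1, ?_, by rw [h.qTrace_conj hGi, h3], ?_⟩
  · rw [h.conj_sub_cMat, h.conj_sub_cMat, h.conj_mul, h.conj_mul, h2]
    simp
  · rw [h.conj_mul, h.qTrace_conj (commute_mul_entries hGi), h4]

/-- If `b` solves the reflection equation with a Hecke matrix `S`, then so does `β = b² - z b`,
provided that `β b` is a multiple of `b`. -/
theorem reflection_of_quadratic {R : Type} [Ring R] [Algebra Scal R] {S b β : R} {ω z w : Scal}
    (hS : S * S = ω • S + 1) (hre : S * b * S * b = b * S * b * S) (hβ : β = b * b - z • b)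
    (hβb : β * b = w • b) : S * β * S * β = β * S * β * S := by
  have hb : Commute b (S * b * S) := by
    simp only [Commute, SemiconjBy, ← mul_assoc]; exact hre.symm
  have hc : Commute β (S * b * S) := by
    rw [hβ]; exact (hb.mul_left hb).sub_left (hb.smul_left z)
  have hbβ : b * β = w • b := by
    rw [← hβb, hβ]; simp [mul_sub, sub_mul, mul_assoc]
  have e : S * β * S = S * b * S * (S * b * S) - ω • (S * b * S * b * S) - z • (S * b * S) := by
    have : S * b * S * (S * b * S) = S * b * (S * S) * b * S := by simp only [mul_assoc]
    rw [this, hS, hβ]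
    simp only [mul_add, add_mul, mul_sub, sub_mul, mul_smul_comm, smul_mul_assoc, mul_one,
      mul_assoc]
    abel
  -- `S b S` commutes with `β`, and `S b S b S` does since `β` acts on `b S b S = S b S b` by `w`.
  have hd : Commute β (S * b * S * b * S) := by
    have h1 : β * (S * b * S * b * S) = w • (b * S * b * S * S) := by
      rw [hre]; simp only [← mul_assoc]; rw [hβb]; simp only [smul_mul_assoc]
    have h2 : S * b * S * b * S * β = w • (b * S * b * S * S) := by
      calc S * b * S * b * S * β = S * (b * S * b * S) * β := by simp only [mul_assoc]
        _ = S * (S * b * S) * (b * β) := by rw [← hre]; simp only [mul_assoc]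
        _ = w • (S * (S * b * S * b)) := by rw [hbβ]; simp only [mul_smul_comm, mul_assoc]
        _ = w • (S * (b * S * b * S)) := by rw [hre]
        _ = w • (S * b * S * b * S) := by simp only [mul_assoc]
        _ = _ := by rw [hre]
    exact h1.trans h2.symm
  have hfin : Commute β (S * β * S) := by
    rw [e]
    exact ((hc.mul_right hc).sub_right (hd.smul_right ω)).sub_right (hc.smul_right z)
  have := hfin.eq
  simp only [← mul_assoc] at this
  exact this.symm

theorem one_kronecker_smul (c : Scal) (M : Matrix (Fin n) (Fin n) A) :
    (1 : Matrix (Fin n) (Fin n) A) ⊗ₖ (c • M) = c • ((1 : Matrix (Fin n) (Fin n) A) ⊗ₖ M) :=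
  Matrix.kronecker_smul _ _ _

/-- The cubic relation says that `L² - (a + b) L` acts on `L` by the scalar `-a b`. -/
theorem cubic_mul {L : Matrix (Fin n) (Fin n) A} {a b : ℂ}
    (hp : L * (L - cMat n A a) * (L - cMat n A b) = 0) :
    (L ^ 2 - cMat n A (a + b) * L) * L = (PowerSeries.C (-(a * b)) : Scal) • L := by
  have : (L ^ 2 - cMat n A (a + b) * L) * L - (PowerSeries.C (-(a * b)) : Scal) • L =
      L * (L - cMat n A a) * (L - cMat n A b) := by
    simp only [cMat_eq, map_neg, map_add, map_mul, pow_two]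
    simp only [mul_sub, sub_mul, add_mul, mul_smul_comm, smul_mul_assoc, mul_one, one_mul,
      smul_sub, smul_smul, add_smul, neg_smul, mul_comm (PowerSeries.C b : Scal)]
    abel
  rw [← sub_eq_zero, this, hp]

/-- The polynomial `E² - (a + b) E` of the generating matrix of a quantized bisymmetric orbit
satisfies the relations of a quantized symmetric orbit. -/
theorem symRel_of_bisymRel (r s t : ℕ) (a b : ℂ) {L : Matrix (Fin n) (Fin n) A}
    (h1 : reflectionDefect L = 0) (h2 : L * (L - cMat n A a) * (L - cMat n A b) = 0)
    (h3 : qTrace L = algebraMap Scal A (PowerSeries.C a * qInt r + PowerSeries.C b * qInt s))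
    (h4 : qTrace (L * L) = algebraMap Scal A
          (PowerSeries.C (a + b) * (PowerSeries.C a * qInt r + PowerSeries.C b * qInt s)
            - PowerSeries.C (a * b) * qInt (r + s))) :
    reflectionDefect (L ^ 2 - cMat n A (a + b) * L) = 0 ∧
    (L ^ 2 - cMat n A (a + b) * L - cMat n A (-(a * b))) *
      (L ^ 2 - cMat n A (a + b) * L - cMat n A 0) = 0 ∧
    qTrace (L ^ 2 - cMat n A (a + b) * L) =
      algebraMap Scal A (PowerSeries.C (-(a * b)) * qInt (r + s) + PowerSeries.C 0 * qInt t) := by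
  have hcub := cubic_mul h2
  have hB : L ^ 2 - cMat n A (a + b) * L = L * L - (PowerSeries.C (a + b) : Scal) • L := by
    rw [cMat_eq, smul_mul_assoc, one_mul, pow_two]
  rw [hB] at hcub ⊢
  refine ⟨sub_eq_zero.mpr (reflection_of_quadratic (b := (1 : Matrix (Fin n) (Fin n) A) ⊗ₖ L)
    sMat_mul_sMat (sub_eq_zero.mp h1) (z := PowerSeries.C (a + b)) (w := PowerSeries.C (-(a * b)))
    ?_ ?_), ?_, ?_⟩
  · rw [one_kronecker_mul, ← one_kronecker_smul]
    ext x y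
    simp [mul_sub]
  · rw [one_kronecker_mul, hcub, one_kronecker_smul]
  · set B := L * L - (PowerSeries.C (a + b) : Scal) • L with hBdef
    have h0 : cMat n A 0 = 0 := by rw [cMat_eq]; simp
    have hBB : B * B = (PowerSeries.C (-(a * b)) : Scal) • B := by
      conv_lhs => rw [hBdef, ← hBdef]
      calc B * B = B * L * L - (PowerSeries.C (a + b) : Scal) • (B * L) := by
            conv_lhs => rw [hBdef]
            rw [← hBdef, mul_sub, mul_smul_comm, mul_assoc]
        _ = _ := by rw [hcub, hBdef, smul_mul_assoc, smul_sub, smul_comm]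
    rw [h0, sub_zero, sub_mul, hBB, cMat_eq, smul_mul_assoc, one_mul, sub_self]
  · have : qTrace (L * L - (PowerSeries.C (a + b) : Scal) • L) =
        qTrace (L * L) - (PowerSeries.C (a + b) : Scal) • qTrace L := by
      simp only [qTrace, Matrix.sub_apply, Matrix.smul_apply, smul_sub, Finset.sum_sub_distrib,
        Finset.smul_sum, smul_comm (PowerSeries.C (a + b) : Scal)]
    rw [this, h3, h4, Algebra.smul_def, ← map_mul, ← map_sub]
    congr 1
    simp

end Orbits

/-! ### Conjugacy of semisimple matrices over local rings -/

section Conjugacy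

variable {n : ℕ} {ι : Type} [DecidableEq ι]

/-- The coordinate idempotent of colour `i`. -/
def colourProj (R : Type) [CommRing R] (c : Fin n → ι) (i : ι) : Matrix (Fin n) (Fin n) R :=
  Matrix.diagonal fun j => if c j = i then 1 else 0

theorem colourProj_mul_self {R : Type} [CommRing R] (c : Fin n → ι) (i : ι) :
    colourProj R c i * colourProj R c i = colourProj R c i := by
  rw [colourProj, Matrix.diagonal_mul_diagonal]
  congr 1
  ext j
  split_ifs <;> simp

variable [Fintype ι]

/-- A complete system of orthogonal idempotent matrices, the trace of the `i`-th one being the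
number of basis vectors of colour `i`. -/
structure IsColouredSystem {R : Type} [CommRing R] (c : Fin n → ι)
    (e : ι → Matrix (Fin n) (Fin n) R) : Prop where
  mul : ∀ i j, e i * e j = if i = j then e i else 0
  sum : ∑ i, e i = 1
  trace : ∀ i, (e i).trace = (Fintype.card {j // c j = i} : R)

theorem IsColouredSystem.map {R R' : Type} [CommRing R] [CommRing R'] {c : Fin n → ι}
    {e : ι → Matrix (Fin n) (Fin n) R} (h : IsColouredSystem c e) (f : R →+* R') :
    IsColouredSystem c fun i => (e i).map f where
  mul i j := by
    rw [← Matrix.map_mul, h.mul]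
    split_ifs
    · rfl
    · simp
  sum := by
    have := congrArg f.mapMatrix h.sum
    simpa [map_sum] using this
  trace i := by
    have := congrArg f (h.trace i)
    rw [map_natCast] at this
    rw [← this, Matrix.trace, Matrix.trace, map_sum]
    rfl

/-- Over a field the conjugating matrix is put together from bases of the images of the
idempotents: in characteristic zero their dimensions are given by the traces. -/
theorem exists_conj_field {K : Type} [Field K] [CharZero K] {c : Fin n → ι}
    {e : ι → Matrix (Fin n) (Fin n) K} (h : IsColouredSystem c e) :
    ∃ g : Matrix (Fin n) (Fin n) K, IsUnit g ∧ ∀ i, g * e i = colourProj K c i * g := by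
  have hidem : ∀ i, IsIdempotentElem (Matrix.toLin' (e i)) := by
    intro i
    rw [IsIdempotentElem, Module.End.mul_eq_comp, ← Matrix.toLin'_mul, h.mul, if_pos rfl]
  have hrank : ∀ i, Module.finrank K (LinearMap.range (Matrix.toLin' (e i))) =
      Fintype.card {j // c j = i} := by
    intro i
    have h1 := LinearMap.IsProj.trace (LinearMap.IsIdempotentElem.isProj_range _ (hidem i))
    rw [Matrix.trace_toLin'_eq, h.trace] at h1
    exact_mod_cast h1.symm
  let b : ∀ i, Module.Basis {j // c j = i} K (LinearMap.range (Matrix.toLin' (e i))) := fun i =>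
    (Module.finBasisOfFinrankEq K _ (hrank i)).reindex (Fintype.equivFin _).symm
  let P : Matrix (Fin n) (Fin n) K := Matrix.of fun a j => (b (c j) ⟨j, rfl⟩ : Fin n → K) a
  have hcol : ∀ j, P.col j = (b (c j) ⟨j, rfl⟩ : Fin n → K) := fun j => rfl
  have hmulVec : ∀ i j, (e i).mulVec (P.col j) = if c j = i then P.col j else 0 := by
    intro i j
    obtain ⟨u, hu⟩ := (b (c j) ⟨j, rfl⟩).2
    rw [hcol, ← hu, Matrix.toLin'_apply, Matrix.mulVec_mulVec, h.mul]
    by_cases hij : c j = i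
    · simp [hij]
    · simp [hij, Ne.symm hij]
  have hP : IsUnit P := by
    rw [← Matrix.linearIndependent_cols_iff_isUnit, Fintype.linearIndependent_iff]
    intro x hx j
    have h1 : ∑ k, (if c k = c j then x k • P.col k else 0) = 0 := by
      have := congrArg (Matrix.toLin' (e (c j))) hx
      rw [map_sum, map_zero] at this
      refine Eq.trans (Finset.sum_congr rfl fun k _ => ?_) this
      rw [map_smul, Matrix.toLin'_apply, hmulVec]
      split_ifs <;> simp
    have h2 : ∑ k : {k // c k = c j}, x k.1 • b (c j) k = 0 := by
      apply Subtype.ext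
      rw [Submodule.coe_sum, Submodule.coe_zero, ← h1, ← Finset.sum_filter,
        ← Finset.sum_subtype_of_mem (p := fun k => c k = c j) _ (by simp)]
      rw [Finset.subtype_eq_univ.mpr (by simp)]
      refine Finset.sum_congr rfl fun k _ => ?_
      obtain ⟨k, hk⟩ := k
      rw [hcol]
      have : ∀ (i : ι) (hk : c k = i), (b (c k) ⟨k, rfl⟩ : Fin n → K) = (b i ⟨k, hk⟩ : Fin n → K) := by
        rintro i rfl; rfl
      rw [this _ hk]
      rfl
    exact Fintype.linearIndependent_iff.mp (b (c j)).linearIndependent (fun k => x k.1) h2 ⟨j, rfl⟩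
  have hcomm : ∀ i, e i * P = P * colourProj K c i := by
    intro i
    ext a j
    have h1 : (e i * P) a j = ((e i).mulVec (P.col j)) a := rfl
    rw [h1, hmulVec, colourProj, Matrix.mul_diagonal]
    split_ifs <;> simp
  obtain ⟨u, hu⟩ := hP
  refine ⟨(u⁻¹ : (Matrix (Fin n) (Fin n) K)ˣ).val, Units.isUnit _, fun i => ?_⟩
  rw [Units.inv_mul_eq_iff_eq_mul, ← mul_assoc, hu, ← hcomm, mul_assoc, ← hu, Units.mul_inv,
    mul_one]

/-- Over a local ring the conjugating matrix `g₀` over the residue field is lifted to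
`∑ Dᵢ G eᵢ`, where `G` is any lift of `g₀`. -/
theorem exists_conj_local {R : Type} [CommRing R] [IsLocalRing R] [Algebra ℂ R] {c : Fin n → ι}
    {e : ι → Matrix (Fin n) (Fin n) R} (h : IsColouredSystem c e) :
    ∃ g : Matrix (Fin n) (Fin n) R, IsUnit g ∧ ∀ i, g * e i = colourProj R c i * g := by
  have : CharZero (IsLocalRing.ResidueField R) :=
    charZero_of_injective_algebraMap (algebraMap ℂ (IsLocalRing.ResidueField R)).injective
  set φ := IsLocalRing.residue R
  have hφ : ∀ i, (colourProj R c i).map φ = colourProj _ c i := by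
    intro i
    rw [colourProj, Matrix.diagonal_map (map_zero φ), colourProj]
    congr 1
    ext j
    simp [apply_ite φ]
  obtain ⟨g₀, hg₀, hcomm⟩ := exists_conj_field (h.map φ)
  choose l hl using IsLocalRing.residue_surjective (R := R)
  set G : Matrix (Fin n) (Fin n) R := g₀.map l with hG
  have hGmap : G.map φ = g₀ := by
    ext a b; simp [hG, φ, hl]
  have hmap : (∑ i, colourProj R c i * G * e i).map φ = g₀ := by
    have : (∑ i, colourProj R c i * G * e i).map φ =
        ∑ i, (colourProj R c i * G * e i).map φ := map_sum φ.mapMatrix _ _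
    rw [this]
    calc ∑ i, (colourProj R c i * G * e i).map φ = ∑ i, g₀ * (e i).map φ := by
          refine Finset.sum_congr rfl fun i _ => ?_
          rw [Matrix.map_mul, Matrix.map_mul, hGmap, hφ, mul_assoc, hcomm, ← mul_assoc,
            colourProj_mul_self]
      _ = g₀ := by rw [← Finset.mul_sum, (h.map φ).sum, mul_one]
  refine ⟨∑ i, colourProj R c i * G * e i, ?_, fun i => ?_⟩
  · rw [Matrix.isUnit_iff_isUnit_det, ← IsLocalRing.residue_ne_zero_iff_isUnit]
    have h1 : φ (∑ i, colourProj R c i * G * e i).det = g₀.det := by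
      rw [← hmap, RingHom.map_det]; rfl
    rw [h1]
    exact ((Matrix.isUnit_iff_isUnit_det _).mp hg₀).ne_zero
  · have h1 : (∑ j, colourProj R c j * G * e j) * e i = colourProj R c i * G * e i := by
      rw [Finset.sum_mul, Finset.sum_eq_single i]
      · rw [mul_assoc, h.mul, if_pos rfl]
      · intro j _ hj; rw [mul_assoc, h.mul, if_neg hj, mul_zero]
      · simp
    have h2 : colourProj R c i * (∑ j, colourProj R c j * G * e j) =
        colourProj R c i * G * e i := by
      rw [Finset.mul_sum, Finset.sum_eq_single i]
      · rw [← mul_assoc, ← mul_assoc, colourProj_mul_self]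
      · intro j _ hj
        have : colourProj R c i * colourProj R c j = 0 := by
          rw [colourProj, colourProj, Matrix.diagonal_mul_diagonal, Matrix.diagonal_eq_zero]
          ext k
          by_cases hk : c k = i
          · simp [hk, Ne.symm hj]
          · simp [hk]
        rw [← mul_assoc, ← mul_assoc, this, zero_mul, zero_mul]
      · simp
    rw [h1, h2]

end Conjugacy

/-! ### Polynomials vanishing on an orbit -/

section Vanishing

variable {n : ℕ}

/-- The evaluation of polynomials in the matrix entries at a matrix. -/
def matEval {R : Type} [CommRing R] [Algebra ℂ R] (E : Matrix (Fin n) (Fin n) R) :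
    MvPolynomial (Fin n × Fin n) ℂ →ₐ[ℂ] R := MvPolynomial.aeval fun p => E p.1 p.2

theorem map_matEval {R R' : Type} [CommRing R] [Algebra ℂ R] [CommRing R'] [Algebra ℂ R']
    (E : Matrix (Fin n) (Fin n) R) (φ : R →ₐ[ℂ] R') (f : MvPolynomial (Fin n × Fin n) ℂ) :
    φ (matEval E f) = matEval (E.map φ) f := by
  have : φ.comp (matEval E) = matEval (E.map φ) := by
    ext p; simp [matEval]
  exact DFunLike.congr_fun this f

/-- A polynomial vanishing on a conjugacy class over `ℂ` vanishes at all conjugates of its base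
point over any `ℂ`-algebra: the coordinate ring of `GL(n)` is an integral domain of finite type. -/
theorem matEval_conj_eq_zero {R : Type} [CommRing R] [Algebra ℂ R]
    {D : Matrix (Fin n) (Fin n) ℂ} {f : MvPolynomial (Fin n × Fin n) ℂ}
    (hf : ∀ M ∈ conjOrbit D, matEval M f = 0) {E g : Matrix (Fin n) (Fin n) R}
    (hg : IsUnit g) (h : g * E = D.map (algebraMap ℂ R) * g) : matEval E f = 0 := by
  set X : Matrix (Fin n) (Fin n) (MvPolynomial (Fin n × Fin n) ℂ) := Matrix.mvPolynomialX (Fin n) (Fin n) ℂ with hX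
  set d : MvPolynomial (Fin n × Fin n) ℂ := X.det with hd
  let L := Localization.Away d
  have hdL : IsUnit (algebraMap (MvPolynomial (Fin n × Fin n) ℂ) L d) := IsLocalization.Away.algebraMap_isUnit d
  set XL : Matrix (Fin n) (Fin n) L := X.map (algebraMap (MvPolynomial (Fin n × Fin n) ℂ) L) with hXL
  have hXLu : IsUnit XL := by
    rw [Matrix.isUnit_iff_isUnit_det]
    have : XL.det = algebraMap (MvPolynomial (Fin n × Fin n) ℂ) L d := (RingHom.map_det _ _).symm
    rwa [this]
  obtain ⟨u, hu⟩ := hXLu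
  set Y : Matrix (Fin n) (Fin n) L :=
    (u⁻¹ : (Matrix (Fin n) (Fin n) L)ˣ).val * D.map (algebraMap ℂ L) * XL with hY
  have hXY : XL * Y = D.map (algebraMap ℂ L) * XL := by
    rw [hY, ← mul_assoc, ← mul_assoc, ← hu, Units.mul_inv, one_mul]
  -- The universal conjugate specializes to all conjugates.
  have spec : ∀ (R : Type) [CommRing R] [Algebra ℂ R] (E g : Matrix (Fin n) (Fin n) R),
      IsUnit g → g * E = D.map (algebraMap ℂ R) * g →
      ∃ φ : L →ₐ[ℂ] R, (∀ p : MvPolynomial (Fin n × Fin n) ℂ, φ (algebraMap (MvPolynomial (Fin n × Fin n) ℂ) L p) = matEval g p) ∧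
        φ (matEval Y f) = matEval E f := by
    intro R _ _ E g hg h
    have hgd : IsUnit ((matEval g : (MvPolynomial (Fin n × Fin n) ℂ) →+* R) d) := by
      have : (matEval g : (MvPolynomial (Fin n × Fin n) ℂ) →+* R) d = g.det := by
        rw [hd, RingHom.map_det]
        congr 1
        ext a b
        simp [hX, matEval]
      rw [this]
      exact (Matrix.isUnit_iff_isUnit_det _).mp hg
    let φ : L →ₐ[ℂ] R :=
      { (IsLocalization.Away.lift d hgd : L →+* R) with
        commutes' := fun r => by
          change IsLocalization.Away.lift d hgd (algebraMap ℂ L r) = _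
          rw [IsScalarTower.algebraMap_apply ℂ (MvPolynomial (Fin n × Fin n) ℂ) L, IsLocalization.Away.lift_eq]
          exact (matEval g).commutes r }
    have hφ : ∀ p : MvPolynomial (Fin n × Fin n) ℂ, φ (algebraMap (MvPolynomial (Fin n × Fin n) ℂ) L p) = matEval g p := fun p =>
      IsLocalization.Away.lift_eq d hgd p
    refine ⟨φ, hφ, ?_⟩
    rw [map_matEval]
    congr 1
    have hXg : XL.map φ = g := by
      ext a b
      rw [hXL, Matrix.map_apply, Matrix.map_apply, hφ]
      simp [hX, matEval]
    have hDm : (D.map (algebraMap ℂ L)).map φ = D.map (algebraMap ℂ R) := by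
      ext a b; simp
    have h1 : g * Y.map φ = g * E := by
      have := congrArg (fun M => M.map φ) hXY
      simp only [Matrix.map_mul, hXg, hDm] at this
      rw [this, h]
    exact congrArg matEval (hg.mul_left_cancel h1)
  have hzero : matEval Y f = 0 := by
    obtain ⟨k, p, hp⟩ := IsLocalization.Away.surj d (matEval Y f)
    have hpd : p * d = 0 := by
      refine MvPolynomial.funext fun x => ?_
      set g : Matrix (Fin n) (Fin n) ℂ := Matrix.of fun a b => x (a, b)
      have hx : ∀ q : MvPolynomial (Fin n × Fin n) ℂ, MvPolynomial.eval x q = matEval g q := by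
        intro q
        rw [matEval, MvPolynomial.aeval_def, MvPolynomial.eval, MvPolynomial.coe_eval₂Hom]
        rfl
      have hxd : MvPolynomial.eval x d = g.det := by
        rw [hd, RingHom.map_det]
        congr 1
        ext a b
        simp [hX, g]
      rw [map_mul, map_zero]
      by_cases hg : g.det = 0
      · rw [hxd, hg, mul_zero]
      · have hgu : IsUnit g := (Matrix.isUnit_iff_isUnit_det _).mpr (isUnit_iff_ne_zero.mpr hg)
        obtain ⟨v, hv⟩ := hgu
        obtain ⟨φ, hφ, hφf⟩ := spec ℂ
          ((v⁻¹ : (Matrix (Fin n) (Fin n) ℂ)ˣ).val * D * v.val) v.val v.isUnit (by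
            rw [← mul_assoc, ← mul_assoc, Units.mul_inv, one_mul]
            congr 1)
        rw [hf _ ⟨v, rfl⟩] at hφf
        have := congrArg φ hp
        rw [map_mul, hφf, zero_mul, hφ, hv] at this
        rw [hx p, ← this, zero_mul]
    have hpL : algebraMap (MvPolynomial (Fin n × Fin n) ℂ) L p = 0 := by
      have := congrArg (algebraMap (MvPolynomial (Fin n × Fin n) ℂ) L) hpd
      rw [map_mul, map_zero] at this
      exact (hdL.mul_left_eq_zero).mp this
    rw [hpL] at hp
    exact ((hdL.pow k).mul_left_eq_zero).mp hp
  obtain ⟨φ, -, hφf⟩ := spec R E g hg h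
  rw [← hφf, hzero, map_zero]

variable {ι : Type} [Fintype ι] [DecidableEq ι]

/-- Vanishing is a local property, and over local rings the matrix is conjugate to a diagonal one. -/
theorem matEval_eq_zero_of_system {R : Type} [CommRing R] [Algebra ℂ R] {c : Fin n → ι}
    {v : ι → ℂ} {e : ι → Matrix (Fin n) (Fin n) R} (h : IsColouredSystem c e)
    {f : MvPolynomial (Fin n × Fin n) ℂ}
    (hf : ∀ M ∈ conjOrbit (Matrix.diagonal fun j => v (c j)), matEval M f = 0) :
    matEval (∑ i, v i • e i) f = 0 := by
  refine eq_zero_of_localization _ fun J hJ => ?_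
  let φ : R →ₐ[ℂ] Localization.AtPrime J :=
    IsScalarTower.toAlgHom ℂ R (Localization.AtPrime J)
  change φ _ = 0
  rw [map_matEval]
  obtain ⟨g, hg, hcomm⟩ := exists_conj_local (h.map (φ : R →+* Localization.AtPrime J))
  refine matEval_conj_eq_zero hf hg ?_
  have h1 : (∑ i, v i • e i).map φ = ∑ i, v i • (e i).map φ := by
    have : (∑ i, v i • e i).map φ = φ.mapMatrix (∑ i, v i • e i) := rfl
    rw [this, map_sum]
    simp only [map_smul]
    rfl
  have h2 : (Matrix.diagonal fun j => v (c j)).map (algebraMap ℂ (Localization.AtPrime J)) =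
      ∑ i, v i • colourProj (Localization.AtPrime J) c i := by
    ext a b
    rw [Matrix.sum_apply]
    by_cases hab : a = b
    · subst hab
      simp [colourProj, Algebra.algebraMap_eq_smul_one]
    · simp [colourProj, hab]
  rw [h1, h2, Finset.mul_sum, Finset.sum_mul]
  refine Finset.sum_congr rfl fun i _ => ?_
  rw [mul_smul_comm, smul_mul_assoc]
  exact congrArg _ (hcomm i)

open Polynomial in
/-- A matrix over a commutative `ℂ`-algebra which is annihilated by `∏ (x - v i)`, with the traces
of powers as on the orbit of `diag (v (c j))`, is a scheme-theoretic point of that orbit. The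
idempotents are the Lagrange interpolation polynomials of the matrix. -/
theorem matEval_eq_zero_of_trace [Nonempty ι] {R : Type} [CommRing R] [Algebra ℂ R] {c : Fin n → ι}
    {v : ι → ℂ} (hv : Function.Injective v) (hcard : 2 ≤ Fintype.card ι)
    {E : Matrix (Fin n) (Fin n) R} (hE : aeval E (Lagrange.nodal Finset.univ v) = 0)
    (htr : ∀ k < Fintype.card ι, (E ^ k).trace = algebraMap ℂ R (∑ j, v (c j) ^ k))
    {f : MvPolynomial (Fin n × Fin n) ℂ}
    (hf : ∀ M ∈ conjOrbit (Matrix.diagonal fun j => v (c j)), matEval M f = 0) :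
    matEval E f = 0 := by
  have hinj : Set.InjOn v (Finset.univ : Finset ι) := hv.injOn
  have hmem : ∀ i : ι, i ∈ (Finset.univ : Finset ι) := Finset.mem_univ
  let β : ι → ℂ[X] := Lagrange.basis Finset.univ v
  have hβ : ∀ i k, (β i).eval (v k) = if i = k then 1 else 0 := by
    intro i k
    split_ifs with h
    · subst h; exact Lagrange.eval_basis_self hinj (hmem i)
    · exact Lagrange.eval_basis_of_ne h (hmem k)
  have hvan : ∀ p : ℂ[X], (∀ i, p.eval (v i) = 0) → aeval E p = 0 := by
    intro p hp
    have : Lagrange.nodal Finset.univ v ∣ p := by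
      rw [Lagrange.nodal_eq]
      refine Finset.prod_dvd_of_coprime ?_ fun i _ => dvd_iff_isRoot.mpr (hp i)
      intro i _ j _ hij
      exact pairwise_coprime_X_sub_C hv hij
    obtain ⟨r, rfl⟩ := this
    rw [map_mul, hE, zero_mul]
  have hnat : ∀ p : ℂ[X], p.degree < Fintype.card ι → p.natDegree < Fintype.card ι := by
    intro p hp
    by_cases h0 : p = 0
    · rw [h0, natDegree_zero]; omega
    · exact (natDegree_lt_iff_degree_lt h0).mpr hp
  have htrace : ∀ p : ℂ[X], p.degree < Fintype.card ι →
      (aeval E p).trace = algebraMap ℂ R (∑ j, p.eval (v (c j))) := by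
    intro p hp
    rw [aeval_eq_sum_range' (n := Fintype.card ι) (hnat p hp),
      Matrix.trace_sum]
    have : ∀ j, p.eval (v (c j)) = ∑ k ∈ Finset.range (Fintype.card ι), p.coeff k * v (c j) ^ k :=
      fun j => eval_eq_sum_range' (hnat p hp) _
    simp only [this]
    rw [Finset.sum_comm, map_sum]
    refine Finset.sum_congr rfl fun k hk => ?_
    rw [Matrix.trace_smul, htr k (Finset.mem_range.mp hk), ← Finset.mul_sum, map_mul,
      Algebra.smul_def]
  have hsys : IsColouredSystem c fun i => aeval E (β i) := by
    refine ⟨fun i j => ?_, ?_, fun i => ?_⟩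
    · rw [← map_mul, ← sub_eq_zero]
      split_ifs with h
      · rw [← map_sub]
        refine hvan _ fun k => ?_
        subst h
        simp only [eval_sub, eval_mul, hβ]
        split_ifs <;> simp
      · rw [sub_zero]
        refine hvan _ fun k => ?_
        simp only [eval_mul, hβ]
        split_ifs with h1 h2
        · exact absurd (h1.trans h2.symm) h
        all_goals simp
    · rw [← map_sum, Lagrange.sum_basis hinj Finset.univ_nonempty, map_one]
    · rw [htrace]
      · simp only [hβ]
        rw [Finset.sum_boole, map_natCast, Fintype.card_subtype]
        congr 3
        ext j
        simp [eq_comm]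
      · rw [Lagrange.degree_basis hinj (hmem i), Finset.card_univ]
        exact_mod_cast Nat.sub_lt (by omega) one_pos
  have hEsum : E = ∑ i, v i • aeval E (β i) := by
    have h1 : aeval E (X - ∑ i, v i • β i) = 0 := by
      refine hvan _ fun k => ?_
      simp [eval_finsetSum, hβ]
    rw [map_sub, aeval_X, sub_eq_zero, map_sum] at h1
    simpa only [map_smul] using h1
  rw [hEsum]
  exact matEval_eq_zero_of_system hsys hf

end Vanishing

/-! ### Reduction of the relations modulo `h` -/

section ClassicalRelations

variable {n : ℕ} {R : Type} [Ring R] [Algebra ℂ R]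

/-- Evaluation at the entries of a matrix, with `h` sent to `0`. -/
def classicalEval (E : Matrix (Fin n) (Fin n) R) : CFree (Fin n × Fin n) →+* R :=
  (FreeAlgebra.lift ℂ fun p : Fin n × Fin n => E p.1 p.2 : _ →ₐ[ℂ] R).toRingHom.comp
    PowerSeries.constantCoeff

theorem classicalEval_apply (E : Matrix (Fin n) (Fin n) R) (f : CFree (Fin n × Fin n)) :
    classicalEval E f =
      FreeAlgebra.lift ℂ (fun p : Fin n × Fin n => E p.1 p.2) (PowerSeries.constantCoeff f) := rfl

/-- A `ℂ`-algebra, viewed as a `ℂ⟦h⟧`-algebra on which `h` acts by zero. -/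
abbrev classicalAlgebra (R : Type) [Ring R] [Algebra ℂ R] : Algebra Scal R :=
  Algebra.compHom R (PowerSeries.constantCoeff : Scal →+* ℂ)

theorem classicalEval_algebraMap (E : Matrix (Fin n) (Fin n) R) (c : Scal) :
    classicalEval E (algebraMap Scal (CFree (Fin n × Fin n)) c) =
      algebraMap ℂ R (PowerSeries.constantCoeff c) := by
  have : PowerSeries.constantCoeff (algebraMap Scal (CFree (Fin n × Fin n)) c) =
      algebraMap ℂ (FreeAlgebra ℂ (Fin n × Fin n)) (PowerSeries.constantCoeff c) := by
    rw [← PowerSeries.coeff_zero_eq_constantCoeff_apply,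
      ← PowerSeries.coeff_zero_eq_constantCoeff_apply]
    exact PowerSeries.coeff_map _ 0 c
  rw [classicalEval_apply, this, AlgHom.commutes]

attribute [local instance] classicalAlgebra in
theorem classical_smul (c : Scal) (x : R) : c • x = PowerSeries.constantCoeff c • x := rfl

attribute [local instance] classicalAlgebra in
theorem classical_algebraMap (c : Scal) :
    algebraMap Scal R c = algebraMap ℂ R (PowerSeries.constantCoeff c) := rfl

attribute [local instance] classicalAlgebra in
/-- `classicalEval` as a morphism of `ℂ⟦h⟧`-algebras. -/
def classicalEvalAlgHom (E : Matrix (Fin n) (Fin n) R) : CFree (Fin n × Fin n) →ₐ[Scal] R :=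
  { classicalEval E with commutes' := classicalEval_algebraMap E }

attribute [local instance] classicalAlgebra in
theorem freeGenMatrix_map_classicalEval (E : Matrix (Fin n) (Fin n) R) :
    (freeGenMatrix n).map (classicalEvalAlgHom E) = E := by
  ext i j
  change classicalEval E (gen (i, j)) = _
  simp [classicalEval_apply, gen]

attribute [local instance] classicalAlgebra in
/-- Modulo `h` the braid matrix is the flip, and the reflection equation says that the matrix
entries commute. -/
theorem classical_reflectionDefect (E : Matrix (Fin n) (Fin n) R) :
    reflectionDefect E = 0 ↔ ∀ i j k l, Commute (E i j) (E k l) := by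
  have hl : ∀ (M : Matrix (Fin n × Fin n) (Fin n × Fin n) R) p x,
      (toMat R (sMat n) * M) p x = M p.swap x := by
    intro M p x
    rw [toMat_sMat_mul_apply]
    split_ifs <;> simp [classical_smul, constantCoeff_qpow]
  have hr : ∀ (M : Matrix (Fin n × Fin n) (Fin n × Fin n) R) p x,
      (M * toMat R (sMat n)) p x = M p x.swap := by
    intro M p x
    rw [mul_toMat_sMat_apply]
    split_ifs <;> simp [classical_smul, constantCoeff_qpow]
  have hd : ∀ p x : Fin n × Fin n, reflectionDefect E p x =
      E p.1 x.1 * E p.2 x.2 - E p.2 x.2 * E p.1 x.1 := by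
    intro p x
    simp only [reflectionDefect, Matrix.sub_apply]
    rw [hr, mul_assoc, mul_assoc, hl, mul_assoc]
    simp only [Matrix.mul_apply (M := 1 ⊗ₖ E), hl, Fintype.sum_prod_type]
    simp [Matrix.one_apply]
  constructor
  · intro h i j k l
    have := hd (i, k) (j, l)
    rw [h, Matrix.zero_apply] at this
    exact (sub_eq_zero.mp this.symm)
  · intro h
    ext p x
    rw [hd, Matrix.zero_apply, sub_eq_zero]
    exact h _ _ _ _

attribute [local instance] classicalAlgebra in
theorem classical_qTrace (E : Matrix (Fin n) (Fin n) R) : qTrace E = E.trace := by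
  simp [qTrace, Matrix.trace, classical_smul, constantCoeff_qpow]

attribute [local instance] classicalAlgebra in
theorem classical_cMat (c : ℂ) : cMat n R c = c • 1 := by
  rw [cMat_eq]
  ext i j
  simp [classical_smul]

attribute [local instance] classicalAlgebra in
theorem classicalEval_symRel (r s : ℕ) (a b : ℂ) (E : Matrix (Fin n) (Fin n) R) :
    (∀ x ∈ {x | SymRel n r s a b x}, classicalEval E x = 0) ↔
      (∀ i j k l, Commute (E i j) (E k l)) ∧ (E - a • 1) * (E - b • 1) = 0 ∧
      E.trace = algebraMap ℂ R (a * r + b * s) := by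
  refine (symRel_iff r s a b (classicalEvalAlgHom E)).trans ?_
  rw [freeGenMatrix_map_classicalEval, classical_reflectionDefect, classical_qTrace,
    classical_cMat, classical_cMat, classical_algebraMap]
  simp [constantCoeff_qInt]

attribute [local instance] classicalAlgebra in
theorem classicalEval_bisymRel (r s : ℕ) (a b : ℂ) (E : Matrix (Fin n) (Fin n) R) :
    (∀ x ∈ {x | BisymRel n r s a b x}, classicalEval E x = 0) ↔
      (∀ i j k l, Commute (E i j) (E k l)) ∧ E * (E - a • 1) * (E - b • 1) = 0 ∧
      E.trace = algebraMap ℂ R (a * r + b * s) ∧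
      (E * E).trace = algebraMap ℂ R ((a + b) * (a * r + b * s) - a * b * (r + s)) := by
  refine (bisymRel_iff r s a b (classicalEvalAlgHom E)).trans ?_
  rw [freeGenMatrix_map_classicalEval, classical_reflectionDefect, classical_qTrace,
    classical_qTrace, classical_cMat, classical_cMat, classical_algebraMap, classical_algebraMap]
  simp [constantCoeff_qInt]

end ClassicalRelations

/-! ### Classical limits of presented algebras -/

section ClassicalLimit

variable {n : ℕ}

/-- The coordinate functions on a set of matrices. -/
def coordMatrix (O : Set (Matrix (Fin n) (Fin n) ℂ)) : Matrix (Fin n) (Fin n) (polyFun O) :=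
  fun i j => ⟨fun M => M.val i j, Algebra.subset_adjoin ⟨i, j, rfl⟩⟩

theorem cfree_eq_C_add_X_smul (g : CFree (Fin n × Fin n)) : ∃ b : CFree (Fin n × Fin n),
    g = PowerSeries.C (PowerSeries.constantCoeff g) + (PowerSeries.X : Scal) • b := by
  obtain ⟨b, hb⟩ := PowerSeries.X_dvd_iff.mpr
    (show PowerSeries.constantCoeff (g - PowerSeries.C (PowerSeries.constantCoeff g)) = 0 by simp)
  refine ⟨b, ?_⟩
  rw [Algebra.smul_def, cfree_algebraMap_X, ← hb]
  abel

/-- A morphism to a `ℂ`-algebra that reduces scalars modulo `h` is determined by the images of the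
generators. -/
theorem eq_classicalEval {R : Type} [Ring R] [Algebra ℂ R] {E : Matrix (Fin n) (Fin n) R}
    (θ : CFree (Fin n × Fin n) →+* R)
    (hscal : ∀ c : Scal, θ (algebraMap Scal _ c) = algebraMap ℂ R (PowerSeries.constantCoeff c))
    (hgen : ∀ i j, θ (gen (i, j)) = E i j) (f : CFree (Fin n × Fin n)) :
    θ f = classicalEval E f := by
  obtain ⟨b, hb⟩ := cfree_eq_C_add_X_smul f
  let θ₀ : FreeAlgebra ℂ (Fin n × Fin n) →ₐ[ℂ] R :=
    { θ.comp PowerSeries.C with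
      commutes' := fun c => by
        change θ (PowerSeries.C (algebraMap ℂ _ c)) = _
        rw [← cfree_algebraMap_C, hscal, PowerSeries.constantCoeff_C] }
  have h0 : θ₀ = FreeAlgebra.lift ℂ fun p : Fin n × Fin n => E p.1 p.2 := by
    ext p
    rw [Function.comp_apply, Function.comp_apply, FreeAlgebra.lift_ι_apply]
    exact hgen p.1 p.2
  have h1 : θ ((PowerSeries.X : Scal) • b) = 0 := by
    rw [Algebra.smul_def, map_mul, hscal]
    simp
  rw [classicalEval_apply, ← h0]
  conv_lhs => rw [hb, map_add, h1, add_zero]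
  rfl

/-- An element of the completed free algebra whose constant term is a consequence of the
classical relations is divisible by `h` in the presented algebra. -/
theorem exists_eq_X_smul {s : Set (CFree (Fin n × Fin n))} {f : CFree (Fin n × Fin n)}
    (hf : PowerSeries.constantCoeff f ∈
      TwoSidedIdeal.span ((PowerSeries.constantCoeff : CFree (Fin n × Fin n) →+* _) '' s)) :
    ∃ b, mkP s f = (PowerSeries.X : Scal) • b := by
  let I : TwoSidedIdeal (FreeAlgebra ℂ (Fin n × Fin n)) := TwoSidedIdeal.mk'
    {x | ∃ b, mkP s (PowerSeries.C x) = (PowerSeries.X : Scal) • b}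
    ⟨0, by simp⟩
    (by
      rintro x y ⟨b, hb⟩ ⟨c, hc⟩
      exact ⟨b + c, by rw [map_add, map_add, hb, hc, smul_add]⟩)
    (by
      rintro x ⟨b, hb⟩
      exact ⟨-b, by rw [map_neg, map_neg, hb, smul_neg]⟩)
    (by
      rintro x y ⟨b, hb⟩
      exact ⟨mkP s (PowerSeries.C x) * b, by rw [map_mul, map_mul, hb, mul_smul_comm]⟩)
    (by
      rintro x y ⟨b, hb⟩
      exact ⟨b * mkP s (PowerSeries.C y), by rw [map_mul, map_mul, hb, smul_mul_assoc]⟩)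
  have hI : TwoSidedIdeal.span ((PowerSeries.constantCoeff : CFree (Fin n × Fin n) →+* _) '' s) ≤
      I := by
    refine TwoSidedIdeal.span_le.mpr ?_
    rintro _ ⟨x, hx, rfl⟩
    refine (TwoSidedIdeal.mem_mk' _ _ _ _ _ _ _).mpr ?_
    obtain ⟨b, hb⟩ := cfree_eq_C_add_X_smul x
    refine ⟨-mkP s b, ?_⟩
    have h0 := mkP_eq_zero hx
    rw [hb, map_add, map_smul] at h0
    rw [smul_neg]
    exact eq_neg_of_add_eq_zero_left h0
  obtain ⟨b, hb⟩ := (TwoSidedIdeal.mem_mk' _ _ _ _ _ _ _).mp (hI hf)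
  obtain ⟨c, hc⟩ := cfree_eq_C_add_X_smul f
  refine ⟨b + mkP s c, ?_⟩
  rw [hc, map_add, map_smul, hb, smul_add]

/-- The polynomial of commuting variables underlying a noncommutative polynomial. -/
def toMvPolynomial : FreeAlgebra ℂ (Fin n × Fin n) →ₐ[ℂ] MvPolynomial (Fin n × Fin n) ℂ :=
  FreeAlgebra.lift ℂ MvPolynomial.X

theorem matEval_toMvPolynomial {R : Type} [CommRing R] [Algebra ℂ R]
    (E : Matrix (Fin n) (Fin n) R) (f : FreeAlgebra ℂ (Fin n × Fin n)) :
    matEval E (toMvPolynomial f) = FreeAlgebra.lift ℂ (fun p : Fin n × Fin n => E p.1 p.2) f := by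
  have : (matEval E).comp toMvPolynomial =
      FreeAlgebra.lift ℂ (fun p : Fin n × Fin n => E p.1 p.2) := by
    ext p; simp [matEval, toMvPolynomial]
  exact DFunLike.congr_fun this f

/-- An element of a free algebra that vanishes in all commutative quotients killing `t` lies in
the ideal of `t`, if modulo `t` the generators commute. -/
theorem mem_span_of_lift_eq_zero {t : Set (FreeAlgebra ℂ (Fin n × Fin n))}
    (hcomm : ∀ (R : Type) [Ring R] [Algebra ℂ R] (E : Matrix (Fin n) (Fin n) R),
      (∀ x ∈ t, FreeAlgebra.lift ℂ (fun p : Fin n × Fin n => E p.1 p.2) x = 0) →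
      ∀ i j k l, Commute (E i j) (E k l)) {f : FreeAlgebra ℂ (Fin n × Fin n)}
    (hf : ∀ (R : Type) [CommRing R] [Algebra ℂ R] (E : Matrix (Fin n) (Fin n) R),
      (∀ x ∈ t, FreeAlgebra.lift ℂ (fun p : Fin n × Fin n => E p.1 p.2) x = 0) →
      FreeAlgebra.lift ℂ (fun p : Fin n × Fin n => E p.1 p.2) f = 0) :
    f ∈ TwoSidedIdeal.span t := by
  let Q := (TwoSidedIdeal.span t).ringCon.Quotient
  let m : FreeAlgebra ℂ (Fin n × Fin n) →ₐ[ℂ] Q :=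
    { (TwoSidedIdeal.span t).ringCon.mk' with commutes' := fun _ => rfl }
  have hm0 : ∀ x, m x = 0 ↔ x ∈ TwoSidedIdeal.span t := fun x => by
    rw [TwoSidedIdeal.mem_iff]
    exact RingCon.eq _
  let E : Matrix (Fin n) (Fin n) Q := fun i j => m (FreeAlgebra.ι ℂ (i, j))
  have hE : FreeAlgebra.lift ℂ (fun p : Fin n × Fin n => E p.1 p.2) = m := by
    ext p; simp [E]
  have ht : ∀ x ∈ t, FreeAlgebra.lift ℂ (fun p : Fin n × Fin n => E p.1 p.2) x = 0 := by
    intro x hx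
    rw [hE]
    exact (hm0 x).mpr (TwoSidedIdeal.subset_span hx)
  have hc := hcomm Q E ht
  have hms : Function.Surjective m := fun x => Quotient.inductionOn' x fun y => ⟨y, rfl⟩
  have key : ∀ x y : FreeAlgebra ℂ (Fin n × Fin n), Commute (m x) (m y) := by
    intro x y
    induction x using FreeAlgebra.induction with
    | grade0 r => rw [AlgHom.commutes]; exact Algebra.commutes r _
    | grade1 p =>
      induction y using FreeAlgebra.induction with
      | grade0 r => rw [AlgHom.commutes]; exact (Algebra.commutes r _).symm
      | grade1 p' => exact hc _ _ _ _
      | mul a b ha hb => rw [map_mul]; exact ha.mul_right hb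
      | add a b ha hb => rw [map_add]; exact ha.add_right hb
    | mul a b ha hb => rw [map_mul]; exact ha.mul_left hb
    | add a b ha hb => rw [map_add]; exact ha.add_left hb
  let : CommRing Q :=
    { (inferInstance : Ring Q) with
      mul_comm := fun a b => by
        obtain ⟨x, rfl⟩ := hms a
        obtain ⟨y, rfl⟩ := hms b
        exact key x y }
  have := hf Q E ht
  rw [hE] at this
  exact (hm0 f).mp this

theorem polyFun_hom_surjective {O : Set (Matrix (Fin n) (Fin n) ℂ)}
    (φ : FreeAlgebra ℂ (Fin n × Fin n) →ₐ[ℂ] polyFun O)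
    (hφ : ∀ i j, φ (FreeAlgebra.ι ℂ (i, j)) = coordMatrix O i j) : Function.Surjective φ := by
  have h : polyFun O ≤ ((polyFun O).val.comp φ).range := by
    refine Algebra.adjoin_le ?_
    rintro _ ⟨i, j, rfl⟩
    exact ⟨FreeAlgebra.ι ℂ (i, j), congrArg Subtype.val (hφ i j)⟩
  rintro ⟨x, hx⟩
  obtain ⟨y, hy⟩ := h hx
  exact ⟨y, Subtype.ext hy⟩

/-- If the relations `s` hold modulo `h` on `O`, imply the commutativity of the generators modulo
`h`, and define `O` scheme-theoretically, then the algebra presented by `s` quantizes `O`. -/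
theorem exists_classicalLimit {s : Set (CFree (Fin n × Fin n))}
    {O : Set (Matrix (Fin n) (Fin n) ℂ)}
    (hO : ∀ M ∈ O, ∀ r ∈ s, classicalEval M r = 0)
    (hcomm : ∀ (R : Type) [Ring R] [Algebra ℂ R] (E : Matrix (Fin n) (Fin n) R),
      (∀ r ∈ s, classicalEval E r = 0) → ∀ i j k l, Commute (E i j) (E k l))
    (hvan : ∀ (R : Type) [CommRing R] [Algebra ℂ R] (E : Matrix (Fin n) (Fin n) R),
      (∀ r ∈ s, classicalEval E r = 0) → ∀ f : MvPolynomial (Fin n × Fin n) ℂ,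
        (∀ M ∈ O, matEval M f = 0) → matEval E f = 0) :
    ∃ cl : Presented s →+* polyFun O, IsClassicalLimit (genMatrix s) O cl ∧
      ∀ (f : CFree (Fin n × Fin n)) (M : O),
        (cl (mkP s f) : O → ℂ) M = classicalEval M.val f := by
  have happ : ∀ (f : CFree (Fin n × Fin n)) (M : O),
      (classicalEval (coordMatrix O) f : O → ℂ) M = classicalEval M.val f := by
    intro f M
    let ev : polyFun O →ₐ[ℂ] ℂ := (Pi.evalAlgHom ℂ (fun _ : O => ℂ) M).comp (polyFun O).val
    have : ev.comp (FreeAlgebra.lift ℂ fun p : Fin n × Fin n => coordMatrix O p.1 p.2) =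
        FreeAlgebra.lift ℂ fun p : Fin n × Fin n => M.val p.1 p.2 := by
      ext p; simp [ev, coordMatrix]
    exact DFunLike.congr_fun this (PowerSeries.constantCoeff f)
  have hkill : ∀ f ∈ closedIdeal s, classicalEval (coordMatrix O) f = 0 := by
    intro f hf
    have h1 := mem_closedIdeal.mp hf 1
    have h2 : f ∈ TwoSidedIdeal.ker (classicalEval (coordMatrix O)) := by
      refine TwoSidedIdeal.span_le.mpr ?_ h1
      rintro x (hx | rfl)
      · refine (TwoSidedIdeal.mem_ker _).mpr (Subtype.ext (funext fun M => ?_))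
        rw [happ, hO M.val M.2 x hx]
        rfl
      · refine (TwoSidedIdeal.mem_ker _).mpr ?_
        simp [classicalEval_apply]
    exact (TwoSidedIdeal.mem_ker _).mp h2
  let cl : Presented s →+* polyFun O :=
    (closedIdeal s).ringCon.lift (classicalEval (coordMatrix O)) fun x y hxy => by
      have := hkill (x - y) ((TwoSidedIdeal.rel_iff _ _ _).mp hxy)
      rw [map_sub, sub_eq_zero] at this
      exact this
  have hcl : ∀ f, cl (mkP s f) = classicalEval (coordMatrix O) f := fun f => rfl
  refine ⟨cl, ⟨fun c => ?_, fun i j M => ?_, fun x => ?_, fun a => ⟨fun h => ?_, ?_⟩⟩,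
    fun f M => by rw [hcl, happ]⟩
  · rw [← (mkP s).commutes, hcl, classicalEval_algebraMap]
  · rw [genMatrix_apply, hcl, happ]
    simp [classicalEval_apply, gen]
  · obtain ⟨y, hy⟩ := polyFun_hom_surjective
      (FreeAlgebra.lift ℂ fun p : Fin n × Fin n => coordMatrix O p.1 p.2)
      (fun i j => by simp) x
    exact ⟨mkP s (PowerSeries.C y), by rw [hcl, classicalEval_apply, ← hy]; simp⟩
  · obtain ⟨f, rfl⟩ := mkP_surjective (s := s) a
    refine exists_eq_X_smul (mem_span_of_lift_eq_zero (fun R _ _ E hE => ?_) fun R _ _ E hE => ?_)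
    · exact hcomm R E fun r hr => hE _ ⟨r, hr, rfl⟩
    · rw [← matEval_toMvPolynomial]
      refine hvan R E (fun r hr => hE _ ⟨r, hr, rfl⟩) _ fun M hM => ?_
      rw [matEval_toMvPolynomial, ← classicalEval_apply, ← happ f ⟨M, hM⟩, ← hcl, h]
      rfl
  · rintro ⟨b, rfl⟩
    rw [Algebra.smul_def, map_mul, ← (mkP s).commutes, hcl, classicalEval_algebraMap]
    simp

end ClassicalLimit

/-! ### The classical limits of the two quantized orbits -/

section ClassicalOrbits

section Conjugates

variable {n : ℕ} (g : GL (Fin n) ℂ) (A B : Matrix (Fin n) (Fin n) ℂ)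

theorem conj_mul_conj : ((g⁻¹ : GL (Fin n) ℂ).val * A * g.val) * ((g⁻¹ : GL (Fin n) ℂ).val * B *
    g.val) = (g⁻¹ : GL (Fin n) ℂ).val * (A * B) * g.val := by
  calc _ = (g⁻¹ : GL (Fin n) ℂ).val * A * (g.val * (g⁻¹ : GL (Fin n) ℂ).val) * B * g.val := by
        simp only [mul_assoc]
    _ = _ := by rw [Units.mul_inv, mul_one]; simp only [mul_assoc]

theorem conj_sub_smul_one (a : ℂ) : (g⁻¹ : GL (Fin n) ℂ).val * A * g.val - a • 1 =
    (g⁻¹ : GL (Fin n) ℂ).val * (A - a • 1) * g.val := by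
  rw [mul_sub, sub_mul, mul_smul_comm, mul_one, smul_mul_assoc, Units.inv_mul]

end Conjugates

theorem aeval_X_sub_C {n : ℕ} {ι : Type} [Fintype ι] {R : Type} [CommRing R] [Algebra ℂ R]
    (v : ι → ℂ) (E : Matrix (Fin n) (Fin n) R) (i : ι) :
    Polynomial.aeval E (Polynomial.X - Polynomial.C (v i)) = E - v i • 1 := by
  simp [Algebra.algebraMap_eq_smul_one]

/-- The colouring of the basis by the two eigenvalues of the symmetric orbit. -/
def symColour (r s : ℕ) (j : Fin (r + s)) : Fin 2 := if j.val < r then 0 else 1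

theorem symPoint_eq (r s : ℕ) (a b : ℂ) :
    symPoint r s a b = Matrix.diagonal fun j => ![a, b] (symColour r s j) := by
  rw [symPoint]
  congr 1
  ext j
  rw [symColour]
  split_ifs <;> rfl

theorem sum_symColour (r s : ℕ) (w : Fin 2 → ℂ) :
    ∑ j, w (symColour r s j) = w 0 * r + w 1 * s := by
  rw [Fin.sum_univ_add]
  simp [symColour, mul_comm]

/-- The colouring of the basis by the three eigenvalues of the bisymmetric orbit. -/
def bisymColour (l m k : ℕ) (j : Fin (l + m + k)) : Fin 3 :=
  if j.val < l then 0 else if j.val < l + m then 1 else 2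

theorem bisymPoint_eq (l m k : ℕ) (a b : ℂ) :
    bisymPoint l m k a b = Matrix.diagonal fun j => ![a, b, 0] (bisymColour l m k j) := by
  rw [bisymPoint]
  congr 1
  ext j
  rw [bisymColour]
  split_ifs <;> rfl

theorem sum_bisymColour (l m k : ℕ) (w : Fin 3 → ℂ) :
    ∑ j, w (bisymColour l m k j) = w 0 * l + w 1 * m + w 2 * k := by
  rw [Fin.sum_univ_add, Fin.sum_univ_add]
  simp [bisymColour, mul_comm, add_assoc]

theorem symRel_of_mem_orbit {r s : ℕ} {a b : ℂ} {M : Matrix (Fin (r + s)) (Fin (r + s)) ℂ}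
    (hM : M ∈ conjOrbit (symPoint r s a b)) :
    ∀ x ∈ {x | SymRel (r + s) r s a b x}, classicalEval M x = 0 := by
  obtain ⟨g, rfl⟩ := hM
  refine (classicalEval_symRel r s a b _).mpr ⟨fun _ _ _ _ => Commute.all _ _, ?_, ?_⟩
  · have : (symPoint r s a b - a • 1) * (symPoint r s a b - b • 1) = 0 := by
      rw [symPoint, Matrix.smul_one_eq_diagonal, Matrix.smul_one_eq_diagonal,
        Matrix.diagonal_sub, Matrix.diagonal_sub, Matrix.diagonal_mul_diagonal,
        Matrix.diagonal_eq_zero]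
      ext j
      simp only [Pi.zero_apply]
      split_ifs <;> simp
    rw [conj_sub_smul_one, conj_sub_smul_one, conj_mul_conj, this, mul_zero, zero_mul]
  · rw [Matrix.trace_units_conj', symPoint_eq, Matrix.trace_diagonal,
      sum_symColour r s ![a, b]]
    rfl

theorem bisymRel_of_mem_orbit {l m k : ℕ} {a b : ℂ}
    {M : Matrix (Fin (l + m + k)) (Fin (l + m + k)) ℂ} (hM : M ∈ conjOrbit (bisymPoint l m k a b)) :
    ∀ x ∈ {x | BisymRel (l + m + k) l m a b x}, classicalEval M x = 0 := by
  obtain ⟨g, rfl⟩ := hM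
  refine (classicalEval_bisymRel l m a b _).mpr ⟨fun _ _ _ _ => Commute.all _ _, ?_, ?_, ?_⟩
  · have : bisymPoint l m k a b * (bisymPoint l m k a b - a • 1) *
        (bisymPoint l m k a b - b • 1) = 0 := by
      rw [bisymPoint, Matrix.smul_one_eq_diagonal, Matrix.smul_one_eq_diagonal,
        Matrix.diagonal_sub, Matrix.diagonal_sub, Matrix.diagonal_mul_diagonal,
        Matrix.diagonal_mul_diagonal, Matrix.diagonal_eq_zero]
      ext j
      simp only [Pi.zero_apply]
      split_ifs <;> simp
    rw [conj_sub_smul_one, conj_sub_smul_one, conj_mul_conj, conj_mul_conj, this, mul_zero,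
      zero_mul]
  · rw [Matrix.trace_units_conj', bisymPoint_eq, Matrix.trace_diagonal,
      sum_bisymColour l m k ![a, b, 0]]
    simp
  · rw [conj_mul_conj, Matrix.trace_units_conj', bisymPoint_eq, Matrix.diagonal_mul_diagonal,
      Matrix.trace_diagonal, sum_bisymColour l m k fun i => ![a, b, 0] i * ![a, b, 0] i]
    simp
    ring

theorem exists_classicalLimit_sym (r s : ℕ) {a b : ℂ} (hab : a ≠ b) :
    ∃ cl : SymOrbitAlg r s a b →+* polyFun (conjOrbit (symPoint r s a b)),
      IsClassicalLimit (symMatrix r s a b) _ cl ∧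
      ∀ f M, (cl (mkP _ f) : conjOrbit (symPoint r s a b) → ℂ) M = classicalEval M.val f := by
  refine exists_classicalLimit (fun M hM => symRel_of_mem_orbit hM)
    (fun R _ _ E hE => ((classicalEval_symRel r s a b E).mp hE).1) fun R _ _ E hE f hf => ?_
  obtain ⟨-, hpoly, htr⟩ := (classicalEval_symRel r s a b E).mp hE
  rw [symPoint_eq] at hf
  refine matEval_eq_zero_of_trace (v := ![a, b]) ?_ (by simp) ?_ ?_ hf
  · intro i j hij
    fin_cases i <;> fin_cases j <;> simp_all
  · rw [Lagrange.nodal, Fin.prod_univ_two, map_mul, aeval_X_sub_C, aeval_X_sub_C]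
    exact hpoly
  · intro d hd
    rw [Fintype.card_fin] at hd
    rw [sum_symColour r s fun i => ![a, b] i ^ d]
    interval_cases d
    · simp
    · simpa using htr

theorem exists_classicalLimit_bisym (l m k : ℕ) {a b : ℂ} (hab : a ≠ b) (ha : a ≠ 0) (hb : b ≠ 0) :
    ∃ cl : BisymOrbitAlg l m k a b →+* polyFun (conjOrbit (bisymPoint l m k a b)),
      IsClassicalLimit (bisymMatrix l m k a b) _ cl ∧
      ∀ f M, (cl (mkP _ f) : conjOrbit (bisymPoint l m k a b) → ℂ) M = classicalEval M.val f := by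
  refine exists_classicalLimit (fun M hM => bisymRel_of_mem_orbit hM)
    (fun R _ _ E hE => ((classicalEval_bisymRel l m a b E).mp hE).1) fun R _ _ E hE f hf => ?_
  obtain ⟨-, hpoly, htr, htr2⟩ := (classicalEval_bisymRel l m a b E).mp hE
  rw [bisymPoint_eq] at hf
  refine matEval_eq_zero_of_trace (v := ![a, b, 0]) ?_ (by simp) ?_ ?_ hf
  · intro i j hij
    fin_cases i <;> fin_cases j <;> simp_all
  · rw [Lagrange.nodal, Fin.prod_univ_three, map_mul, map_mul, aeval_X_sub_C, aeval_X_sub_C,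
      aeval_X_sub_C]
    have hE0 : E - (![a, b, 0] : Fin 3 → ℂ) 2 • 1 = E := by simp
    have hcomm : Commute ((E - a • 1) * (E - b • 1)) E := by
      have h : ∀ z : ℂ, Commute (E - z • 1) E := fun z =>
        (Commute.refl E).sub_left ((Commute.one_left E).smul_left z)
      exact (h a).mul_left (h b)
    rw [hE0]
    exact hcomm.eq.trans ((mul_assoc _ _ _).symm.trans hpoly)
  · intro d hd
    rw [Fintype.card_fin] at hd
    rw [sum_bisymColour l m k fun i => ![a, b, 0] i ^ d]
    interval_cases d
    · simp
    · simpa using htr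
    · rw [pow_two, htr2]
      congr 1
      simp
      ring

theorem bisymPoint_quadratic (l m k : ℕ) (a b : ℂ) :
    bisymPoint l m k a b * bisymPoint l m k a b - (a + b) • bisymPoint l m k a b =
      symPoint (l + m) k (-(a * b)) 0 := by
  rw [bisymPoint, Matrix.diagonal_mul_diagonal, ← Matrix.diagonal_smul, Matrix.diagonal_sub,
    symPoint]
  congr 1
  ext j
  simp only [Pi.smul_apply, smul_eq_mul]
  split_ifs <;> first | omega | ring

theorem conj_quadratic {n : ℕ} (g : GL (Fin n) ℂ) (A : Matrix (Fin n) (Fin n) ℂ) (c : ℂ) :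
    ((g⁻¹ : GL (Fin n) ℂ).val * A * g.val) * ((g⁻¹ : GL (Fin n) ℂ).val * A * g.val) -
      c • ((g⁻¹ : GL (Fin n) ℂ).val * A * g.val) =
      (g⁻¹ : GL (Fin n) ℂ).val * (A * A - c • A) * g.val := by
  rw [conj_mul_conj, mul_sub, sub_mul, mul_smul_comm, smul_mul_assoc]

/-- The bundle map `M ↦ M² - (a + b) M` between the orbits: it sends `g⁻¹ D g` to `g⁻¹ D' g`. -/
def bundleMap (l m k : ℕ) (a b : ℂ) (M : conjOrbit (bisymPoint l m k a b)) :
    conjOrbit (symPoint (l + m) k (-(a * b)) 0) :=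
  ⟨M.val * M.val - (a + b) • M.val, by
    obtain ⟨M, g, rfl⟩ := M
    exact ⟨g, by rw [conj_quadratic, bisymPoint_quadratic]⟩⟩

theorem bundleMap_conj (l m k : ℕ) (a b : ℂ) (M : conjOrbit (bisymPoint l m k a b))
    (g : GL (Fin (l + m + k)) ℂ)
    (h : M.val = (g⁻¹ : GL (Fin (l + m + k)) ℂ).val * bisymPoint l m k a b * g.val) :
    (bundleMap l m k a b M).val =
      (g⁻¹ : GL (Fin (l + m + k)) ℂ).val * symPoint (l + m) k (-(a * b)) 0 * g.val := by
  change M.val * M.val - (a + b) • M.val = _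
  rw [h, conj_quadratic, bisymPoint_quadratic]

end ClassicalOrbits

/-! ### The morphism of quantized orbits -/

section OrbitMorphism

/-- The morphism of quantized orbits with `B ↦ E² - (a + b) E`. -/
theorem exists_orbitMorphism (l m k : ℕ) (a b : ℂ) :
    ∃ π : SymOrbitAlg (l + m) k (-(a * b)) 0 →ₐ[Scal] BisymOrbitAlg l m k a b,
      (symMatrix (l + m) k (-(a * b)) 0).map π =
        bisymMatrix l m k a b ^ 2 - cMat (l + m + k) _ (a + b) * bisymMatrix l m k a b := by
  obtain ⟨h1, h2, h3, h4⟩ := (bisymRel_iff l m a b (mkP {x | BisymRel (l + m + k) l m a b x})).mp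
    fun x hx => mkP_eq_zero hx
  set B := bisymMatrix l m k a b ^ 2 - cMat (l + m + k) _ (a + b) * bisymMatrix l m k a b with hB
  have hmap : (freeGenMatrix (l + m + k)).map (eval fun x => B x.1 x.2) = B := by
    ext i j
    simp [freeGenMatrix]
  have hrel := (symRel_iff (l + m) k (-(a * b)) 0 (eval fun x => B x.1 x.2)).mpr (by
    rw [hmap]
    exact symRel_of_bisymRel l m k a b h1 h2 h3 h4)
  exact ⟨liftP _ hrel, hmap⟩

end OrbitMorphism

end QuantumOrbit

end

theorem theorem4p9 (l m k : ℕ) (hl : 0 < l) (hm : 0 < m) (hk : 0 < k)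
    (lam mu : ℂ) (hne : lam ≠ mu) (hlam : lam ≠ 0) (hmu : mu ≠ 0) :
    -- the quantum group action on the two quantized orbits, and the morphism
    ∃ (actB : Uh (l + m + k) →ₐ[Scal] Module.End Scal (SymOrbitAlg (l + m) k (-(lam * mu)) 0))
      (actE : Uh (l + m + k) →ₐ[Scal] Module.End Scal (BisymOrbitAlg l m k lam mu))
      (π : SymOrbitAlg (l + m) k (-(lam * mu)) 0 →ₐ[Scal] BisymOrbitAlg l m k lam mu),
      -- the actions are the unique module algebra structures extending the coadjoint action
      (IsModuleAlgebra actB ∧ IsCoadjointOn actB (symMatrix (l + m) k (-(lam * mu)) 0) ∧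
        ∀ act, IsModuleAlgebra act →
          IsCoadjointOn act (symMatrix (l + m) k (-(lam * mu)) 0) → act = actB) ∧
      (IsModuleAlgebra actE ∧ IsCoadjointOn actE (bisymMatrix l m k lam mu) ∧
        ∀ act, IsModuleAlgebra act →
          IsCoadjointOn act (bisymMatrix l m k lam mu) → act = actE) ∧
      -- `π` is the unique algebra morphism with `π(B) = E² - (λ + μ) E`
      ((symMatrix (l + m) k (-(lam * mu)) 0).map π =
          bisymMatrix l m k lam mu ^ 2 -
            cMat (l + m + k) _ (lam + mu) * bisymMatrix l m k lam mu ∧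
        ∀ π' : SymOrbitAlg (l + m) k (-(lam * mu)) 0 →ₐ[Scal] BisymOrbitAlg l m k lam mu,
          (symMatrix (l + m) k (-(lam * mu)) 0).map π' =
            bisymMatrix l m k lam mu ^ 2 -
              cMat (l + m + k) _ (lam + mu) * bisymMatrix l m k lam mu → π' = π) ∧
      -- `π` is equivariant
      (∀ (x : Uh (l + m + k)) (b : SymOrbitAlg (l + m) k (-(lam * mu)) 0),
        π (actB x b) = actE x (π b)) ∧
      -- modulo `h` it is the pullback along the bundle map of the classical orbits
      ∃ (clB : SymOrbitAlg (l + m) k (-(lam * mu)) 0 →+*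
            polyFun (conjOrbit (symPoint (l + m) k (-(lam * mu)) 0)))
        (clE : BisymOrbitAlg l m k lam mu →+* polyFun (conjOrbit (bisymPoint l m k lam mu)))
        (p : conjOrbit (bisymPoint l m k lam mu) →
            conjOrbit (symPoint (l + m) k (-(lam * mu)) 0)),
        IsClassicalLimit (symMatrix (l + m) k (-(lam * mu)) 0) _ clB ∧
        IsClassicalLimit (bisymMatrix l m k lam mu) _ clE ∧
        (∀ (M : conjOrbit (bisymPoint l m k lam mu)) (g : GL (Fin (l + m + k)) ℂ),
          M.val = (g⁻¹ : GL (Fin (l + m + k)) ℂ).val * bisymPoint l m k lam mu * g.val →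
          (p M).val = (g⁻¹ : GL (Fin (l + m + k)) ℂ).val *
            symPoint (l + m) k (-(lam * mu)) 0 * g.val) ∧
        ∀ (b : SymOrbitAlg (l + m) k (-(lam * mu)) 0) (M : conjOrbit (bisymPoint l m k lam mu)),
          (clE (π b) : conjOrbit (bisymPoint l m k lam mu) → ℂ) M =
            (clB b : conjOrbit (symPoint (l + m) k (-(lam * mu)) 0) → ℂ) (p M) := by
  obtain ⟨actB, haB, hcB, -, -⟩ :=
    exists_action (gaugeInvariant_symRel (n := l + m + k) (l + m) k (-(lam * mu)) 0)
  obtain ⟨actE, haE, hcE, hK, hKinv⟩ :=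
    exists_action (gaugeInvariant_bisymRel (n := l + m + k) l m lam mu)
  obtain ⟨π, hπ⟩ := exists_orbitMorphism l m k lam mu
  obtain ⟨clB, hclB, hclB'⟩ := exists_classicalLimit_sym (l + m) k
    (a := -(lam * mu)) (b := 0) (neg_ne_zero.mpr (mul_ne_zero hlam hmu))
  obtain ⟨clE, hclE, -⟩ := exists_classicalLimit_bisym l m k hne hlam hmu
  have hπ' : (symMatrix (l + m) k (-(lam * mu)) 0).map π =
      bisymMatrix l m k lam mu * bisymMatrix l m k lam mu -
        (PowerSeries.C (lam + mu) : Scal) • bisymMatrix l m k lam mu := by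
    rw [hπ, cMat_eq, smul_mul_assoc, one_mul, pow_two]
  refine ⟨actB, actE, π, ⟨haB, hcB, fun act ha hc => action_unique ha hc haB hcB⟩,
    ⟨haE, hcE, fun act ha hc => action_unique ha hc haE hcE⟩, ⟨hπ, fun π' h' => ?_⟩,
    equivariant_of_coadjoint haB haE hcB π ?_,
    clB, clE, bundleMap l m k lam mu, hclB, hclE, bundleMap_conj l m k lam mu, ?_⟩
  · exact presented_algHom_ext fun x => congrFun (congrFun (h'.trans hπ.symm) x.1) x.2
  · exact hπ' ▸ (IsCoadjointOn.mul haE hcE hcE hK hKinv).sub_smul hcE _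
  · intro b M
    obtain ⟨f, rfl⟩ := mkP_surjective b
    rw [hclB']
    -- Evaluation at `M` is a character of the quantized orbit in which `h` is zero.
    let ev : polyFun (conjOrbit (bisymPoint l m k lam mu)) →ₐ[ℂ] ℂ :=
      (Pi.evalAlgHom ℂ (fun _ => ℂ) M).comp (polyFun _).val
    refine eq_classicalEval (((ev : _ →+* ℂ).comp clE).comp ((π.comp (mkP _) : _ →+* _)))
      (fun c => ?_) (fun i j => ?_) f
    · change ev (clE ((π.comp (mkP _)) (algebraMap Scal _ c))) = _
      rw [AlgHom.commutes, hclE.scalars, AlgHom.commutes]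
    · change ev (clE ((symMatrix (l + m) k (-(lam * mu)) 0).map π i j)) = _
      have hent : ∀ i j, ev (clE (bisymMatrix l m k lam mu i j)) = M.val i j :=
        fun i j => hclE.entries i j M
      rw [hπ', Matrix.sub_apply, Matrix.mul_apply, Matrix.smul_apply, Algebra.smul_def]
      simp only [map_sub, map_sum, map_mul, hent, hclE.scalars, AlgHom.commutes]
      simp [bundleMap, Matrix.mul_apply]
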